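/- Setting. Let $d\ge 1$, let $\{0,\dots,d-1\}^{\mathbb N}$ carry the product topology, and let $\sigma(x)_n=x_{n+1}$ be the shift. A shift space is a closed set $X\subset\{0,\dots,d-1\}^{\mathbb N}$ with $\sigma(X)\subset X$. For a finite word $w$ of length $|w|$, let $[w]$ be the set of $x\in X$ that begin with $w$, and let $\mathcal L=\{w : [w]\ne\emptyset\}$ be the language of $X$ (containing the empty word). For $\varphi\colon X\to\mathbb R$ put $S_n\varphi(x)=\sum_{k=0}^{n-1}\varphi(\sigma^kx)$, $\varphi_n(w)=\sup_{x\in[w]}S_n\varphi(x)$ for $w\in\mathcal L$ with $|w|=n$, and, for $\mathcal D\subset\mathcal L$, $\Lambda_n(\mathcal D,\varphi)=\sum_{w\in\mathcal D,\,|w|=n}e^{\varphi_n(w)}$. The pressure is $P(X,\varphi)=\limsup_{n\to\infty}\frac1n\log\Lambda_n(\mathcal L,\varphi)$. The function $\varphi$ has the Bowen property on $\mathcal D$ if there is $V<\infty$ such that $|S_{|w|}\varphi(x)-S_{|w|}\varphi(y)|\le V$ for all $w\in\mathcal D$ and $x,y\in[w]$; it has the Bowen property if this holds on $\mathcal L$.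 An equilibrium state for $\varphi$ is a $\sigma$-invariant Borel probability measure on $X$ that maximises $h(\mu)+\int\varphi\,d\mu$ among all $\sigma$-invariant Borel probability measures, where $h$ is the Kolmogorov–Sinai entropy. For $n\geq 1$, $\mathrm{Per}_n=\{x\in X:\sigma^nx=x\}$. A collection $\mathcal D\subset\mathcal L$ has specification with gap size $t\in\mathbb N$ if for all $m\ge1$ and $w^1,\dots,w^m\in\mathcal D$ there are $v^1,\dots,v^{m-1}\in\mathcal L$ of length $t$ with $z=w^1v^1w^2\cdots v^{m-1}w^m\in\mathcal L$; it has periodic specification if in addition $z$ can be chosen so that $[z]$ contains a point $x$ with $\sigma^{|z|+t}x=x$. The shift space $X$ has the specification property if $\mathcal L$ has specification with some gap size. For $\beta>1$ let $w^\beta$ be the infinite greedy $\beta$-expansion of $1$: $r_0=1$, $w^\beta_{n+1}=\lceil\beta r_n\rceil-1$, $r_{n+1}=\beta r_n-w^\beta_{n+1}$. The $\beta$-shift is the set of all $x\in\{0,\dots,\lceil\beta\rceil-1\}^{\mathbb N}$ such that $\sigma^kx$ is lexicographically at most $w^\beta$ for all $k\ge0$. A measure $\mu$ is weak Gibbs for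 $\varphi$ if there are $\mathcal C^p,\mathcal G,\mathcal C^s\subset\mathcal L$ such that every word of $\mathcal L$ is a concatenation $uvw$ with $u\in\mathcal C^p$, $v\in\mathcal G$, $w\in\mathcal C^s$, and, with $\mathcal G(M)=\{uvw\in\mathcal L: u\in\mathcal C^p,v\in\mathcal G,w\in\mathcal C^s,|u|\le M,|w|\le M\}$: (i) for every $M\in\mathbb N$, $\mathcal G(M)$ has periodic specification with some gap size; (ii) $\varphi$ has the Bowen property on $\mathcal G$; (iii) $\sum_{n\ge1}\Lambda_n(\mathcal C^p\cup\mathcal C^s,\varphi)e^{-nP(X,\varphi)}<\infty$; (iv) there are constants $K'>0$ and $K_M>0$ ($M\in\mathbb N$) such that for all $M,n\in\mathbb N$ and all $w\in\mathcal G(M)$ of length $n$, $$K_M\le\frac{\mu([w])}{e^{-nP(X,\varphi)+\varphi_n(w)}}\le K'.$$ Theorem. Let $X$ be a $\beta$-shift for some $\beta>1$, or a shift space with the specification property, and suppose that $X$ contains the fixed point $0=000\cdots$ and $X\ne\{0\}$. For $x\neq0$ let $k(x)$ be the number of initial $0$s of $x$. Let $\varphi=\varphi_r+\varphi_0$, where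 $\varphi_r\colon X\to\mathbb R$ is continuous and has the Bowen property, $\varphi_0(0)=0$, and $\varphi_0(x)=a_{k(x)}$ for $x\ne0$, for some real sequence $(a_n)_{n\ge 0}$ with $a_n\to0$. If the partial sums $\sum_{n=1}^Na_n$ are unbounded (that is, $\sup_N|\sum_{n=1}^Na_n|=\infty$), then $\varphi$ does not have the Bowen property. Nevertheless, if $\varphi(0)<P(X,\varphi)$, then $\varphi$ has a unique equilibrium state $\mu_\varphi$; it is weak Gibbs for $\varphi$, and it is the weak* limit, as $n\to\infty$, of the periodic orbit measures $$\frac1{\sum_{x\in\mathrm{Per}_n}e^{S_n\varphi(x)}}\sum_{x\in\mathrm{Per}_n}e^{S_n\varphi(x)}\delta_x.$$ -/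

import Mathlib

open MeasureTheory Filter Topology SymbolicDynamics.FullShift

noncomputable section

namespace Thermo

/-! ### One-sided shift spaces and their languages -/

/-- The shift map `(σ x)_n = x_{n+1}` of a one-sided shift space `X`, as a self-map of `X`. -/
def shiftMap {d : ℕ} (X : Subshift (Fin d) ℕ) : X.carrier → X.carrier :=
  (X.mapsTo 1).restrict (shift 1) X.carrier X.carrier

/-- The cylinder `[w]` of the points of `X` that begin with the word `w`. -/
def cyl {d : ℕ} (X : Subshift (Fin d) ℕ) (w : List (Fin d)) : Set X.carrier :=
  {x | ∀ i : Fin w.length, x.1 i = w.get i}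

/-- The language of `X`: the finite words with nonempty cylinder (the empty word included). -/
def language {d : ℕ} (X : Subshift (Fin d) ℕ) : Set (List (Fin d)) :=
  {w | (cyl X w).Nonempty}

/-- The word `w⁰ v⁰ w¹ v¹ ⋯ v^{m-1} w^m`. -/
def glue {α : Type*} {m : ℕ} (w : Fin (m + 1) → List α) (v : Fin m → List α) : List α :=
  w 0 ++ (List.ofFn fun i : Fin m => v i ++ w i.succ).flatten

/-- (S)-specification on a collection of words `G`, with gap size `t`. -/
def HasSpecificationOn {d : ℕ} (X : Subshift (Fin d) ℕ) (G : Set (List (Fin d))) (t : ℕ) : Prop :=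
  ∀ (m : ℕ) (w : Fin (m + 1) → List (Fin d)), (∀ i, w i ∈ G) →
    ∃ v : Fin m → List (Fin d), (∀ i, v i ∈ language X ∧ (v i).length = t) ∧
      glue w v ∈ language X

/-- (Per)-specification on a collection of words `G`, with gap size `t`: the glued word can
moreover be chosen so that its cylinder contains a point whose period is its length plus `t`. -/
def HasPerSpecificationOn {d : ℕ} (X : Subshift (Fin d) ℕ) (G : Set (List (Fin d))) (t : ℕ) :
    Prop :=
  ∀ (m : ℕ) (w : Fin (m + 1) → List (Fin d)), (∀ i, w i ∈ G) →
    ∃ v : Fin m → List (Fin d), (∀ i, v i ∈ language X ∧ (v i).length = t) ∧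
      glue w v ∈ language X ∧
      ∃ x ∈ cyl X (glue w v), Function.IsPeriodicPt (shiftMap X) ((glue w v).length + t) x

/-- The classical specification property of a shift space. -/
def HasSpecification {d : ℕ} (X : Subshift (Fin d) ℕ) : Prop :=
  ∃ t : ℕ, HasSpecificationOn X (language X) t

/-! ### β-shifts -/

/-- The remainders `r₀ = 1`, `r_{n+1} = β r_n - (⌈β r_n⌉ - 1) ∈ (0, 1]` of the expansion of `1`. -/
def betaRemainder (β : ℝ) : ℕ → ℝ
  | 0 => 1
  | n + 1 => β * betaRemainder β n - ((⌈β * betaRemainder β n⌉ - 1 : ℤ) : ℝ)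

/-- The digits `w^β_{n+1} = ⌈β r_n⌉ - 1` of the (infinite) greedy `β`-expansion of `1`: at every
step the largest digit that leaves a positive remainder. It agrees with the digits `⌊β r_n⌋` of the
usual greedy algorithm unless that algorithm terminates. -/
def betaDigit (β : ℝ) (n : ℕ) : ℤ := ⌈β * betaRemainder β n⌉ - 1

theorem isOpen_lex_gt {d : ℕ} (w : ℕ → ℤ) (k : ℕ) :
    IsOpen {x : ℕ → Fin d | toLex w < toLex fun n => ((x (k + n)).val : ℤ)} := by
  have h : {x : ℕ → Fin d | toLex w < toLex fun n => ((x (k + n)).val : ℤ)} =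
      ⋃ i : ℕ, ((⋂ j ∈ Finset.range i, {x : ℕ → Fin d | w j = ((x (k + j)).val : ℤ)}) ∩
        {x : ℕ → Fin d | w i < ((x (k + i)).val : ℤ)}) := by
    ext x
    simp only [Set.mem_iUnion, Set.mem_inter_iff, Set.mem_iInter, Finset.mem_range]
    exact Iff.rfl
  rw [h]
  refine isOpen_iUnion fun i => IsOpen.inter ?_ ?_
  · refine isOpen_biInter_finset fun j _ => ?_
    exact (isOpen_discrete {a : Fin d | w j = (a.val : ℤ)}).preimage
      (continuous_apply (A := fun _ : ℕ => Fin d) (k + j))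
  · exact (isOpen_discrete {a : Fin d | w i < (a.val : ℤ)}).preimage
      (continuous_apply (A := fun _ : ℕ => Fin d) (k + i))

/-- The sequences over `{0, …, d - 1}` all of whose shifts are lexicographically at most `w^β`.
For `d = ⌈β⌉` this is the `β`-shift. -/
def betaShift (β : ℝ) (d : ℕ) : Subshift (Fin d) ℕ where
  carrier := {x | ∀ k : ℕ, toLex (fun n => ((x (k + n)).val : ℤ)) ≤ toLex (betaDigit β)}
  isClosed := by
    simp only [Set.ofPred_forall]
    refine isClosed_iInter fun k => ?_
    have := (isOpen_lex_gt (d := d) (betaDigit β) k).isClosed_compl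
    convert this using 1
    ext x
    exact (not_lt (α := Lex (ℕ → ℤ))).symm
  mapsTo := by
    intro g x hx k
    have := hx (g + k)
    simpa only [shift_apply, add_assoc] using this

/-- `X` is a `β`-shift for some `β > 1`, over the alphabet `{0, …, ⌈β⌉ - 1}`. -/
def IsBetaShift {d : ℕ} (X : Subshift (Fin d) ℕ) : Prop :=
  ∃ β : ℝ, 1 < β ∧ d = ⌈β⌉₊ ∧ X = betaShift β d

/-! ### Potentials, the Bowen property and pressure -/

/-- The Bowen property of `φ` on a collection of words `G`. -/
def HasBowenPropertyOn {d : ℕ} (X : Subshift (Fin d) ℕ) (G : Set (List (Fin d)))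
    (φ : X.carrier → ℝ) : Prop :=
  ∃ V : ℝ, ∀ w ∈ G, ∀ x ∈ cyl X w, ∀ y ∈ cyl X w,
    |birkhoffSum (shiftMap X) φ w.length x - birkhoffSum (shiftMap X) φ w.length y| ≤ V

/-- The Bowen property. -/
def HasBowenProperty {d : ℕ} (X : Subshift (Fin d) ℕ) (φ : X.carrier → ℝ) : Prop :=
  HasBowenPropertyOn X (language X) φ

/-- `φ_n(w) = sup_{x ∈ [w]} S_n φ(x)` for a word `w` of length `n`. -/
def wordSup {d : ℕ} (X : Subshift (Fin d) ℕ) (φ : X.carrier → ℝ) (w : List (Fin d)) : ℝ :=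
  sSup (birkhoffSum (shiftMap X) φ w.length '' cyl X w)

open Classical in
/-- `Λ_n(D, φ)`, the sum of `exp (φ_n(w))` over the words `w ∈ D` of length `n`. -/
def partitionSum {d : ℕ} (X : Subshift (Fin d) ℕ) (D : Set (List (Fin d)))
    (φ : X.carrier → ℝ) (n : ℕ) : ℝ :=
  ∑ w : Fin n → Fin d with List.ofFn w ∈ D, Real.exp (wordSup X φ (List.ofFn w))

/-- The topological pressure `P(X, φ) = limsup (1/n) log Λ_n(L, φ)`. -/
def pressure {d : ℕ} (X : Subshift (Fin d) ℕ) (φ : X.carrier → ℝ) : ℝ :=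
  limsup (fun n : ℕ => Real.log (partitionSum X (language X) φ n) / n) atTop

/-! ### Entropy and equilibrium states -/

/-- The Shannon entropy of the `n`-th refinement of the finite partition into the level sets
of `ξ`, under the map `T` and the measure `μ`. -/
def refinedEntropy {α : Type*} [MeasurableSpace α] (T : α → α) (μ : Measure α) {k : ℕ}
    (ξ : α → Fin k) (n : ℕ) : ℝ :=
  ∑ c : Fin n → Fin k, Real.negMulLog (μ.real {x | ∀ i : Fin n, ξ (T^[i] x) = c i})

/-- The measure-theoretic (Kolmogorov–Sinai) entropy: the supremum over all finite measurable
partitions of the growth rate of the entropy of their refinements. -/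
def measureEntropy {α : Type*} [MeasurableSpace α] (T : α → α) (μ : Measure α) : EReal :=
  ⨆ (k : ℕ) (ξ : α → Fin k) (_ : Measurable ξ),
    limsup (fun n : ℕ => ((refinedEntropy T μ ξ n / n : ℝ) : EReal)) atTop

/-- `μ` is a shift-invariant Borel probability measure on `X`. -/
def IsInvariantProb {d : ℕ} (X : Subshift (Fin d) ℕ) (μ : Measure X.carrier) : Prop :=
  IsProbabilityMeasure μ ∧ MeasurePreserving (shiftMap X) μ μ

/-- `μ` is an equilibrium state for `φ`: an invariant probability measure that maximises
`h(μ) + ∫ φ dμ` among all of them. -/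
def IsEquilibriumState {d : ℕ} (X : Subshift (Fin d) ℕ) (φ : X.carrier → ℝ)
    (μ : Measure X.carrier) : Prop :=
  IsInvariantProb X μ ∧ ∀ ν : Measure X.carrier, IsInvariantProb X ν →
    measureEntropy (shiftMap X) ν + ((∫ x, φ x ∂ν : ℝ) : EReal) ≤
      measureEntropy (shiftMap X) μ + ((∫ x, φ x ∂μ : ℝ) : EReal)

/-! ### The weak Gibbs property -/

/-- The collection `G(M)` of the words `u v w ∈ L` with `u ∈ Cp`, `v ∈ G`, `w ∈ Cs`,
`|u| ≤ M` and `|w| ≤ M`. -/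
def fattened {d : ℕ} (X : Subshift (Fin d) ℕ) (Cp G Cs : Set (List (Fin d))) (M : ℕ) :
    Set (List (Fin d)) :=
  {z | z ∈ language X ∧ ∃ u ∈ Cp, ∃ v ∈ G, ∃ w ∈ Cs,
    u.length ≤ M ∧ w.length ≤ M ∧ z = u ++ v ++ w}

/-- A decomposition `Cp G Cs = L` of the language into good cores, prefixes and suffixes that is
adapted to `φ`: every `G(M)` has (Per)-specification, `φ` has the Bowen property on `G`, and
`∑_{n ≥ 1} Λ_n(Cp ∪ Cs, φ) exp (-n P(φ))` converges. -/
structure IsAdaptedDecomposition {d : ℕ} (X : Subshift (Fin d) ℕ) (φ : X.carrier → ℝ)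
    (Cp G Cs : Set (List (Fin d))) : Prop where
  prefix_subset : Cp ⊆ language X
  core_subset : G ⊆ language X
  suffix_subset : Cs ⊆ language X
  decompose : ∀ z ∈ language X, ∃ u ∈ Cp, ∃ v ∈ G, ∃ w ∈ Cs, z = u ++ v ++ w
  specification : ∀ M : ℕ, ∃ t : ℕ, HasPerSpecificationOn X (fattened X Cp G Cs M) t
  bowen : HasBowenPropertyOn X G φ
  summable : Summable fun n : ℕ =>
    partitionSum X (Cp ∪ Cs) φ (n + 1) * Real.exp (-((n + 1 : ℕ) : ℝ) * pressure X φ)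

/-- The Gibbs bounds with respect to `Cp`, `G`, `Cs`: the upper constant is uniform, the lower one
may depend on `M`. -/
def HasGibbsBounds {d : ℕ} (X : Subshift (Fin d) ℕ) (φ : X.carrier → ℝ)
    (Cp G Cs : Set (List (Fin d))) (μ : Measure X.carrier) : Prop :=
  ∃ (K' : ℝ) (K : ℕ → ℝ), 0 < K' ∧ (∀ M, 0 < K M) ∧
    ∀ (M : ℕ), ∀ w ∈ fattened X Cp G Cs M,
      K M ≤ μ.real (cyl X w) / Real.exp (-(w.length : ℝ) * pressure X φ + wordSup X φ w) ∧
      μ.real (cyl X w) / Real.exp (-(w.length : ℝ) * pressure X φ + wordSup X φ w) ≤ K'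

/-- The weak Gibbs property: the Gibbs bounds with respect to an adapted decomposition. -/
def IsWeakGibbs {d : ℕ} (X : Subshift (Fin d) ℕ) (φ : X.carrier → ℝ)
    (μ : Measure X.carrier) : Prop :=
  ∃ Cp G Cs : Set (List (Fin d)),
    IsAdaptedDecomposition X φ Cp G Cs ∧ HasGibbsBounds X φ Cp G Cs μ

/-! ### Periodic orbit measures -/

/-- The weight `exp (S_n φ(x))`. -/
def orbitWeight {d : ℕ} (X : Subshift (Fin d) ℕ) (φ : X.carrier → ℝ) (n : ℕ)
    (x : X.carrier) : ENNReal :=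
  ENNReal.ofReal (Real.exp (birkhoffSum (shiftMap X) φ n x))

/-- The periodic orbit measure: the sum over all `x ∈ X` with `σ^n x = x` of the point masses
`exp (S_n φ(x)) δ_x`, divided by the sum of the weights `exp (S_n φ(x))`. -/
def periodicOrbitMeasure {d : ℕ} (X : Subshift (Fin d) ℕ) (φ : X.carrier → ℝ) (n : ℕ) :
    Measure X.carrier :=
  (∑' x : Function.ptsOfPeriod (shiftMap X) n, orbitWeight X φ n x.1)⁻¹ •
    Measure.sum fun x : Function.ptsOfPeriod (shiftMap X) n =>
      orbitWeight X φ n x.1 • Measure.dirac x.1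

/-! ### Potentials that depend on the number of leading zeros -/

/-- The number `k(x)` of initial zeros of a sequence `x ≠ 0`. -/
def leadingZeros {d : ℕ} [NeZero d] (x : ℕ → Fin d) : ℕ := sInf {n | x n ≠ 0}

open Classical in
/-- The function that vanishes at the fixed point `0` and equals `a_{k(x)}` at `x ≠ 0`. -/
def leadingZeroPotential {d : ℕ} [NeZero d] (X : Subshift (Fin d) ℕ) (a : ℕ → ℝ)
    (x : X.carrier) : ℝ :=
  if x.1 = 0 then 0 else a (leadingZeros x.1)

end Thermo

end

open Thermo

set_option linter.unusedSectionVars false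

noncomputable section

namespace Thermo

/-! ### Shannon entropy of finite-valued observables -/

section Entropy

open Real

variable {Ω : Type*} [MeasurableSpace Ω]

/-! A point with exactly N leading zeros has S_N φ₀ = a_1 + ⋯ + a_N, while S_N φ₀ vanishes at the
fixed point 0. Since φ_r has the Bowen property, unbounded partial sums exclude it for φ
(`not_hasBowenProperty`).

For the equilibrium state it suffices to find an adapted decomposition with trivial prefixes. Weigh
a word w of length n by exp(φ_n(w) - nP). These weights are submultiplicative, so by Fekete each
level of the language has total weight at least 1. Conversely, a Kraft inequality (`sum_exp_le_one`)
bounds the level weights of the core, and the finite total weight of the suffixes extends the bound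
to the language. Periodic specification transfers these bounds to periodic points: every limit point
μ of the periodic orbit measures satisfies an upper Gibbs bound and, on each G(M), a lower bound for
the joint occurrence of two words (`exists_limit`). The upper bound gives μ free energy at least P,
and counting gives every invariant measure at most P. The lower bound makes each measure of free
energy P absolutely continuous with respect to μ; the joint bound makes μ ergodic. So such a measure
equals μ, and all limit points coincide (`exists_unique_equilibriumState`).

The sums of φ₀ over a word are undetermined only along a final run of zeros, so cores are words with
a nonzero letter near the end. Under specification the suffixes are the words 0^k, whose weights
decay geometrically because φ(0) < P, and a synchronizing word upgrades specification to its
periodic form. In a β-shift with maximal sequence ω, words whose suffixes fall strictly below ω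
concatenate freely; the obstruction is the initial words of ω. Lowering the last, nonzero letter of
such a word gives an element of a freely concatenable prefix code, and the cost is bounded because
the sums of the a_n telescope to a_0 - a_p. Kraft then bounds the total weight of these initial
words (`sum_weight_initialWord_ne_top`); trailing zeros are absorbed by φ(0) < P. Finally a
self-bounding inequality, valid once cores may end in T zeros with T large, gives suffixes of finite
total weight (`exists_totalWeight_lexSuffix_ne_top`). -/

/-- Shannon entropy of a finite-valued observable. -/
def obsEntropy {A : Type*} [Fintype A] (μ : Measure Ω) (f : Ω → A) : ℝ :=
  ∑ a, negMulLog (μ.real (f ⁻¹' {a}))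

/-- Conditional Shannon entropy of `f` given `h`. -/
def condEntropy {A B : Type*} [Fintype A] [Fintype B] (μ : Measure Ω) (f : Ω → A) (h : Ω → B) : ℝ :=
  obsEntropy μ (fun x => (f x, h x)) - obsEntropy μ h

/-- Nonnegativity of mutual information: log t ≤ t - 1 at t = r_a s_b / (Q q_ab), summed against q.
The total mass Q is arbitrary, so that the inequality applies to each fibre of a third observable.
-/
theorem sum_negMulLog_add_le {A B : Type*} [Fintype A] [Fintype B] (q : A → B → ℝ)
    (hq : ∀ a b, 0 ≤ q a b) :
    ∑ a, ∑ b, negMulLog (q a b) + negMulLog (∑ a, ∑ b, q a b) ≤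
      ∑ a, negMulLog (∑ b, q a b) + ∑ b, negMulLog (∑ a, q a b) := by
  set r : A → ℝ := fun a => ∑ b, q a b with hr
  set s : B → ℝ := fun b => ∑ a, q a b with hs
  set Q : ℝ := ∑ a, r a with hQ
  have hr0 : ∀ a, 0 ≤ r a := fun a => Finset.sum_nonneg fun b _ => hq a b
  have hs0 : ∀ b, 0 ≤ s b := fun b => Finset.sum_nonneg fun a _ => hq a b
  have hQs : Q = ∑ b, s b := Finset.sum_comm
  have hQ0 : 0 ≤ Q := Finset.sum_nonneg fun a _ => hr0 a
  have key : ∀ a b, negMulLog (q a b) + q a b * log (r a) + q a b * log (s b) - q a b * log Q ≤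
      r a * s b / Q - q a b := by
    intro a b
    rcases (hq a b).eq_or_lt with h | h
    · rw [← h]; simp; exact div_nonneg (mul_nonneg (hr0 a) (hs0 b)) hQ0
    · have h1 : q a b ≤ r a := Finset.single_le_sum (fun b _ => hq a b) (Finset.mem_univ b)
      have h2 : q a b ≤ s b := Finset.single_le_sum (f := fun a => q a b)
        (fun a _ => hq a b) (Finset.mem_univ a)
      have h3 : r a ≤ Q := Finset.single_le_sum (fun a _ => hr0 a) (Finset.mem_univ a)
      have hra : 0 < r a := h.trans_le h1
      have hsb : 0 < s b := h.trans_le h2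
      have hQp : 0 < Q := hra.trans_le h3
      have := log_le_sub_one_of_pos (x := r a * s b / (Q * q a b)) (by positivity)
      rw [log_div (by positivity) (by positivity), log_mul hra.ne' hsb.ne', log_mul hQp.ne' h.ne']
        at this
      have h4 := mul_le_mul_of_nonneg_left this h.le
      have h5 : q a b * (r a * s b / (Q * q a b) - 1) = r a * s b / Q - q a b := by
        field_simp
      rw [h5] at h4
      simp only [negMulLog]
      nlinarith
  have hsum := Finset.sum_le_sum fun a (_ : a ∈ Finset.univ) =>
    Finset.sum_le_sum fun b (_ : b ∈ Finset.univ) => key a b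
  simp only [Finset.sum_add_distrib, Finset.sum_sub_distrib, ← Finset.sum_mul] at hsum
  have e1 : ∑ a, ∑ b, q a b * log (s b) = ∑ b, s b * log (s b) := by
    rw [Finset.sum_comm]; simp only [hs, Finset.sum_mul]
  have e2 : ∑ a, ∑ b, r a * s b / Q = Q := by
    simp only [← Finset.sum_div, ← Finset.mul_sum, ← hQs]
    rw [← Finset.sum_mul, ← hQ]
    rcases hQ0.eq_or_lt with h | h
    · rw [← h]; simp
    · field_simp
  rw [e1, e2] at hsum
  simp only [negMulLog, neg_mul, Finset.sum_neg_distrib] at hsum ⊢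
  change _ + -(Q * log Q) ≤ -∑ a, r a * log (r a) + -∑ b, s b * log (s b)
  change _ + ∑ a, r a * log (r a) + _ - Q * log Q ≤ Q - Q at hsum
  linarith

variable {A B C : Type*} [Fintype A] [Fintype B] [Fintype C]
  [MeasurableSpace A] [MeasurableSingletonClass A] [MeasurableSpace B] [MeasurableSingletonClass B]
  [MeasurableSpace C] [MeasurableSingletonClass C]
  {μ : Measure Ω} [IsProbabilityMeasure μ]

theorem sum_measureReal_prod_left {f : Ω → A} {g : Ω → B} (hf : Measurable f)
    (hg : Measurable g) (a : A) :
    ∑ b, μ.real ((fun x => (f x, g x)) ⁻¹' {(a, b)}) = μ.real (f ⁻¹' {a}) := by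
  have h : f ⁻¹' {a} = ⋃ b ∈ (Finset.univ : Finset B), (fun x => (f x, g x)) ⁻¹' {(a, b)} := by
    ext x; simp
  rw [h, measureReal_biUnion_finset]
  · intro b _ c _ hbc
    refine Set.disjoint_left.2 fun x hx hx' => hbc ?_
    simp only [Set.mem_preimage, Set.mem_singleton_iff, Prod.mk.injEq] at hx hx'
    exact hx.2.symm.trans hx'.2
  · intro b _
    exact (hf.prodMk hg) (measurableSet_singleton _)

theorem measureReal_comp_preimage (κ : A → B) {g : Ω → A} (hg : Measurable g) (b : B)
    [DecidableEq B] :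
    μ.real ((fun x => κ (g x)) ⁻¹' {b}) =
      ∑ a with κ a = b, μ.real (g ⁻¹' {a}) := by
  have h : (fun x => κ (g x)) ⁻¹' {b} =
      ⋃ a ∈ (Finset.univ.filter fun a => κ a = b), g ⁻¹' {a} := by
    ext x; simp
  rw [h, measureReal_biUnion_finset]
  · intro b _ c _ hbc
    refine Set.disjoint_left.2 fun x hx hx' => hbc ?_
    simp only [Set.mem_preimage, Set.mem_singleton_iff] at hx hx'
    exact hx.symm.trans hx'
  · intro b _
    exact hg (measurableSet_singleton _)

/-- An atom of g has at most the mass of the fibre of κ that contains it, and the logarithm is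
monotone. -/
theorem obsEntropy_comp_le (κ : A → B) {g : Ω → A} (hg : Measurable g) :
    obsEntropy μ (fun x => κ (g x)) ≤ obsEntropy μ g := by
  classical
  unfold obsEntropy
  rw [← Finset.sum_fiberwise_of_maps_to (s := Finset.univ) (t := Finset.univ) (g := κ) (by simp)]
  refine Finset.sum_le_sum fun b _ => ?_
  have hm := measureReal_comp_preimage (μ := μ) κ hg b
  rw [negMulLog, neg_mul]
  conv_lhs => rw [← mul_comm, hm, Finset.mul_sum, ← Finset.sum_neg_distrib]
  refine Finset.sum_le_sum fun a ha => ?_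
  rw [negMulLog, ← hm]
  have h1 : μ.real (g ⁻¹' {a}) ≤ μ.real ((fun x => κ (g x)) ⁻¹' {b}) := by
    rw [hm]
    exact Finset.single_le_sum (f := fun a => μ.real (g ⁻¹' {a})) (fun _ _ => measureReal_nonneg) ha
  rcases (measureReal_nonneg (μ := μ) (s := g ⁻¹' {a})).eq_or_lt with h | h
  · rw [← h]; simp
  · have := log_le_log h h1
    nlinarith

/-- This is `sum_negMulLog_add_le` on each fibre {h = c}, summed over c. -/
theorem obsEntropy_submodular {f : Ω → A} {g : Ω → B} {h : Ω → C}
    (hf : Measurable f) (hg : Measurable g) (hh : Measurable h) :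
    obsEntropy μ (fun x => ((f x, g x), h x)) + obsEntropy μ h ≤
      obsEntropy μ (fun x => (f x, h x)) + obsEntropy μ (fun x => (g x, h x)) := by
  unfold obsEntropy
  simp only [Fintype.sum_prod_type_right]
  rw [← Finset.sum_add_distrib, ← Finset.sum_add_distrib]
  refine Finset.sum_le_sum fun c _ => ?_
  have := sum_negMulLog_add_le
    (fun a b => μ.real ((fun x => ((f x, g x), h x)) ⁻¹' {((a, b), c)}))
    fun _ _ => measureReal_nonneg
  rw [Finset.sum_comm]
  have e1 : ∀ a, ∑ b, μ.real ((fun x => ((f x, g x), h x)) ⁻¹' {((a, b), c)}) =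
      μ.real ((fun x => (f x, h x)) ⁻¹' {(a, c)}) := by
    intro a
    rw [← sum_measureReal_prod_left (hf.prodMk hh) hg]
    refine Finset.sum_congr rfl fun b _ => ?_
    congr 1; ext x; simp; tauto
  have e2 : ∀ b, ∑ a, μ.real ((fun x => ((f x, g x), h x)) ⁻¹' {((a, b), c)}) =
      μ.real ((fun x => (g x, h x)) ⁻¹' {(b, c)}) := by
    intro b
    rw [← sum_measureReal_prod_left (hg.prodMk hh) hf]
    refine Finset.sum_congr rfl fun b _ => ?_
    congr 1; ext x; simp; tauto
  have e3 : ∑ a, μ.real ((fun x => (f x, h x)) ⁻¹' {(a, c)}) = μ.real (h ⁻¹' {c}) := by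
    rw [← sum_measureReal_prod_left hh hf]
    refine Finset.sum_congr rfl fun b _ => ?_
    congr 1; ext x; simp; tauto
  simp only [e1, e2, e3] at this
  exact this

theorem condEntropy_prod_le {f : Ω → A} {g : Ω → B} {h : Ω → C}
    (hf : Measurable f) (hg : Measurable g) (hh : Measurable h) :
    condEntropy μ (fun x => (f x, g x)) h ≤ condEntropy μ f h + condEntropy μ g h := by
  have := obsEntropy_submodular (μ := μ) hf hg hh
  unfold condEntropy
  linarith

theorem condEntropy_comp_left_le (κ : A → B) {f : Ω → A} {h : Ω → C}
    (hf : Measurable f) (hh : Measurable h) :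
    condEntropy μ (fun x => κ (f x)) h ≤ condEntropy μ f h := by
  have := obsEntropy_comp_le (μ := μ) (fun p : A × C => (κ p.1, p.2)) (hf.prodMk hh)
  unfold condEntropy
  linarith

/-- Submodularity for f, h and κ ∘ h, where the pair (h, κ ∘ h) carries the same information as h.
-/
theorem condEntropy_le_condEntropy_comp (κ : B → C) {f : Ω → A} {h : Ω → B}
    (hf : Measurable f) (hh : Measurable h) (hκ : Measurable κ) :
    condEntropy μ f h ≤ condEntropy μ f (fun x => κ (h x)) := by
  have h1 : _ + obsEntropy μ (fun x => κ (h x)) ≤ _ :=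
    obsEntropy_submodular (μ := μ) hf hh (hκ.comp hh)
  have h2 := obsEntropy_comp_le (μ := μ) (fun p : (A × B) × C => p.1)
    ((hf.prodMk hh).prodMk (hκ.comp hh))
  have h3 := obsEntropy_comp_le (μ := μ) (fun b : B => (b, κ b)) hh
  unfold condEntropy
  simp only [Function.comp_apply] at h1 h2 h3
  linarith

theorem obsEntropy_const {c : A} : obsEntropy μ (fun _ : Ω => c) = 0 := by
  classical
  refine Finset.sum_eq_zero fun a _ => ?_
  by_cases h : c = a
  · rw [h, Set.preimage_const_of_mem (by simp)]; simp
  · rw [Set.preimage_const_of_notMem (by simpa using h)]; simp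

theorem obsEntropy_prod_le {f : Ω → A} {g : Ω → B} (hf : Measurable f) (hg : Measurable g) :
    obsEntropy μ (fun x => (f x, g x)) ≤ obsEntropy μ f + obsEntropy μ g := by
  have h1 := obsEntropy_submodular (μ := μ) hf hg (measurable_const (a := ()))
  have h2 := obsEntropy_comp_le (μ := μ) (fun p : (A × B) × Unit => p.1)
    ((hf.prodMk hg).prodMk (measurable_const (a := ())))
  have h3 := obsEntropy_comp_le (μ := μ) (fun p : A => (p, ())) hf
  have h4 := obsEntropy_comp_le (μ := μ) (fun p : B => (p, ())) hg
  have h5 := obsEntropy_const (μ := μ) (c := ())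
  linarith

theorem obsEntropy_comp_measurePreserving {T : Ω → Ω} (hT : MeasurePreserving T μ μ)
    {f : Ω → A} (hf : Measurable f) : obsEntropy μ (fun x => f (T x)) = obsEntropy μ f := by
  unfold obsEntropy
  refine Finset.sum_congr rfl fun a _ => ?_
  congr 1
  exact hT.measureReal_preimage (hf (measurableSet_singleton a)).nullMeasurableSet

theorem condEntropy_comp_measurePreserving {T : Ω → Ω} (hT : MeasurePreserving T μ μ)
    {f : Ω → A} {h : Ω → B} (hf : Measurable f) (hh : Measurable h) :
    condEntropy μ (fun x => f (T x)) (fun x => h (T x)) = condEntropy μ f h := by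
  unfold condEntropy
  rw [obsEntropy_comp_measurePreserving hT hh,
    obsEntropy_comp_measurePreserving hT (hf.prodMk hh)]

theorem condEntropy_pi_le {m : ℕ} (F : ℕ → Ω → A) {h : Ω → C}
    (hF : ∀ i, Measurable (F i)) (hh : Measurable h) :
    condEntropy μ (fun x (i : Fin m) => F i x) h ≤ ∑ i ∈ Finset.range m, condEntropy μ (F i) h := by
  induction m with
  | zero =>
    have h1 := obsEntropy_comp_le (μ := μ) (fun c : C => ((fun i : Fin 0 => i.elim0 : Fin 0 → A), c)) hh
    have h2 : (fun x => ((fun i : Fin 0 => F i x), h x)) =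
        fun x => ((fun i : Fin 0 => i.elim0 : Fin 0 → A), h x) := by
      funext x; congr 1; funext i; exact i.elim0
    simp only [condEntropy, h2, Finset.range_zero, Finset.sum_empty]
    linarith
  | succ m ih =>
    rw [Finset.sum_range_succ]
    have hm : Measurable fun x (i : Fin m) => F i x := measurable_pi_lambda _ fun i => hF i
    refine le_trans ?_ ((condEntropy_prod_le hm (hF m) hh).trans (by gcongr))
    have := condEntropy_comp_left_le (μ := μ)
      (fun p : (Fin m → A) × A => (Fin.snoc p.1 p.2 : Fin (m + 1) → A)) (hm.prodMk (hF m)) hh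
    refine le_of_eq_of_le ?_ this
    congr 1
    funext x i
    refine Fin.lastCases ?_ (fun j => ?_) i <;> simp

theorem obsEntropy_le_add_condEntropy {f : Ω → A} {h : Ω → B} (hf : Measurable f)
    (hh : Measurable h) : obsEntropy μ f ≤ obsEntropy μ h + condEntropy μ f h := by
  have := obsEntropy_comp_le (μ := μ) (fun p : A × B => p.1) (hf.prodMk hh)
  simp only [condEntropy]
  linarith

/-- The joint law of (f, g_j) converges to the law of (f, f) on the diagonal, and entropy is a
finite sum of continuous functions of the atoms. -/
theorem tendsto_condEntropy_zero {f : Ω → A} (hf : Measurable f) {g : ℕ → Ω → A}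
    (hg : ∀ j, Measurable (g j))
    (h : Tendsto (fun j => μ.real {x | f x ≠ g j x}) atTop (𝓝 0)) :
    Tendsto (fun j => condEntropy μ f (g j)) atTop (𝓝 0) := by
  classical
  have hpair : ∀ a b, Tendsto (fun j => μ.real ((fun x => (f x, g j x)) ⁻¹' {(a, b)})) atTop
      (𝓝 (if a = b then μ.real (f ⁻¹' {a}) else 0)) := by
    intro a b
    split_ifs with hab
    · subst hab
      rw [tendsto_iff_dist_tendsto_zero]
      refine squeeze_zero (fun _ => dist_nonneg) (fun j => ?_) h
      rw [Real.dist_eq, abs_sub_comm]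
      refine (abs_measureReal_sub_le_measureReal_symmDiff (hf (measurableSet_singleton _)).nullMeasurableSet
        (((hf.prodMk (hg j)) (measurableSet_singleton _)).nullMeasurableSet)).trans (measureReal_mono ?_)
      intro x hx
      simp only [Set.mem_symmDiff, Set.mem_preimage, Set.mem_singleton_iff, Prod.mk.injEq] at hx
      simp only [Set.mem_ofPred_eq]
      grind
    · refine squeeze_zero (fun _ => measureReal_nonneg) (fun j => measureReal_mono ?_) h
      intro x hx
      simp only [Set.mem_preimage, Set.mem_singleton_iff, Prod.mk.injEq] at hx
      simp only [Set.mem_ofPred_eq]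
      grind
  have hsing : ∀ b, Tendsto (fun j => μ.real (g j ⁻¹' {b})) atTop (𝓝 (μ.real (f ⁻¹' {b}))) := by
    intro b
    rw [tendsto_iff_dist_tendsto_zero]
    refine squeeze_zero (fun _ => dist_nonneg) (fun j => ?_) h
    rw [Real.dist_eq, abs_sub_comm]
    refine (abs_measureReal_sub_le_measureReal_symmDiff (hf (measurableSet_singleton _)).nullMeasurableSet
      ((hg j (measurableSet_singleton _)).nullMeasurableSet)).trans (measureReal_mono ?_)
    intro x hx
    simp only [Set.mem_symmDiff, Set.mem_preimage, Set.mem_singleton_iff] at hx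
    simp only [Set.mem_ofPred_eq]
    grind
  have h1 : Tendsto (fun j => obsEntropy μ (fun x => (f x, g j x))) atTop
      (𝓝 (∑ p : A × A, negMulLog (if p.1 = p.2 then μ.real (f ⁻¹' {p.1}) else 0))) :=
    tendsto_finsetSum _ fun p _ => (continuous_negMulLog.tendsto _).comp (hpair p.1 p.2)
  have h2 : Tendsto (fun j => obsEntropy μ (g j)) atTop (𝓝 (obsEntropy μ f)) :=
    tendsto_finsetSum _ fun p _ => (continuous_negMulLog.tendsto _).comp (hsing p)
  have h3 : ∑ p : A × A, negMulLog (if p.1 = p.2 then μ.real (f ⁻¹' {p.1}) else 0) =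
      obsEntropy μ f := by
    rw [Fintype.sum_prod_type]
    refine Finset.sum_congr rfl fun a _ => ?_
    rw [Finset.sum_eq_single a]
    · simp
    · intro b _ hb; simp [hb.symm]
    · simp
  rw [h3] at h1
  have := h1.sub h2
  rwa [sub_self] at this

/-! ### Itineraries and the Kolmogorov–Sinai theorem for generators. -/

/-- The itinerary of length `n` of a point with respect to the observable `f`. -/
def itinerary (T : Ω → Ω) (f : Ω → A) (n : ℕ) (x : Ω) : Fin n → A := fun i => f (T^[i] x)

theorem measurable_itinerary {T : Ω → Ω} (hT : Measurable T) {f : Ω → A} (hf : Measurable f)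
    (n : ℕ) : Measurable (itinerary T f n) :=
  measurable_pi_lambda _ fun i => hf.comp (hT.iterate i)

theorem obsEntropy_itinerary_subadditive {T : Ω → Ω} (hT : MeasurePreserving T μ μ) {f : Ω → A}
    (hf : Measurable f) : Subadditive fun n => obsEntropy μ (itinerary T f n) := by
  intro m n
  have hm := fun n => measurable_itinerary hT.measurable hf n
  have h1 := obsEntropy_comp_le (μ := μ) (fun p : (Fin m → A) × (Fin n → A) => Fin.append p.1 p.2)
    ((hm m).prodMk ((hm n).comp (hT.measurable.iterate m)))
  have h2 := obsEntropy_prod_le (μ := μ) (hm m) ((hm n).comp (hT.measurable.iterate m))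
  have h3 := obsEntropy_comp_measurePreserving (hT.iterate m) (hm n)
  have h4 : itinerary T f (m + n) = fun x => Fin.append (itinerary T f m x)
      ((itinerary T f n ∘ T^[m]) x) := by
    funext x i
    refine Fin.addCases (fun j => ?_) (fun j => ?_) i
    · simp [itinerary]
    · simp [itinerary, ← Function.iterate_add_apply, add_comm]
  change obsEntropy μ (itinerary T f (m + n)) ≤ _
  rw [h4]
  change obsEntropy μ (itinerary T f n ∘ T^[m]) = _ at h3
  rw [h3] at h2
  exact h1.trans h2

/-- **Kolmogorov–Sinai**: for a generating observable `f`, the entropy of `T` is at most the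
normalised entropy of every itinerary map of `f`. -/
theorem measureEntropy_le_of_generator {T : Ω → Ω} (hT : MeasurePreserving T μ μ) {f : Ω → A}
    (hf : Measurable f)
    (hgen : ∀ s, MeasurableSet s → ∀ ε > 0, ∃ N₀, ∀ N ≥ N₀, ∃ S : Set (Fin N → A),
      μ.real (symmDiff s (itinerary T f N ⁻¹' S)) < ε) {n : ℕ} (hn : n ≠ 0) :
    measureEntropy T μ ≤ ((obsEntropy μ (itinerary T f n) / n : ℝ) : EReal) := by
  classical
  unfold measureEntropy
  refine iSup_le fun k => iSup_le fun ξ => iSup_le fun hξ => ?_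
  have hit := fun n => measurable_itinerary hT.measurable hf n
  have approx : ∀ δ > 0, ∃ N, ∃ η : (Fin N → A) → Fin k,
      μ.real {x | ξ x ≠ η (itinerary T f N x)} < δ := by
    intro δ hδ
    have hδ' : 0 < δ / (k + 1) := by positivity
    choose N₀ hN₀ using fun a : Fin k => hgen (ξ ⁻¹' {a}) (hξ (measurableSet_singleton a)) _ hδ'
    obtain ⟨N, hN⟩ : ∃ N, ∀ a, N₀ a ≤ N :=
      ⟨Finset.univ.sup N₀, fun a => Finset.le_sup (Finset.mem_univ a)⟩
    choose S hS using fun a => hN₀ a N (hN a)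
    obtain ⟨x₀⟩ : Nonempty Ω := nonempty_of_isProbabilityMeasure μ
    -- The default ξ x₀ merely provides an element of `Fin k`. The guess can be wrong only inside
    -- one of the k symmetric differences, each of measure below δ/(k+1).
    refine ⟨N, fun c => if h : ∃ a, c ∈ S a then h.choose else ξ x₀, ?_⟩
    have hsub : {x | ξ x ≠ (fun c => if h : ∃ a, c ∈ S a then h.choose else ξ x₀)
        (itinerary T f N x)} ⊆
        ⋃ a ∈ (Finset.univ : Finset (Fin k)), symmDiff (ξ ⁻¹' {a}) (itinerary T f N ⁻¹' S a) := by
      intro x hx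
      by_contra hcon
      simp only [Finset.mem_univ, Set.iUnion_true, Set.mem_iUnion, not_exists, Set.mem_symmDiff,
        Set.mem_preimage, Set.mem_singleton_iff] at hcon
      have h1 : itinerary T f N x ∈ S (ξ x) := by
        have := hcon (ξ x); tauto
      have h2 : ∃ a, itinerary T f N x ∈ S a := ⟨_, h1⟩
      have h3 := h2.choose_spec
      apply hx
      simp only [dif_pos h2]
      have := hcon h2.choose; tauto
    refine (measureReal_mono hsub (measure_ne_top _ _)).trans_lt ((measureReal_biUnion_finset_le _ _).trans_lt ?_)
    refine (Finset.sum_le_sum fun a _ => (hS a).le).trans_lt ?_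
    simp only [Finset.sum_const, Finset.card_univ, Fintype.card_fin, nsmul_eq_mul]
    rw [mul_div_assoc', div_lt_iff₀ (by positivity)]
    nlinarith
  have hcond : ∀ ε > 0, ∃ N, condEntropy μ ξ (itinerary T f N) < ε := by
    intro ε hε
    choose N η hη using fun j : ℕ => approx (1 / ((j : ℝ) + 1)) (by positivity)
    have hη' : ∀ j, Measurable (η j) := fun j => measurable_of_finite _
    have ht := tendsto_condEntropy_zero (μ := μ) hξ (g := fun j x => η j (itinerary T f (N j) x))
      (fun j => (hη' j).comp (hit _))
      (squeeze_zero (fun _ => measureReal_nonneg) (fun j => (hη j).le)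
        tendsto_one_div_add_atTop_nhds_zero_nat)
    obtain ⟨j, hj⟩ := (ht.eventually_lt_const hε).exists
    exact ⟨N j, (condEntropy_le_condEntropy_comp (η j) hξ (hit _) (hη' j)).trans_lt hj⟩
  -- The f-itinerary of length m + N contains the itinerary of length N from each time i < m, so by
  -- invariance every letter of the ξ-name costs at most the conditional entropy of ξ given N
  -- letters.
  have hbound : ∀ N m, refinedEntropy T μ ξ m ≤
      obsEntropy μ (itinerary T f m) + obsEntropy μ (itinerary T f N) +
        m * condEntropy μ ξ (itinerary T f N) := by
    intro N m
    have h0 : refinedEntropy T μ ξ m = obsEntropy μ (fun x (i : Fin m) => ξ (T^[i] x)) := by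
      unfold refinedEntropy obsEntropy
      refine Finset.sum_congr rfl fun c _ => ?_
      congr 2
      ext x
      simp [funext_iff]
    have hF : ∀ i : ℕ, Measurable fun x => ξ (T^[i] x) :=
      fun i => hξ.comp (hT.measurable.iterate i)
    have hFm : Measurable fun x (i : Fin m) => ξ (T^[i] x) := measurable_pi_lambda _ fun i => hF i
    have h1 := obsEntropy_le_add_condEntropy (μ := μ) hFm (hit (m + N))
    have h2 := condEntropy_pi_le (μ := μ) (m := m) (fun i x => ξ (T^[i] x)) hF (hit (m + N))
    have h3 : ∀ i ∈ Finset.range m, condEntropy μ (fun x => ξ (T^[i] x)) (itinerary T f (m + N)) ≤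
        condEntropy μ ξ (itinerary T f N) := by
      intro i hi
      rw [Finset.mem_range] at hi
      rw [← condEntropy_comp_measurePreserving (hT.iterate i) hξ (hit N)]
      have := condEntropy_le_condEntropy_comp (μ := μ)
        (fun (c : Fin (m + N) → A) (l : Fin N) => c ⟨i + l, by omega⟩) (hF i) (hit (m + N))
        (measurable_of_finite _)
      refine this.trans_eq ?_
      congr 1
      funext x l
      simp only [itinerary, ← Function.iterate_add_apply]
      rw [add_comm]
    have h4 := obsEntropy_itinerary_subadditive hT hf m N
    simp only at h4
    have h5 := Finset.sum_le_sum h3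
    simp only [Finset.sum_const, Finset.card_range, nsmul_eq_mul] at h5
    rw [h0]
    linarith
  refine EReal.le_of_forall_lt_iff_le.1 fun z hz => ?_
  have hz' : obsEntropy μ (itinerary T f n) / n < z := by exact_mod_cast hz
  set u := obsEntropy μ (itinerary T f n) / n
  -- One ε each for Fekete's lemma applied to f-itineraries, for the boundary term of length N, and
  -- for the conditional entropy.
  set ε := (z - u) / 3 with hε
  have hε0 : 0 < ε := by rw [hε]; linarith
  obtain ⟨N, hN⟩ := hcond ε hε0
  have e1 := (obsEntropy_itinerary_subadditive hT hf).eventually_div_lt_of_div_lt hn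
    (L := u + ε) (by change u < u + ε; linarith)
  have e2 : ∀ᶠ m : ℕ in atTop, obsEntropy μ (itinerary T f N) / m < ε :=
    (tendsto_const_div_atTop_nhds_zero_nat _).eventually_lt_const hε0
  refine limsup_le_of_le (by isBoundedDefault) ?_
  filter_upwards [e1, e2, eventually_gt_atTop 0] with m h1 h2 h3
  rw [EReal.coe_le_coe_iff]
  have hm : (0 : ℝ) < m := by exact_mod_cast h3
  rw [div_le_iff₀ hm]
  rw [div_lt_iff₀ hm] at h1 h2
  have := hbound N m
  have h4 : m * condEntropy μ ξ (itinerary T f N) ≤ m * ε := by gcongr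
  have : z = u + 3 * ε := by rw [hε]; ring
  rw [this]
  nlinarith

end Entropy

end Thermo

end

noncomputable section

namespace Thermo

variable {d : ℕ} {X : Subshift (Fin d) ℕ}

/-! ### Cylinders and words -/

theorem shiftMap_apply (x : X.carrier) (n : ℕ) : (shiftMap X x).1 n = x.1 (1 + n) := rfl

theorem iterate_shiftMap_apply (k : ℕ) (x : X.carrier) (n : ℕ) :
    ((shiftMap X)^[k] x).1 n = x.1 (k + n) := by
  induction k generalizing n with
  | zero => simp
  | succ k ih =>
    rw [Function.iterate_succ_apply', shiftMap_apply, ih, add_assoc]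

theorem mem_cyl_iff {w : List (Fin d)} {x : X.carrier} :
    x ∈ cyl X w ↔ ∀ (i : ℕ) (h : i < w.length), x.1 i = w[i] :=
  ⟨fun H i h => H ⟨i, h⟩, fun H i => H i.1 i.2⟩

theorem mem_cyl_append {u v : List (Fin d)} {x : X.carrier} :
    x ∈ cyl X (u ++ v) ↔ x ∈ cyl X u ∧ (shiftMap X)^[u.length] x ∈ cyl X v := by
  simp only [mem_cyl_iff, List.length_append, iterate_shiftMap_apply]
  constructor
  · intro H
    refine ⟨fun i h => ?_, fun i h => ?_⟩
    · rw [H i (by omega), List.getElem_append_left h]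
    · rw [H (u.length + i) (by omega), List.getElem_append_right (by omega)]
      simp
  · rintro ⟨h1, h2⟩ i h
    by_cases hi : i < u.length
    · rw [List.getElem_append_left hi, h1]
    · rw [List.getElem_append_right (by omega), ← h2 _ (by omega), Nat.add_sub_cancel' (by omega)]

theorem mem_cyl_nil (x : X.carrier) : x ∈ cyl X [] := by simp [mem_cyl_iff]

theorem cyl_nil : cyl X [] = Set.univ := Set.eq_univ_of_forall mem_cyl_nil

theorem eq_of_mem_cyl {u v : List (Fin d)} {x : X.carrier} (hu : x ∈ cyl X u) (hv : x ∈ cyl X v)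
    (h : u.length = v.length) : u = v := by
  rw [mem_cyl_iff] at hu hv
  exact List.ext_getElem h fun i h1 h2 => (hu i h1).symm.trans (hv i h2)

/-- The initial word of length `n` of a point, as a tuple. -/
def letters (X : Subshift (Fin d) ℕ) (n : ℕ) (x : X.carrier) : Fin n → Fin d := fun i => x.1 i

theorem mem_cyl_ofFn {n : ℕ} {c : Fin n → Fin d} {x : X.carrier} :
    x ∈ cyl X (List.ofFn c) ↔ letters X n x = c := by
  rw [mem_cyl_iff, funext_iff]
  simp only [List.length_ofFn, List.getElem_ofFn, letters]
  exact ⟨fun H i => H i.1 i.2, fun H i h => H ⟨i, h⟩⟩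

theorem cyl_ofFn {n : ℕ} (c : Fin n → Fin d) : cyl X (List.ofFn c) = letters X n ⁻¹' {c} := by
  ext x; exact mem_cyl_ofFn

theorem mem_cyl_letters (n : ℕ) (x : X.carrier) : x ∈ cyl X (List.ofFn (letters X n x)) :=
  mem_cyl_ofFn.2 rfl

theorem mem_language {w : List (Fin d)} : w ∈ language X ↔ (cyl X w).Nonempty := Iff.rfl

theorem mem_language_of_mem_cyl {w : List (Fin d)} {x : X.carrier} (h : x ∈ cyl X w) :
    w ∈ language X := ⟨x, h⟩

theorem letters_mem_language (n : ℕ) (x : X.carrier) : List.ofFn (letters X n x) ∈ language X :=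
  ⟨x, mem_cyl_letters n x⟩

theorem language_append_left {u v : List (Fin d)} (h : u ++ v ∈ language X) : u ∈ language X :=
  h.imp fun _ hx => (mem_cyl_append.1 hx).1

theorem language_append_right {u v : List (Fin d)} (h : u ++ v ∈ language X) : v ∈ language X := by
  obtain ⟨x, hx⟩ := h
  exact ⟨_, (mem_cyl_append.1 hx).2⟩

theorem nil_mem_language [Nonempty X.carrier] : [] ∈ language X :=
  ⟨Classical.arbitrary _, mem_cyl_nil _⟩

/-! ### Topology of the shift space -/

instance : CompactSpace X.carrier := isCompact_iff_compactSpace.1 X.isClosed.isCompact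

theorem continuous_shiftMap : Continuous (shiftMap X) :=
  ((continuous_shift 1).comp continuous_subtype_val).subtype_mk _

theorem measurable_shiftMap : Measurable (shiftMap X) := continuous_shiftMap.measurable

theorem isClopen_letters_preimage (n : ℕ) (S : Set (Fin n → Fin d)) :
    IsClopen (letters X n ⁻¹' S) := by
  have hc : Continuous (letters X n) :=
    continuous_pi fun i => (continuous_apply (i : ℕ)).comp continuous_subtype_val
  exact (isClopen_discrete S).preimage hc

theorem measurable_letters (n : ℕ) : Measurable (letters X n) :=
  measurable_pi_lambda _ fun i => (measurable_pi_apply (i : ℕ)).comp measurable_subtype_coe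

theorem isClopen_cyl (w : List (Fin d)) : IsClopen (cyl X w) := by
  have := isClopen_letters_preimage (X := X) w.length {w.get}
  rwa [← cyl_ofFn, List.ofFn_get] at this

theorem measurableSet_cyl (w : List (Fin d)) : MeasurableSet (cyl X w) :=
  (isClopen_cyl w).isOpen.measurableSet

theorem exists_letters_subset {U : Set X.carrier} (hU : IsOpen U) {x : X.carrier} (hx : x ∈ U) :
    ∃ n, ∀ y, letters X n y = letters X n x → y ∈ U := by
  obtain ⟨V, hV, rfl⟩ := isOpen_induced_iff.1 hU
  obtain ⟨C, ⟨z, n, rfl⟩, hxC, hCV⟩ :=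
    (PiNat.isTopologicalBasis_cylinders (fun _ : ℕ => Fin d)).exists_subset_of_mem_open hx hV
  refine ⟨n, fun y hy => hCV fun i hi => ?_⟩
  exact (congrFun hy ⟨i, hi⟩).trans (hxC i hi)

theorem letters_eq_of_le {m n : ℕ} (h : m ≤ n) {x y : X.carrier}
    (hxy : letters X n x = letters X n y) : letters X m x = letters X m y :=
  funext fun i => congrFun hxy ⟨i, i.2.trans_le h⟩

/-- Uniform continuity in terms of cylinders: finitely many cylinders of small oscillation cover X,
and the longest of their lengths serves for all points. -/
theorem exists_letters_abs_sub_lt {φ : X.carrier → ℝ} (hφ : Continuous φ) {ε : ℝ} (hε : 0 < ε) :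
    ∃ N, ∀ x y : X.carrier, letters X N x = letters X N y → |φ x - φ y| < ε := by
  have h : ∀ x : X.carrier, ∃ n, ∀ y, letters X n y = letters X n x → |φ y - φ x| < ε / 2 := by
    intro x
    refine exists_letters_subset (U := {y | |φ y - φ x| < ε / 2}) ?_ ?_
    · exact isOpen_lt (by fun_prop) continuous_const
    · simpa using hε
  choose n hn using h
  obtain ⟨t, ht⟩ := isCompact_univ.elim_nhds_subcover
    (fun x : X.carrier => letters X (n x) ⁻¹' {letters X (n x) x})
    (fun x _ => (isClopen_letters_preimage _ _).isOpen.mem_nhds rfl)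
  refine ⟨t.sup n, fun x y hxy => ?_⟩
  obtain ⟨z, hz, hxz⟩ := Set.mem_iUnion₂.1 (ht.2 (Set.mem_univ x))
  have h1 := hn z x hxz
  have h2 := hn z y ((letters_eq_of_le (Finset.le_sup hz) hxy).symm.trans hxz)
  rw [abs_lt] at *
  constructor <;> linarith

theorem exists_abs_le {φ : X.carrier → ℝ} (hφ : Continuous φ) : ∃ B, 0 ≤ B ∧ ∀ x, |φ x| ≤ B := by
  obtain ⟨B, hB⟩ := isCompact_univ.exists_bound_of_continuousOn hφ.continuousOn
  exact ⟨max B 0, le_max_right _ _, fun x => (hB x (Set.mem_univ x)).trans (le_max_left _ _)⟩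

/-- Finite unions of cylinders form an algebra that generates the σ-algebra, hence are dense for the
measure. A union of cylinders of length M is also one of any length N ≥ M. -/
theorem exists_letters_symmDiff_lt (m : Measure X.carrier) [IsFiniteMeasure m] {s : Set X.carrier}
    (hs : MeasurableSet s) {ε : ℝ} (hε : 0 < ε) :
    ∃ N₀, ∀ N ≥ N₀, ∃ S : Set (Fin N → Fin d), m.real (symmDiff s (letters X N ⁻¹' S)) < ε := by
  have lift : ∀ {M N : ℕ} (h : M ≤ N) (S : Set (Fin M → Fin d)),
      letters X M ⁻¹' S = letters X N ⁻¹' {c | (fun i : Fin M => c ⟨i, i.2.trans_le h⟩) ∈ S} :=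
    fun _ _ => rfl
  let 𝒜 : Set (Set X.carrier) := {t | ∃ (N : ℕ) (S : Set (Fin N → Fin d)), t = letters X N ⁻¹' S}
  have hA : IsSetAlgebra 𝒜 := by
    refine ⟨⟨0, ∅, rfl⟩, ?_, ?_⟩
    · rintro _ ⟨N, S, rfl⟩
      exact ⟨N, Sᶜ, rfl⟩
    · rintro _ _ ⟨M, S, rfl⟩ ⟨N, S', rfl⟩
      rw [lift (le_max_left M N), lift (le_max_right M N)]
      exact ⟨_, _, (Set.preimage_union).symm⟩
  have hgen : (inferInstance : MeasurableSpace X.carrier) = MeasurableSpace.generateFrom 𝒜 := by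
    refine le_antisymm ?_ (MeasurableSpace.generateFrom_le ?_)
    · change MeasurableSpace.comap (Subtype.val : X.carrier → ℕ → Fin d) MeasurableSpace.pi ≤ _
      rw [← measurable_iff_comap_le]
      change Measurable[MeasurableSpace.generateFrom 𝒜] (Subtype.val : X.carrier → ℕ → Fin d)
      refine @measurable_pi_lambda _ _ _ (MeasurableSpace.generateFrom 𝒜) _ _ fun i => ?_
      intro S _
      refine MeasurableSpace.measurableSet_generateFrom
        ⟨i + 1, {c | c (Fin.last i) ∈ S}, rfl⟩
    · rintro _ ⟨N, S, rfl⟩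
      exact measurable_letters N (Set.toFinite S).measurableSet
  obtain ⟨_, ⟨M, S, rfl⟩, h⟩ :=
    (Measure.MeasureDense.of_generateFrom_isSetAlgebra_finite (μ := m) hA hgen).approx s hs
      (measure_ne_top _ _) ε hε
  refine ⟨M, fun N hN => ⟨{c | (fun i : Fin M => c ⟨i, i.2.trans_le hN⟩) ∈ S}, ?_⟩⟩
  rw [← lift hN S, measureReal_def]
  exact (ENNReal.lt_ofReal_iff_toReal_lt (measure_ne_top _ _)).1 h

theorem itinerary_eq_letters (n : ℕ) :
    itinerary (shiftMap X) (fun x => x.1 0) n = letters X n := by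
  funext x i
  simp [itinerary, letters, iterate_shiftMap_apply]

/-- The zeroth letter is a generator, and its itineraries are the initial words. -/
theorem measureEntropy_le_letters {ν : Measure X.carrier} (hν : IsInvariantProb X ν) {n : ℕ}
    (hn : n ≠ 0) :
    measureEntropy (shiftMap X) ν ≤ ((obsEntropy ν (letters X n) / n : ℝ) : EReal) := by
  have := hν.1
  rw [← itinerary_eq_letters]
  have hm : Measurable fun x : X.carrier => x.1 0 :=
    (measurable_pi_apply 0).comp measurable_subtype_coe
  refine measureEntropy_le_of_generator hν.2 hm (fun s hs ε hε => ?_) hn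
  have := exists_letters_symmDiff_lt ν hs hε
  simpa only [← itinerary_eq_letters] using this

/-! ### Birkhoff sums over words -/

theorem abs_birkhoffSum_le {φ : X.carrier → ℝ} {B : ℝ} (hB : ∀ x, |φ x| ≤ B) (n : ℕ)
    (x : X.carrier) : |birkhoffSum (shiftMap X) φ n x| ≤ n * B := by
  refine (Finset.abs_sum_le_sum_abs _ _).trans ((Finset.sum_le_sum fun i _ => hB _).trans ?_)
  simp

theorem bddAbove_birkhoffSum {φ : X.carrier → ℝ} {B : ℝ} (hB : ∀ x, |φ x| ≤ B) (n : ℕ)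
    (s : Set X.carrier) : BddAbove (birkhoffSum (shiftMap X) φ n '' s) :=
  ⟨n * B, by rintro _ ⟨x, -, rfl⟩; exact (le_abs_self _).trans (abs_birkhoffSum_le hB n x)⟩

theorem continuous_birkhoffSum {φ : X.carrier → ℝ} (hφ : Continuous φ) (n : ℕ) :
    Continuous (birkhoffSum (shiftMap X) φ n) :=
  continuous_finsetSum _ fun i _ => hφ.comp (continuous_shiftMap.iterate i)

theorem birkhoffSum_le_wordSup {φ : X.carrier → ℝ} (hφ : Continuous φ) {w : List (Fin d)}
    {x : X.carrier} (hx : x ∈ cyl X w) :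
    birkhoffSum (shiftMap X) φ w.length x ≤ wordSup X φ w := by
  obtain ⟨B, -, hB⟩ := exists_abs_le hφ
  exact le_csSup (bddAbove_birkhoffSum hB _ _) ⟨x, hx, rfl⟩

theorem exists_birkhoffSum_eq_wordSup {φ : X.carrier → ℝ} (hφ : Continuous φ)
    {w : List (Fin d)} (hw : w ∈ language X) :
    ∃ x ∈ cyl X w, wordSup X φ w = birkhoffSum (shiftMap X) φ w.length x :=
  (isClopen_cyl w).isClosed.isCompact.exists_sSup_image_eq hw
    (continuous_birkhoffSum hφ _).continuousOn

theorem wordSup_nil [Nonempty X.carrier] (φ : X.carrier → ℝ) : wordSup X φ [] = 0 := by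
  have h : birkhoffSum (shiftMap X) φ ([] : List (Fin d)).length '' cyl X [] = {0} := by
    rw [cyl_nil]
    ext r
    simp [birkhoffSum]
  rw [wordSup, h, csSup_singleton]

theorem wordSup_append_le {φ : X.carrier → ℝ} (hφ : Continuous φ) {u v : List (Fin d)}
    (h : u ++ v ∈ language X) : wordSup X φ (u ++ v) ≤ wordSup X φ u + wordSup X φ v := by
  obtain ⟨x, hx, hs⟩ := exists_birkhoffSum_eq_wordSup hφ h
  rw [hs, List.length_append, birkhoffSum_add]
  have := mem_cyl_append.1 hx
  exact add_le_add (birkhoffSum_le_wordSup hφ this.1) (birkhoffSum_le_wordSup hφ this.2)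

theorem abs_wordSup_le {φ : X.carrier → ℝ} (hφ : Continuous φ) {B : ℝ} (hB : ∀ x, |φ x| ≤ B)
    {w : List (Fin d)} (hw : w ∈ language X) : |wordSup X φ w| ≤ w.length * B := by
  obtain ⟨x, -, hs⟩ := exists_birkhoffSum_eq_wordSup hφ hw
  rw [hs]
  exact abs_birkhoffSum_le hB _ _

theorem letters_iterate {w : List (Fin d)} {x y : X.carrier} (hx : x ∈ cyl X w) (hy : y ∈ cyl X w)
    {i N : ℕ} (h : i + N ≤ w.length) :
    letters X N ((shiftMap X)^[i] x) = letters X N ((shiftMap X)^[i] y) := by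
  funext j
  simp only [letters, iterate_shiftMap_apply]
  rw [mem_cyl_iff] at hx hy
  rw [hx _ (by omega), hy _ (by omega)]

/-- Two points in the same cylinder have Birkhoff sums that differ sublinearly. -/
theorem exists_abs_birkhoffSum_sub_le {φ : X.carrier → ℝ} (hφ : Continuous φ) {ε : ℝ}
    (hε : 0 < ε) :
    ∃ C, ∀ (w : List (Fin d)), ∀ x ∈ cyl X w, ∀ y ∈ cyl X w,
      |birkhoffSum (shiftMap X) φ w.length x - birkhoffSum (shiftMap X) φ w.length y| ≤
        C + ε * w.length := by
  obtain ⟨B, hB0, hB⟩ := exists_abs_le hφ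
  obtain ⟨N, hN⟩ := exists_letters_abs_sub_lt hφ hε
  -- Except at the last N times, the two orbits still share N letters and φ differs by less than ε;
  -- each exceptional time costs at most 2B.
  refine ⟨N * (2 * B), fun w x hx y hy => ?_⟩
  have hB2 : ∀ x y, |φ x - φ y| ≤ 2 * B := fun x y => by
    have h1 := abs_le.1 (hB x)
    have h2 := abs_le.1 (hB y)
    rw [abs_le]; constructor <;> linarith
  rw [birkhoffSum, birkhoffSum, ← Finset.sum_sub_distrib]
  refine (Finset.abs_sum_le_sum_abs _ _).trans ?_
  have hsplit : ∀ i ∈ Finset.range w.length,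
      |φ ((shiftMap X)^[i] x) - φ ((shiftMap X)^[i] y)| ≤
        (if w.length < i + N then 2 * B else 0) + ε := by
    intro i hi
    split_ifs with h
    · linarith [hB2 ((shiftMap X)^[i] x) ((shiftMap X)^[i] y)]
    · rw [zero_add]
      exact (hN _ _ (letters_iterate hx hy (by omega))).le
  refine (Finset.sum_le_sum hsplit).trans ?_
  rw [Finset.sum_add_distrib, ← Finset.sum_filter]
  simp only [Finset.sum_const, Finset.card_range, nsmul_eq_mul]
  have hcard : ((Finset.range w.length).filter fun i => w.length < i + N).card ≤ N := by
    calc _ ≤ (Finset.Ico (w.length + 1 - N) w.length).card := by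
          refine Finset.card_le_card fun i hi => ?_
          simp only [Finset.mem_filter, Finset.mem_range] at hi
          simp only [Finset.mem_Ico]; omega
      _ ≤ N := by rw [Nat.card_Ico]; omega
  have : (((Finset.range w.length).filter fun i => w.length < i + N).card : ℝ) * (2 * B) ≤
      N * (2 * B) := by gcongr
  linarith

end Thermo

end

noncomputable section

namespace Thermo

variable {d : ℕ} {X : Subshift (Fin d) ℕ}

/-! ### Pressure -/

theorem partitionSum_language_pos [Nonempty X.carrier] (φ : X.carrier → ℝ) (n : ℕ) :
    0 < partitionSum X (language X) φ n := by
  classical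
  refine Finset.sum_pos (fun _ _ => Real.exp_pos _) ?_
  exact ⟨letters X n (Classical.arbitrary _), by simpa using letters_mem_language _ _⟩

theorem partitionSum_nonneg (D : Set (List (Fin d))) (φ : X.carrier → ℝ) (n : ℕ) :
    0 ≤ partitionSum X D φ n :=
  Finset.sum_nonneg fun _ _ => (Real.exp_pos _).le

theorem partitionSum_add_le {φ : X.carrier → ℝ} (hφ : Continuous φ) (m n : ℕ) :
    partitionSum X (language X) φ (m + n) ≤
      partitionSum X (language X) φ m * partitionSum X (language X) φ n := by
  classical
  simp only [partitionSum, Finset.sum_filter]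
  rw [← (Fin.appendEquiv m n).sum_comp, Fintype.sum_prod_type, Finset.sum_mul_sum]
  refine Finset.sum_le_sum fun a _ => Finset.sum_le_sum fun b _ => ?_
  simp only [Fin.appendEquiv, Equiv.coe_fn_mk, List.ofFn_fin_append]
  split_ifs with h1 h2 h3 h3 h2 h3 h3
  · rw [← Real.exp_add]
    exact Real.exp_le_exp.2 (wordSup_append_le hφ h1)
  · exact absurd (language_append_right h1) h3
  · exact absurd (language_append_left h1) h2
  · exact absurd (language_append_left h1) h2
  all_goals positivity

theorem exp_neg_le_partitionSum [Nonempty X.carrier] {φ : X.carrier → ℝ} (hφ : Continuous φ)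
    {B : ℝ} (hB : ∀ x, |φ x| ≤ B) (n : ℕ) :
    Real.exp (-(n * B)) ≤ partitionSum X (language X) φ n := by
  classical
  set x : X.carrier := Classical.arbitrary _
  have h := letters_mem_language n x
  have h1 : Real.exp (wordSup X φ (List.ofFn (letters X n x))) ≤
      partitionSum X (language X) φ n :=
    Finset.single_le_sum (f := fun c => Real.exp (wordSup X φ (List.ofFn c)))
      (fun _ _ => (Real.exp_pos _).le) (by simpa using h)
  refine le_trans (Real.exp_le_exp.2 ?_) h1
  have := abs_wordSup_le hφ hB h
  rw [List.length_ofFn] at this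
  exact (abs_le.1 this).1

theorem partitionSum_subadditive [Nonempty X.carrier] {φ : X.carrier → ℝ} (hφ : Continuous φ) :
    Subadditive fun n => Real.log (partitionSum X (language X) φ n) := fun m n => by
  have hp := partitionSum_language_pos (X := X) φ
  rw [← Real.log_mul (hp m).ne' (hp n).ne']
  exact Real.log_le_log (hp _) (partitionSum_add_le hφ m n)

theorem bddBelow_log_partitionSum_div [Nonempty X.carrier] {φ : X.carrier → ℝ}
    (hφ : Continuous φ) :
    BddBelow (Set.range fun n : ℕ => Real.log (partitionSum X (language X) φ n) / n) := by
  obtain ⟨B, hB0, hB⟩ := exists_abs_le hφ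
  refine ⟨-B, ?_⟩
  rintro _ ⟨n, rfl⟩
  rcases Nat.eq_zero_or_pos n with rfl | hn
  · simpa using hB0
  · have hn' : (0 : ℝ) < n := by exact_mod_cast hn
    simp only
    rw [le_div_iff₀ hn', Real.le_log_iff_exp_le (partitionSum_language_pos φ n)]
    convert exp_neg_le_partitionSum hφ hB n using 2
    ring

theorem tendsto_pressure [Nonempty X.carrier] {φ : X.carrier → ℝ} (hφ : Continuous φ) :
    Tendsto (fun n : ℕ => Real.log (partitionSum X (language X) φ n) / n) atTop
      (𝓝 (pressure X φ)) := by
  have h := (partitionSum_subadditive hφ).tendsto_lim (bddBelow_log_partitionSum_div hφ)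
  rwa [← h.limsup_eq] at h

/-- By Fekete's lemma the pressure is a lower bound of the quotients log Λ_n / n, not only their
limit. -/
theorem exp_pressure_le_partitionSum [Nonempty X.carrier] {φ : X.carrier → ℝ}
    (hφ : Continuous φ) (n : ℕ) :
    Real.exp (n * pressure X φ) ≤ partitionSum X (language X) φ n := by
  rcases Nat.eq_zero_or_pos n with rfl | hn
  · obtain ⟨B, hB0, hB⟩ := exists_abs_le hφ
    simpa using exp_neg_le_partitionSum hφ hB 0
  · have hn' : (0 : ℝ) < n := by exact_mod_cast hn
    have h := (partitionSum_subadditive hφ).lim_le_div (bddBelow_log_partitionSum_div hφ) hn.ne'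
    have h' := (partitionSum_subadditive hφ).tendsto_lim (bddBelow_log_partitionSum_div hφ)
    rw [tendsto_nhds_unique h' (tendsto_pressure hφ), le_div_iff₀ hn', mul_comm,
      Real.le_log_iff_exp_le (partitionSum_language_pos φ n)] at h
    exact h

theorem exists_partitionSum_le [Nonempty X.carrier] {φ : X.carrier → ℝ} (hφ : Continuous φ)
    {ε : ℝ} (hε : 0 < ε) :
    ∃ C, 0 < C ∧ ∀ n : ℕ,
      partitionSum X (language X) φ n * Real.exp (-n * pressure X φ) ≤ C * Real.exp (n * ε) := by
  have h := (tendsto_pressure hφ).eventually_lt_const (lt_add_of_pos_right _ hε)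
  obtain ⟨n₀, hn₀⟩ := eventually_atTop.1 h
  set f : ℕ → ℝ := fun n => partitionSum X (language X) φ n * Real.exp (-n * pressure X φ)
  have hf : ∀ n, 0 ≤ f n := fun n => mul_nonneg (partitionSum_nonneg _ _ _) (Real.exp_pos _).le
  refine ⟨1 + ∑ n ∈ Finset.range (n₀ + 1), f n, ?_, fun n => ?_⟩
  · have := Finset.sum_nonneg fun n (_ : n ∈ Finset.range (n₀ + 1)) => hf n
    linarith
  · have h1 : (1 : ℝ) ≤ Real.exp (n * ε) := Real.one_le_exp (by positivity)
    have h0 := Finset.sum_nonneg fun n (_ : n ∈ Finset.range (n₀ + 1)) => hf n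
    by_cases hn : n < n₀ + 1
    · have := Finset.single_le_sum (fun n _ => hf n) (Finset.mem_range.2 hn)
      change f n ≤ _
      nlinarith
    · have hpos : (0 : ℝ) < n := by exact_mod_cast (by omega : 0 < n)
      have := hn₀ n (by omega)
      rw [div_lt_iff₀ hpos, Real.log_lt_iff_lt_exp (partitionSum_language_pos φ n)] at this
      calc _ ≤ Real.exp ((pressure X φ + ε) * n) * Real.exp (-n * pressure X φ) := by gcongr
        _ = Real.exp (n * ε) := by rw [← Real.exp_add]; congr 1; ring
        _ ≤ _ := by nlinarith

/-! ### Weights of words -/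

open Classical in
/-- The normalised weight `exp (φ_n(w) - n P)` of a word `w ∈ L` of length `n`; zero off `L`. -/
def weight (X : Subshift (Fin d) ℕ) (φ : X.carrier → ℝ) (w : List (Fin d)) : ENNReal :=
  if w ∈ language X then ENNReal.ofReal (Real.exp (wordSup X φ w - w.length * pressure X φ)) else 0

/-- The total weight of a collection of words. -/
def totalWeight (X : Subshift (Fin d) ℕ) (φ : X.carrier → ℝ) (D : Set (List (Fin d))) : ENNReal :=
  ∑' w, D.indicator (weight X φ) w

/-- The words of length `n` in `D`. -/
def level (D : Set (List (Fin d))) (n : ℕ) : Set (List (Fin d)) := {w | w ∈ D ∧ w.length = n}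

variable {φ : X.carrier → ℝ}

theorem weight_of_mem {w : List (Fin d)} (hw : w ∈ language X) :
    weight X φ w = ENNReal.ofReal (Real.exp (wordSup X φ w - w.length * pressure X φ)) := if_pos hw

theorem weight_ne_top (w : List (Fin d)) : weight X φ w ≠ ⊤ := by
  unfold weight; split_ifs <;> simp

theorem weight_nil [Nonempty X.carrier] : weight X φ [] = 1 := by
  rw [weight_of_mem nil_mem_language, wordSup_nil]; simp

theorem weight_append_le (hφ : Continuous φ) (u v : List (Fin d)) :
    weight X φ (u ++ v) ≤ weight X φ u * weight X φ v := by
  by_cases h : u ++ v ∈ language X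
  · rw [weight_of_mem h, weight_of_mem (language_append_left h),
      weight_of_mem (language_append_right h), ← ENNReal.ofReal_mul (Real.exp_pos _).le,
      ← Real.exp_add]
    refine ENNReal.ofReal_le_ofReal (Real.exp_le_exp.2 ?_)
    have := wordSup_append_le hφ h
    push_cast [List.length_append]
    linarith
  · rw [weight, if_neg h]; exact zero_le

theorem totalWeight_mono {D E : Set (List (Fin d))} (h : D ⊆ E) :
    totalWeight X φ D ≤ totalWeight X φ E :=
  ENNReal.tsum_le_tsum fun _ => Set.indicator_le_indicator_of_subset h (fun _ => zero_le) _

theorem totalWeight_union_le (D E : Set (List (Fin d))) :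
    totalWeight X φ (D ∪ E) ≤ totalWeight X φ D + totalWeight X φ E := by
  rw [totalWeight, totalWeight, totalWeight, ← ENNReal.tsum_add]
  refine ENNReal.tsum_le_tsum fun w => ?_
  by_cases hD : w ∈ D <;> by_cases hE : w ∈ E <;> simp [hD, hE]

theorem totalWeight_singleton (w : List (Fin d)) : totalWeight X φ {w} = weight X φ w := by
  rw [totalWeight, tsum_eq_single w]
  · simp
  · intro v hv; simp [hv]

theorem totalWeight_eq_tsum_subtype (D : Set (List (Fin d))) :
    totalWeight X φ D = ∑' w : D, weight X φ w := (tsum_subtype D _).symm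

/-- A word is recovered from its chosen factors, so the choice is injective into pairs, and the
weight is submultiplicative. Letting G depend on the suffix s allows the length of the other factor
to be prescribed. Words off the language have weight zero and need no factorisation. -/
theorem totalWeight_le_tsum (hφ : Continuous φ) {D E : Set (List (Fin d))}
    {G : List (Fin d) → Set (List (Fin d))}
    (h : ∀ z ∈ D, z ∈ language X → ∃ s ∈ E, ∃ v ∈ G s, z = v ++ s) :
    totalWeight X φ D ≤ ∑' s, E.indicator (weight X φ) s * totalWeight X φ (G s) := by
  choose! s hs v hv hz using h
  have h1 : totalWeight X φ D = totalWeight X φ (D ∩ language X) := by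
    refine tsum_congr fun w => ?_
    by_cases hw : w ∈ language X
    · by_cases hD : w ∈ D <;> simp [hD, hw]
    · simp [Set.indicator, weight, hw]
  rw [h1, totalWeight_eq_tsum_subtype]
  let F : List (Fin d) × List (Fin d) → ENNReal := fun p =>
    E.indicator (weight X φ) p.1 * (G p.1).indicator (weight X φ) p.2
  have hinj : Function.Injective fun z : ↥(D ∩ language X) => (s z, v z) := by
    intro z z' hzz
    simp only [Prod.mk.injEq] at hzz
    apply Subtype.ext
    rw [hz z z.2.1 z.2.2, hz z' z'.2.1 z'.2.2, hzz.1, hzz.2]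
  calc ∑' z : ↥(D ∩ language X), weight X φ z ≤ ∑' z : ↥(D ∩ language X), F (s z, v z) := by
        refine ENNReal.tsum_le_tsum fun z => ?_
        simp only [F]
        rw [Set.indicator_of_mem (hs z z.2.1 z.2.2), Set.indicator_of_mem (hv z z.2.1 z.2.2),
          mul_comm]
        conv_lhs => rw [hz z z.2.1 z.2.2]
        exact weight_append_le hφ _ _
    _ ≤ ∑' p, F p := ENNReal.tsum_comp_le_tsum_of_injective hinj F
    _ = _ := by
        rw [ENNReal.tsum_prod']
        refine tsum_congr fun a => ?_
        simp only [F]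
        rw [ENNReal.tsum_mul_left, totalWeight]

theorem totalWeight_le_mul (hφ : Continuous φ) {D E G : Set (List (Fin d))}
    (h : ∀ z ∈ D, z ∈ language X → ∃ s ∈ E, ∃ v ∈ G, z = v ++ s) :
    totalWeight X φ D ≤ totalWeight X φ E * totalWeight X φ G := by
  refine (totalWeight_le_tsum hφ (G := fun _ => G) h).trans_eq ?_
  rw [ENNReal.tsum_mul_right]; rfl

theorem totalWeight_level (D : Set (List (Fin d))) (n : ℕ) :
    totalWeight X φ (level D n) = ∑ c : Fin n → Fin d, D.indicator (weight X φ) (List.ofFn c) := by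
  rw [← tsum_fintype (L := SummationFilter.unconditional _), totalWeight]
  have hinj : Function.Injective (List.ofFn : (Fin n → Fin d) → List (Fin d)) :=
    List.ofFn_injective
  rw [← hinj.tsum_eq]
  · refine tsum_congr fun c => ?_
    have hl : List.ofFn c ∈ level D n ↔ List.ofFn c ∈ D := by
      change _ ∧ _ ↔ _
      rw [List.length_ofFn]; simp
    by_cases h : List.ofFn c ∈ D
    · rw [Set.indicator_of_mem h, Set.indicator_of_mem (hl.2 h)]
    · rw [Set.indicator_of_notMem h, Set.indicator_of_notMem (mt hl.1 h)]
  · intro w hw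
    have : w ∈ level D n := by
      by_contra h; simp [h] at hw
    obtain ⟨-, rfl⟩ := this
    exact ⟨w.get, List.ofFn_get w⟩

theorem totalWeight_level_eq {D : Set (List (Fin d))} (hD : D ⊆ language X) (n : ℕ) :
    totalWeight X φ (level D n) =
      ENNReal.ofReal (partitionSum X D φ n * Real.exp (-n * pressure X φ)) := by
  classical
  rw [totalWeight_level, partitionSum, Finset.sum_mul, ENNReal.ofReal_sum_of_nonneg
    (fun _ _ => by positivity), Finset.sum_filter]
  refine Finset.sum_congr rfl fun c _ => ?_
  by_cases h : List.ofFn c ∈ D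
  · rw [Set.indicator_of_mem h, if_pos h, weight_of_mem (hD h), ← Real.exp_add, List.length_ofFn]
    congr 2; ring
  · rw [Set.indicator_of_notMem h, if_neg h]

theorem totalWeight_eq_tsum_level (D : Set (List (Fin d))) :
    totalWeight X φ D = ∑' n, totalWeight X φ (level D n) := by
  rw [totalWeight, ← List.equivSigmaTuple.symm.tsum_eq, ENNReal.tsum_sigma']
  refine tsum_congr fun n => ?_
  rw [totalWeight_level, tsum_fintype]
  rfl

theorem tendsto_totalWeight_long {D : Set (List (Fin d))} (hD : totalWeight X φ D ≠ ⊤) :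
    Tendsto (fun M => totalWeight X φ {w | w ∈ D ∧ M ≤ w.length}) atTop (𝓝 0) := by
  rw [totalWeight_eq_tsum_level] at hD
  refine (ENNReal.tendsto_sum_nat_add _ hD).congr fun M => ?_
  rw [totalWeight_eq_tsum_level {w | w ∈ D ∧ M ≤ w.length},
    ← Summable.sum_add_tsum_nat_add' (f := fun n => totalWeight X φ
      (level {w | w ∈ D ∧ M ≤ w.length} n)) (k := M) ENNReal.summable, Finset.sum_eq_zero, zero_add]
  · refine tsum_congr fun n => ?_
    congr 1; ext w; simp only [level, Set.mem_ofPred_eq]; grind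
  · intro n hn
    rw [Finset.mem_range] at hn
    have : level {w | w ∈ D ∧ M ≤ w.length} n = ∅ := by
      ext w; simp only [level, Set.mem_ofPred_eq, Set.mem_empty_iff_false]; grind
    rw [this]; simp [totalWeight]

theorem one_le_totalWeight_level [Nonempty X.carrier] (hφ : Continuous φ) (n : ℕ) :
    1 ≤ totalWeight X φ (level (language X) n) := by
  rw [totalWeight_level_eq subset_rfl, ENNReal.one_le_ofReal]
  have := exp_pressure_le_partitionSum hφ n
  calc (1 : ℝ) = Real.exp (n * pressure X φ) * Real.exp (-n * pressure X φ) := by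
        rw [← Real.exp_add]; simp
    _ ≤ _ := by gcongr

theorem totalWeight_level_ne_top (D : Set (List (Fin d))) (n : ℕ) :
    totalWeight X φ (level D n) ≠ ⊤ := by
  rw [totalWeight_level]
  refine ENNReal.sum_ne_top.2 fun c _ => ?_
  by_cases h : List.ofFn c ∈ D
  · rw [Set.indicator_of_mem h]; exact weight_ne_top _
  · rw [Set.indicator_of_notMem h]; simp

/-- **Kraft inequality**: codes whose concatenations are recoverable words of the language carry
total weight at most one. -/
theorem sum_exp_le_one [Nonempty X.carrier] (hφ : Continuous φ) {I : Type*} [Fintype I]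
    (ℓ : I → ℕ) (h : I → ℝ) (f : ∀ k, (Fin k → I) → List (Fin d))
    (hinj : ∀ k, Function.Injective (f k)) (hL : ∀ k i, f k i ∈ language X)
    (hlen : ∀ k i, (f k i).length = ∑ j, ℓ (i j))
    (hs : ∀ k i, ∑ j, h (i j) ≤ wordSup X φ (f k i)) :
    ∑ i, Real.exp (h i - ℓ i * pressure X φ) ≤ 1 := by
  set P := pressure X φ
  set s := ∑ i, Real.exp (h i - ℓ i * P) with hs_def
  set N := ∑ i, ℓ i with hN
  have hs0 : 0 ≤ s := Finset.sum_nonneg fun _ _ => (Real.exp_pos _).le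
  have hlenN : ∀ k i, (f k i).length ≤ k * N := by
    intro k i
    rw [hlen]
    refine (Finset.sum_le_sum fun j _ =>
      Finset.single_le_sum (f := ℓ) (fun _ _ => Nat.zero_le _) (Finset.mem_univ (i j))).trans ?_
    simp [hN]
  -- Expanding the power gives one term for each k-tuple of code words. Each term is at most the
  -- weight of a word of length at most kN, and distinct tuples give distinct words.
  have hpow : ∀ k, ENNReal.ofReal (s ^ k) ≤
      ∑ n ∈ Finset.range (k * N + 1), totalWeight X φ (level (language X) n) := by
    intro k
    rw [hs_def, Fintype.sum_pow, ENNReal.ofReal_sum_of_nonneg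
      (fun _ _ => Finset.prod_nonneg fun _ _ => (Real.exp_pos _).le)]
    calc _ ≤ ∑ i : Fin k → I, weight X φ (f k i) := by
          refine Finset.sum_le_sum fun i _ => ?_
          rw [weight_of_mem (hL k i), ← Real.exp_sum, Finset.sum_sub_distrib, hlen,
            ← Finset.sum_mul]
          refine ENNReal.ofReal_le_ofReal (Real.exp_le_exp.2 ?_)
          push_cast
          linarith [hs k i]
      _ ≤ ∑ i : Fin k → I, ∑ n ∈ Finset.range (k * N + 1),
            (level (language X) n).indicator (weight X φ) (f k i) := by
          refine Finset.sum_le_sum fun i _ => ?_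
          have hmem : (f k i).length ∈ Finset.range (k * N + 1) := by
            rw [Finset.mem_range]; have := hlenN k i; omega
          refine le_trans ?_ (Finset.single_le_sum (f := fun n =>
            (level (language X) n).indicator (weight X φ) (f k i)) (fun _ _ => zero_le) hmem)
          rw [Set.indicator_of_mem]
          exact ⟨hL k i, rfl⟩
      _ = ∑ n ∈ Finset.range (k * N + 1), ∑ i : Fin k → I,
            (level (language X) n).indicator (weight X φ) (f k i) := Finset.sum_comm
      _ ≤ _ := by
          refine Finset.sum_le_sum fun n _ => ?_
          rw [← tsum_fintype (L := SummationFilter.unconditional _)]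
          exact ENNReal.tsum_comp_le_tsum_of_injective (hinj k) _
  by_contra! hs1
  -- With this ε one has exp(Nε) ≤ q = √s, so the subexponential growth of the level weights gives
  -- s^k ≤ C (kN + 1) q^k. Hence q^k grows at most linearly, which is absurd for q > 1.
  set ε := Real.log s / (2 * (N + 1)) with hε
  have hlog : 0 < Real.log s := Real.log_pos hs1
  have hε0 : 0 < ε := by positivity
  obtain ⟨C, hC, hCn⟩ := exists_partitionSum_le hφ hε0
  set q := Real.exp (Real.log s / 2) with hq
  have hq1 : 1 < q := Real.one_lt_exp_iff.2 (by positivity)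
  have hqs : q * q = s := by
    rw [hq, ← Real.exp_add, add_halves, Real.exp_log (by linarith)]
  have hqN : Real.exp (N * ε) ≤ q := by
    refine Real.exp_le_exp.2 ?_
    rw [hε]
    rw [mul_div_assoc', div_le_div_iff₀ (by positivity) (by positivity)]
    nlinarith
  have hbound : ∀ k : ℕ, q ^ k ≤ C * (k * N + 1) := by
    intro k
    have h1 : s ^ k ≤ (k * N + 1) * (C * q ^ k) := by
      have h2 : ∑ n ∈ Finset.range (k * N + 1), totalWeight X φ (level (language X) n) ≤
          ENNReal.ofReal ((k * N + 1) * (C * q ^ k)) := by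
        calc _ ≤ ∑ n ∈ Finset.range (k * N + 1), ENNReal.ofReal (C * q ^ k) := by
              refine Finset.sum_le_sum fun n hn => ?_
              rw [totalWeight_level_eq subset_rfl]
              refine ENNReal.ofReal_le_ofReal ((hCn n).trans ?_)
              gcongr
              rw [Finset.mem_range] at hn
              calc Real.exp (n * ε) ≤ Real.exp (k * (N * ε)) := by
                    refine Real.exp_le_exp.2 ?_
                    rw [← mul_assoc]
                    gcongr
                    exact_mod_cast (by omega : n ≤ k * N)
                _ = Real.exp (N * ε) ^ k := Real.exp_nat_mul _ _
                _ ≤ q ^ k := by gcongr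
          _ = _ := by
              rw [Finset.sum_const, Finset.card_range, nsmul_eq_mul,
                ENNReal.ofReal_mul (p := (k * N + 1 : ℝ)) (by positivity), ← ENNReal.ofReal_natCast]
              push_cast; rfl
      exact (ENNReal.ofReal_le_ofReal_iff (by positivity)).1 ((hpow k).trans h2)
    rw [← hqs, mul_pow] at h1
    have hqk : 0 < q ^ k := by positivity
    have : q ^ k * q ^ k ≤ (C * (k * N + 1)) * q ^ k := by linarith
    exact le_of_mul_le_mul_right this hqk
  have ht1 := tendsto_pow_const_div_const_pow_of_one_lt 1 hq1
  have ht0 := tendsto_pow_const_div_const_pow_of_one_lt 0 hq1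
  have ht : Tendsto (fun k : ℕ => C * N * ((k : ℝ) ^ 1 / q ^ k) + C * ((k : ℝ) ^ 0 / q ^ k)) atTop
      (𝓝 (C * N * 0 + C * 0)) := (ht1.const_mul _).add (ht0.const_mul _)
  rw [mul_zero, mul_zero, add_zero] at ht
  obtain ⟨k, hk⟩ := (ht.eventually_lt_const one_pos).exists
  have hqk : 0 < q ^ k := by positivity
  have : C * N * ((k : ℝ) ^ 1 / q ^ k) + C * ((k : ℝ) ^ 0 / q ^ k) = C * (k * N + 1) / q ^ k := by
    field_simp
  rw [this, div_lt_one hqk] at hk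
  linarith [hbound k]

end Thermo

end

noncomputable section

namespace Thermo

variable {d : ℕ} {X : Subshift (Fin d) ℕ} {φ : X.carrier → ℝ}

/-! ### Glued words -/

theorem glue_zero {α : Type*} (w : Fin 1 → List α) (v : Fin 0 → List α) : glue w v = w 0 := by
  simp [glue]

theorem glue_succ {α : Type*} {m : ℕ} (w : Fin (m + 2) → List α) (v : Fin (m + 1) → List α) :
    glue w v = w 0 ++ (v 0 ++ glue (fun i => w i.succ) fun i => v i.succ) := by
  simp [glue, List.ofFn_succ, List.append_assoc]

theorem length_glue {α : Type*} {m : ℕ} (w : Fin (m + 1) → List α) (v : Fin m → List α) :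
    (glue w v).length = ∑ i, (w i).length + ∑ i, (v i).length := by
  induction m with
  | zero => simp [glue_zero]
  | succ m ih =>
    rw [glue_succ, List.length_append, List.length_append, ih,
      Fin.sum_univ_succ fun i => (w i).length, Fin.sum_univ_succ fun i => (v i).length]
    ring

theorem eq_of_glue_eq {α : Type*} {m : ℕ} {w w' : Fin (m + 1) → List α} {v v' : Fin m → List α}
    (hw : ∀ i, (w i).length = (w' i).length) (hv : ∀ i, (v i).length = (v' i).length)
    (h : glue w v = glue w' v') : w = w' := by
  induction m with
  | zero =>
    rw [glue_zero, glue_zero] at h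
    funext i
    exact Fin.cases h (fun j => j.elim0) i
  | succ m ih =>
    rw [glue_succ, glue_succ] at h
    obtain ⟨h1, h2⟩ := List.append_inj h (hw 0)
    obtain ⟨-, h3⟩ := List.append_inj h2 (hv 0)
    have := ih (fun i => hw i.succ) (fun i => hv i.succ) h3
    funext i
    refine Fin.cases h1 (fun j => ?_) i
    exact congrFun this j

theorem le_birkhoffSum_glue {B : ℝ} (hB : ∀ x, |φ x| ≤ B) {m : ℕ} (w : Fin (m + 1) → List (Fin d))
    (v : Fin m → List (Fin d)) (r : Fin (m + 1) → ℝ)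
    (hr : ∀ i, ∀ x ∈ cyl X (w i), r i ≤ birkhoffSum (shiftMap X) φ (w i).length x)
    {x : X.carrier} (hx : x ∈ cyl X (glue w v)) :
    ∑ i, r i - B * ∑ i, ((v i).length : ℝ) ≤
      birkhoffSum (shiftMap X) φ (glue w v).length x := by
  induction m generalizing x with
  | zero =>
    rw [glue_zero] at hx ⊢
    simpa using hr 0 x hx
  | succ m ih =>
    rw [glue_succ] at hx ⊢
    obtain ⟨h1, h2⟩ := mem_cyl_append.1 hx
    obtain ⟨h3, h4⟩ := mem_cyl_append.1 h2
    rw [List.length_append, birkhoffSum_add, List.length_append, birkhoffSum_add]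
    have e1 := hr 0 x h1
    have e2 := ih (fun i => w i.succ) (fun i => v i.succ) (fun i => r i.succ)
      (fun i => hr i.succ) h4
    have e3 := (abs_le.1 (abs_birkhoffSum_le hB (v 0).length ((shiftMap X)^[(w 0).length] x))).1
    rw [Fin.sum_univ_succ r, Fin.sum_univ_succ fun i => ((v i).length : ℝ)]
    linarith

/-! ### Counting estimates for an adapted decomposition -/

variable {G Cs : Set (List (Fin d))}

theorem IsAdaptedDecomposition.nil_mem [Nonempty X.carrier] {Cp : Set (List (Fin d))}
    (h : IsAdaptedDecomposition X φ Cp G Cs) : [] ∈ G ∧ [] ∈ Cs := by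
  obtain ⟨u, -, v, hv, w, hw, hz⟩ := h.decompose [] nil_mem_language
  have := (List.append_eq_nil_iff.1 hz.symm)
  have h2 := List.append_eq_nil_iff.1 this.1
  exact ⟨h2.2 ▸ hv, this.2 ▸ hw⟩

theorem IsAdaptedDecomposition.core_subset_fattened [Nonempty X.carrier]
    (h : IsAdaptedDecomposition X φ {[]} G Cs) (M : ℕ) : G ⊆ fattened X {[]} G Cs M :=
  fun v hv => ⟨h.core_subset hv, [], rfl, v, hv, [], h.nil_mem.2, by simp, by simp, by simp⟩

theorem HasBowenPropertyOn.exists_nonneg {D : Set (List (Fin d))} (h : HasBowenPropertyOn X D φ) :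
    ∃ V, 0 ≤ V ∧ ∀ w ∈ D, ∀ x ∈ cyl X w, ∀ y ∈ cyl X w,
      |birkhoffSum (shiftMap X) φ w.length x - birkhoffSum (shiftMap X) φ w.length y| ≤ V := by
  obtain ⟨V, hV⟩ := h
  exact ⟨|V|, abs_nonneg _, fun w hw x hx y hy => (hV w hw x hx y hy).trans (le_abs_self _)⟩

theorem wordSup_sub_le (hφ : Continuous φ) {V : ℝ} {w : List (Fin d)}
    (hV : ∀ x ∈ cyl X w, ∀ y ∈ cyl X w,
      |birkhoffSum (shiftMap X) φ w.length x - birkhoffSum (shiftMap X) φ w.length y| ≤ V)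
    {x : X.carrier} (hx : x ∈ cyl X w) :
    wordSup X φ w - V ≤ birkhoffSum (shiftMap X) φ w.length x := by
  obtain ⟨y, hy, hs⟩ := exists_birkhoffSum_eq_wordSup hφ ⟨x, hx⟩
  have := (abs_le.1 (hV x hx y hy)).1
  rw [hs]; linarith

/-- Words of length n in D, glued with gaps of length t, form a code of word length n + t to which
Kraft applies. The gaps may depend on the whole tuple, but the words stand at fixed positions and
remain readable. -/
theorem exists_totalWeight_level_le [Nonempty X.carrier] (hφ : Continuous φ)
    {D : Set (List (Fin d))} (hDL : D ⊆ language X) (hnil : [] ∈ D) {t : ℕ}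
    (ht : HasSpecificationOn X D t) (hbow : HasBowenPropertyOn X D φ) :
    ∃ C : ℝ, 0 < C ∧ ∀ n, totalWeight X φ (level D n) ≤ ENNReal.ofReal C := by
  classical
  obtain ⟨B, hB0, hB⟩ := exists_abs_le hφ
  obtain ⟨V, hV0, hV⟩ := hbow.exists_nonneg
  -- Per code word, V is lost through the Bowen property and tB through the values of φ on the gap,
  -- while the extra length t contributes tP.
  refine ⟨Real.exp (V + t * B + t * pressure X φ), Real.exp_pos _, fun n => ?_⟩
  let I := {c : Fin n → Fin d // List.ofFn c ∈ D}
  -- A final empty word is glued on so that each of the k code words is followed by a gap and the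
  -- total length is exactly k(n + t), also for k = 0.
  let W : ∀ k, (Fin k → I) → Fin (k + 1) → List (Fin d) := fun k i =>
    Fin.snoc (α := fun _ => List (Fin d)) (fun j => List.ofFn (i j).1) []
  have hW : ∀ k i j, W k i j ∈ D := by
    intro k i j
    refine Fin.lastCases ?_ (fun j => ?_) j
    · simpa [W] using hnil
    · simpa [W] using (i j).2
  choose v hv hg using fun k i => ht k (W k i) (hW k i)
  have key := sum_exp_le_one (X := X) hφ (I := I) (fun _ => n + t)
    (fun c => wordSup X φ (List.ofFn c.1) - V - t * B) (fun k i => glue (W k i) (v k i)) ?_ hg ?_ ?_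
  · rw [totalWeight_level_eq hDL]
    refine ENNReal.ofReal_le_ofReal ?_
    have e : partitionSum X D φ n = ∑ c : I, Real.exp (wordSup X φ (List.ofFn c.1)) := by
      rw [partitionSum]
      exact (Finset.sum_subtype _ (by simp) _)
    have e2 : ∑ i : I, Real.exp (wordSup X φ (List.ofFn i.1) - V - t * B -
        ((n + t : ℕ) : ℝ) * pressure X φ) =
        (∑ c : I, Real.exp (wordSup X φ (List.ofFn c.1))) * Real.exp (-n * pressure X φ) *
          Real.exp (-(V + t * B + t * pressure X φ)) := by
      rw [Finset.sum_mul, Finset.sum_mul]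
      refine Finset.sum_congr rfl fun c _ => ?_
      rw [← Real.exp_add, ← Real.exp_add]
      congr 1; push_cast; ring
    rw [e2, Real.exp_neg, ← div_eq_mul_inv, div_le_one (Real.exp_pos _), ← e] at key
    exact key
  · intro k i i' h
    have := eq_of_glue_eq (w := W k i) (w' := W k i') ?_ ?_ h
    · funext j
      have h2 := congrFun this j.castSucc
      simp only [W, Fin.snoc_castSucc] at h2
      exact Subtype.ext (List.ofFn_injective h2)
    · intro j
      refine Fin.lastCases ?_ (fun j => ?_) j <;> simp [W]
    · intro j
      rw [(hv k i j).2, (hv k i' j).2]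
  · intro k i
    simp only [length_glue, (hv k i _).2, Fin.sum_univ_castSucc, W, Fin.snoc_castSucc,
      Fin.snoc_last, List.length_ofFn, List.length_nil]
    simp [mul_add]
  · intro k i
    obtain ⟨x, hx⟩ := hg k i
    have h1 := le_birkhoffSum_glue hB (W k i) (v k i)
      (Fin.snoc (α := fun _ => ℝ) (fun j => wordSup X φ (List.ofFn (i j).1) - V) 0) ?_ hx
    · refine le_trans (le_trans (le_of_eq ?_) h1) (birkhoffSum_le_wordSup hφ hx)
      simp only [(hv k i _).2, Fin.sum_univ_castSucc, Fin.snoc_castSucc, Fin.snoc_last,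
        Finset.sum_sub_distrib]
      simp; ring
    · intro j
      refine Fin.lastCases ?_ (fun j => ?_) j
      · intro x _
        simp [W]
      · intro x hx
        simp only [W, Fin.snoc_castSucc] at hx ⊢
        exact wordSup_sub_le hφ (hV _ (i j).2) hx

theorem HasPerSpecificationOn.hasSpecificationOn {D : Set (List (Fin d))} {t : ℕ}
    (h : HasPerSpecificationOn X D t) : HasSpecificationOn X D t := fun m w hw => by
  obtain ⟨v, hv, hg, -⟩ := h m w hw
  exact ⟨v, hv, hg⟩

theorem HasPerSpecificationOn.mono {D E : Set (List (Fin d))} {t : ℕ}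
    (h : HasPerSpecificationOn X E t) (hDE : D ⊆ E) : HasPerSpecificationOn X D t :=
  fun m w hw => h m w fun i => hDE (hw i)

namespace IsAdaptedDecomposition

variable (h : IsAdaptedDecomposition X φ {[]} G Cs)

include h

theorem totalWeight_suffix_ne_top [Nonempty X.carrier] : totalWeight X φ Cs ≠ ⊤ := by
  rw [totalWeight_eq_tsum_level, tsum_eq_zero_add' ENNReal.summable]
  refine ENNReal.add_ne_top.2 ⟨totalWeight_level_ne_top _ _, ?_⟩
  have hU : ({[]} ∪ Cs : Set (List (Fin d))) ⊆ language X :=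
    Set.union_subset h.prefix_subset h.suffix_subset
  have h1 : ∀ n, totalWeight X φ (level Cs (n + 1)) ≤ ENNReal.ofReal
      (partitionSum X ({[]} ∪ Cs) φ (n + 1) * Real.exp (-((n + 1 : ℕ) : ℝ) * pressure X φ)) := by
    intro n
    rw [← totalWeight_level_eq hU]
    exact totalWeight_mono fun w hw => ⟨Or.inr hw.1, hw.2⟩
  refine ne_top_of_le_ne_top ?_ (ENNReal.tsum_le_tsum h1)
  exact h.summable.tsum_ofReal_ne_top

theorem exists_totalWeight_core_le [Nonempty X.carrier] (hφ : Continuous φ) :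
    ∃ C : ℝ, 0 < C ∧ ∀ n, totalWeight X φ (level G n) ≤ ENNReal.ofReal C := by
  obtain ⟨t, ht⟩ := h.specification 0
  exact exists_totalWeight_level_le hφ h.core_subset h.nil_mem.1
    (ht.mono (h.core_subset_fattened 0)).hasSpecificationOn h.bowen

/-- For a fixed suffix s the core has the fixed length n - |s|, so a single level of G, of weight at
most C, is involved for each s. -/
theorem totalWeight_level_le_mul [Nonempty X.carrier] (hφ : Continuous φ) {C : ENNReal}
    (hC : ∀ n, totalWeight X φ (level G n) ≤ C) {D E : Set (List (Fin d))}
    (hD : ∀ z ∈ D, z ∈ language X → ∃ s ∈ E, ∃ v ∈ G, z = v ++ s) (n : ℕ) :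
    totalWeight X φ (level D n) ≤ totalWeight X φ E * C := by
  have h1 := totalWeight_le_tsum (X := X) (φ := φ) hφ (D := level D n) (E := E)
    (G := fun s => level G (n - s.length)) (fun z hz hzL => by
      obtain ⟨s, hs, v, hv, rfl⟩ := hD z hz.1 hzL
      have := hz.2
      rw [List.length_append] at this
      exact ⟨s, hs, v, ⟨hv, by omega⟩, rfl⟩)
  refine h1.trans ?_
  rw [totalWeight, ← ENNReal.tsum_mul_right]
  exact ENNReal.tsum_le_tsum fun s => by gcongr; exact hC _

theorem exists_totalWeight_language_le [Nonempty X.carrier] (hφ : Continuous φ) :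
    ∃ C : ℝ, 0 < C ∧ ∀ n, totalWeight X φ (level (language X) n) ≤ ENNReal.ofReal C := by
  obtain ⟨C, hC0, hC⟩ := h.exists_totalWeight_core_le hφ
  refine ⟨(totalWeight X φ Cs).toReal * C + 1, by positivity, fun n => ?_⟩
  refine (h.totalWeight_level_le_mul hφ hC (E := Cs) (fun z hz _ => ?_) n).trans ?_
  · obtain ⟨u, hu, v, hv, w, hw, rfl⟩ := h.decompose z hz
    rw [Set.mem_singleton_iff] at hu
    exact ⟨w, hw, v, hv, by simp [hu]⟩
  · rw [← ENNReal.ofReal_toReal h.totalWeight_suffix_ne_top, ← ENNReal.ofReal_mul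
      ENNReal.toReal_nonneg]
    refine ENNReal.ofReal_le_ofReal ?_
    rw [ENNReal.toReal_ofReal ENNReal.toReal_nonneg]
    linarith

/-- A word outside G(M) decomposes with a suffix longer than M, and the total weight of long
suffixes is the tail of a convergent series. The bound is therefore uniform in n. -/
theorem exists_totalWeight_not_fattened_le [Nonempty X.carrier] (hφ : Continuous φ) {ε : ℝ}
    (hε : 0 < ε) :
    ∃ M₀, ∀ M ≥ M₀, ∀ n, totalWeight X φ (level (language X \ fattened X {[]} G Cs M) n) ≤
      ENNReal.ofReal ε := by
  obtain ⟨C, hC0, hC⟩ := h.exists_totalWeight_core_le hφ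
  have ht := tendsto_totalWeight_long h.totalWeight_suffix_ne_top
  have ht2 := ENNReal.Tendsto.mul_const ht (Or.inr (ENNReal.ofReal_ne_top (r := C)))
  rw [zero_mul] at ht2
  have hev := ht2.eventually (gt_mem_nhds (ENNReal.ofReal_pos.2 hε))
  obtain ⟨M₀, hM₀⟩ := eventually_atTop.1 hev
  refine ⟨M₀, fun M hM n => ?_⟩
  refine (h.totalWeight_level_le_mul hφ hC (E := {w | w ∈ Cs ∧ M ≤ w.length})
    (fun z hz _ => ?_) n).trans (hM₀ M hM).le
  obtain ⟨u, hu, v, hv, w, hw, rfl⟩ := h.decompose z hz.1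
  rw [Set.mem_singleton_iff] at hu
  subst hu
  refine ⟨w, ⟨hw, ?_⟩, v, hv, by simp⟩
  by_contra hlt
  exact hz.2 ⟨hz.1, [], rfl, v, hv, w, hw, by simp, by omega, by simp⟩

theorem fattened_mono {M N : ℕ} (hMN : M ≤ N) :
    fattened X {[]} G Cs M ⊆ fattened X {[]} G Cs N := by
  rintro z ⟨hz, u, hu, v, hv, w, hw, h1, h2, h3⟩
  exact ⟨hz, u, hu, v, hv, w, hw, h1.trans hMN, h2.trans hMN, h3⟩

/-- Each level of the language weighs at least 1, of which at most 1/2 lies outside G(M). -/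
theorem exists_half_le_totalWeight_fattened [Nonempty X.carrier] (hφ : Continuous φ) :
    ∃ M₀, ∀ M ≥ M₀, ∀ n,
      ENNReal.ofReal (1 / 2) ≤ totalWeight X φ (level (fattened X {[]} G Cs M) n) := by
  obtain ⟨M₀, hM₀⟩ := h.exists_totalWeight_not_fattened_le hφ (ε := 1 / 2) (by norm_num)
  refine ⟨M₀, fun M hM n => ?_⟩
  have h1 := one_le_totalWeight_level (X := X) hφ n
  have h2 : totalWeight X φ (level (language X) n) ≤
      totalWeight X φ (level (fattened X {[]} G Cs M) n) +
        totalWeight X φ (level (language X \ fattened X {[]} G Cs M) n) := by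
    refine le_trans (totalWeight_mono fun w hw => ?_) (totalWeight_union_le _ _)
    by_cases hf : w ∈ fattened X {[]} G Cs M
    · exact Or.inl ⟨hf, hw.2⟩
    · exact Or.inr ⟨⟨hw.1, hf⟩, hw.2⟩
  have h3 := (h1.trans h2).trans (add_le_add_right (hM₀ M hM n) _)
  have h4 : (1 : ENNReal) = ENNReal.ofReal (1 / 2) + ENNReal.ofReal (1 / 2) := by
    rw [← ENNReal.ofReal_add (by norm_num) (by norm_num)]; norm_num
  rw [h4] at h3
  exact (ENNReal.add_le_add_iff_right ENNReal.ofReal_ne_top).1 h3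

theorem exists_bowen_fattened (hφ : Continuous φ) (M : ℕ) :
    ∃ V, 0 ≤ V ∧ ∀ w ∈ fattened X {[]} G Cs M, ∀ x ∈ cyl X w, ∀ y ∈ cyl X w,
      |birkhoffSum (shiftMap X) φ w.length x - birkhoffSum (shiftMap X) φ w.length y| ≤ V := by
  obtain ⟨B, hB0, hB⟩ := exists_abs_le hφ
  obtain ⟨V, hV0, hV⟩ := h.bowen.exists_nonneg
  refine ⟨V + 2 * (M * B), by positivity, ?_⟩
  rintro _ ⟨-, u, hu, v, hv, w, -, -, h2, rfl⟩ x hx y hy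
  rw [Set.mem_singleton_iff] at hu
  subst hu
  rw [List.nil_append] at hx hy ⊢
  rw [mem_cyl_append] at hx hy
  rw [List.length_append, birkhoffSum_add, birkhoffSum_add]
  have e1 := abs_le.1 (hV v hv x hx.1 y hy.1)
  have e2 := abs_le.1 (abs_birkhoffSum_le hB w.length ((shiftMap X)^[v.length] x))
  have e3 := abs_le.1 (abs_birkhoffSum_le hB w.length ((shiftMap X)^[v.length] y))
  have e4 : (w.length : ℝ) * B ≤ M * B := by gcongr
  rw [abs_le]
  constructor <;> linarith

end IsAdaptedDecomposition

end Thermo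

end

noncomputable section

namespace Thermo

variable {d : ℕ} {X : Subshift (Fin d) ℕ} {φ : X.carrier → ℝ}

/-! ### Sums over periodic points -/

/-- The total weight `∑ exp (S_n φ(x))` of the points of period `n` in `E`. -/
def periodicWeight (X : Subshift (Fin d) ℕ) (φ : X.carrier → ℝ) (n : ℕ) (E : Set X.carrier) :
    ENNReal :=
  ∑' x : ↥(Function.ptsOfPeriod (shiftMap X) n ∩ E), orbitWeight X φ n x

theorem periodicWeight_eq (n : ℕ) (E : Set X.carrier) :
    periodicWeight X φ n E =
      ∑' x : Function.ptsOfPeriod (shiftMap X) n, E.indicator (orbitWeight X φ n) x := by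
  rw [periodicWeight, tsum_subtype, tsum_subtype (Function.ptsOfPeriod (shiftMap X) n)
    (E.indicator (orbitWeight X φ n)), Set.indicator_indicator]

theorem periodicOrbitMeasure_apply (n : ℕ) {E : Set X.carrier} (hE : MeasurableSet E) :
    periodicOrbitMeasure X φ n E = (periodicWeight X φ n Set.univ)⁻¹ * periodicWeight X φ n E := by
  rw [periodicOrbitMeasure, Measure.smul_apply, Measure.sum_apply _ hE, periodicWeight_eq,
    periodicWeight_eq]
  simp only [Set.indicator_univ, smul_eq_mul, Measure.smul_apply, Measure.dirac_apply' _ hE]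
  congr 2
  funext x
  by_cases h : x.1 ∈ E <;> simp [h]

theorem tsum_orbitWeight_le {J : Type*} (n : ℕ) {E : Set X.carrier} (F : J → X.carrier)
    (hF : Function.Injective F) (hper : ∀ j, Function.IsPeriodicPt (shiftMap X) n (F j))
    (hE : ∀ j, F j ∈ E) : ∑' j, orbitWeight X φ n (F j) ≤ periodicWeight X φ n E := by
  let F' : J → ↥(Function.ptsOfPeriod (shiftMap X) n ∩ E) := fun j => ⟨F j, hper j, hE j⟩
  have hF' : Function.Injective F' := fun i j hij => hF (congrArg Subtype.val hij)
  exact ENNReal.tsum_comp_le_tsum_of_injective hF' fun x => orbitWeight X φ n x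

theorem eq_of_letters_eq {n : ℕ} (hn : 0 < n) {x y : X.carrier}
    (hx : Function.IsPeriodicPt (shiftMap X) n x) (hy : Function.IsPeriodicPt (shiftMap X) n y)
    (h : letters X n x = letters X n y) : x = y := by
  have step : ∀ z : X.carrier, Function.IsPeriodicPt (shiftMap X) n z →
      ∀ i, z.1 (n + i) = z.1 i := by
    intro z hz i
    rw [← iterate_shiftMap_apply, hz.eq]
  apply Subtype.ext
  funext i
  induction i using Nat.strong_induction_on with
  | _ i ih =>
    by_cases hi : i < n
    · exact congrFun h ⟨i, hi⟩
    · have e : n + (i - n) = i := by omega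
      rw [← e, step x hx, step y hy, ih _ (by omega)]

/-- A point of period n in [w] is determined by the n - |w| letters that follow w, and its Birkhoff
sum splits at that place. -/
theorem periodicWeight_cyl_le (hφ : Continuous φ) {n : ℕ} (hn : 0 < n) {w : List (Fin d)}
    (hw : w.length ≤ n) :
    periodicWeight X φ n (cyl X w) ≤ ENNReal.ofReal (Real.exp (n * pressure X φ)) * weight X φ w *
      totalWeight X φ (level (language X) (n - w.length)) := by
  set k := w.length with hk
  let u : ↥(Function.ptsOfPeriod (shiftMap X) n ∩ cyl X w) → List (Fin d) := fun x =>
    List.ofFn (letters X (n - k) ((shiftMap X)^[k] x))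
  have hu : Function.Injective u := by
    intro x y hxy
    have hxy := List.ofFn_injective hxy
    apply Subtype.ext
    refine eq_of_letters_eq hn x.2.1 y.2.1 ?_
    funext i
    by_cases hi : (i : ℕ) < k
    · have h1 := mem_cyl_iff.1 x.2.2 i hi
      have h2 := mem_cyl_iff.1 y.2.2 i hi
      exact h1.trans h2.symm
    · have := congrFun hxy ⟨i - k, by omega⟩
      simp only [letters, iterate_shiftMap_apply] at this
      rwa [Nat.add_sub_cancel' (by omega)] at this
  calc periodicWeight X φ n (cyl X w)
      ≤ ∑' x : ↥(Function.ptsOfPeriod (shiftMap X) n ∩ cyl X w),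
        ENNReal.ofReal (Real.exp (n * pressure X φ)) * weight X φ w *
          (level (language X) (n - k)).indicator (weight X φ) (u x) := by
        refine ENNReal.tsum_le_tsum fun x => ?_
        have hL : u x ∈ language X := letters_mem_language _ _
        have hlen : (u x).length = n - k := List.length_ofFn
        have hmem : u x ∈ level (language X) (n - k) := ⟨hL, hlen⟩
        rw [Set.indicator_of_mem hmem, weight_of_mem hL,
          weight_of_mem (mem_language_of_mem_cyl x.2.2), ← ENNReal.ofReal_mul (Real.exp_pos _).le,
          ← ENNReal.ofReal_mul (by positivity), ← Real.exp_add, ← Real.exp_add, orbitWeight]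
        refine ENNReal.ofReal_le_ofReal (Real.exp_le_exp.2 ?_)
        have e1 := birkhoffSum_le_wordSup hφ x.2.2
        have e2 := birkhoffSum_le_wordSup hφ (mem_cyl_letters (n - k) ((shiftMap X)^[k] x.1))
        rw [List.length_ofFn] at e2
        have e3 := birkhoffSum_add (shiftMap X) φ k (n - k) x.1
        rw [Nat.add_sub_cancel' hw] at e3
        rw [hlen, e3, Nat.cast_sub hw]
        simp only [u, ← hk] at e1 ⊢
        linarith
    _ ≤ _ := by
        rw [ENNReal.tsum_mul_left]
        gcongr
        exact ENNReal.tsum_comp_le_tsum_of_injective hu _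

theorem glue_four {α : Type*} (w : Fin 4 → List α) (v : Fin 3 → List α) :
    glue w v = w 0 ++ (v 0 ++ (w 1 ++ (v 1 ++ (w 2 ++ (v 2 ++ w 3))))) := by
  rw [glue_succ, glue_succ, glue_succ, glue_zero]; rfl

/-- Periodic specification glues w, a filler, u and a second filler into a periodic orbit. The
fillers range over whole levels of D, of weight at least 1/2 each, and can be read off the periodic
point at fixed places, so distinct fillers give distinct points. -/
theorem exists_le_periodicWeight (hφ : Continuous φ) {D : Set (List (Fin d))}
    (hDL : D ⊆ language X) {t : ℕ} (ht : HasPerSpecificationOn X D t) {V : ℝ}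
    (hV : ∀ w ∈ D, ∀ x ∈ cyl X w, ∀ y ∈ cyl X w,
      |birkhoffSum (shiftMap X) φ w.length x - birkhoffSum (shiftMap X) φ w.length y| ≤ V)
    (hD : ∀ n, ENNReal.ofReal (1 / 2) ≤ totalWeight X φ (level D n)) :
    ∃ c : ℝ, 0 < c ∧ ∀ w ∈ D, ∀ u ∈ D, ∀ l n, w.length + 2 * t ≤ l → l + u.length + 2 * t ≤ n →
      ENNReal.ofReal (c * Real.exp (n * pressure X φ)) * (weight X φ w * weight X φ u) ≤
        periodicWeight X φ n (cyl X w ∩ (shiftMap X)^[l] ⁻¹' cyl X u) := by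
  obtain ⟨B, hB0, hB⟩ := exists_abs_le hφ
  set P := pressure X φ
  -- Four words lose V each and four gaps, the closing one included, lose tB each; 4tP accounts for
  -- the gap letters in the period n.
  set c₀ := Real.exp (-(4 * V + 4 * (t * B) + 4 * (t * P)))
  refine ⟨c₀ * (1 / 2) * (1 / 2), by positivity, fun w hw u hu l n hl hn => ?_⟩
  -- The filler lengths a and b are chosen so that u starts exactly at time l and the period is
  -- exactly n.
  obtain ⟨a, ha⟩ := Nat.exists_eq_add_of_le hl
  obtain ⟨b, hb⟩ := Nat.exists_eq_add_of_le hn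
  let W : level D a × level D b → Fin 4 → List (Fin d) := fun p => ![w, p.1.1, u, p.2.1]
  have hW : ∀ p i, W p i ∈ D := by
    intro p i
    fin_cases i
    exacts [hw, p.1.2.1, hu, p.2.2.1]
  choose v hv hg x hx hper using fun p => ht 3 (W p) (hW p)
  have hglue : ∀ p, (glue (W p) (v p)).length = w.length + a + u.length + b + 3 * t := by
    intro p
    have e : ∑ i : Fin (3 + 1), (W p i).length =
        w.length + p.1.1.length + u.length + p.2.1.length := Fin.sum_univ_four _
    rw [length_glue, e, p.1.2.2, p.2.2.2]
    simp only [Fin.sum_univ_three, (hv p _).2]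
    ring
  have hper' : ∀ p, Function.IsPeriodicPt (shiftMap X) n (x p) := by
    intro p
    have := hper p
    rw [hglue] at this
    convert this using 1
    omega
  have hpos : ∀ p, x p ∈ cyl X w ∧ (shiftMap X)^[w.length + t] (x p) ∈ cyl X p.1.1 ∧
      (shiftMap X)^[l] (x p) ∈ cyl X u ∧ (shiftMap X)^[l + u.length + t] (x p) ∈ cyl X p.2.1 := by
    intro p
    have := hx p
    rw [glue_four] at this
    simp only [mem_cyl_append, (hv p _).2, ← Function.iterate_add_apply, W, Matrix.cons_val,
      p.1.2.2] at this
    obtain ⟨h1, -, h2, -, h3, -, h4⟩ := this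
    refine ⟨h1, ?_, ?_, ?_⟩
    · convert h2 using 2; ring
    · convert h3 using 2; omega
    · convert h4 using 2; omega
  have hinj : Function.Injective x := by
    intro p q hpq
    have hp := hpos p
    have hq := hpos q
    rw [← hpq] at hq
    refine Prod.ext (Subtype.ext ?_) (Subtype.ext ?_)
    · exact eq_of_mem_cyl hp.2.1 hq.2.1 (p.1.2.2.trans q.1.2.2.symm)
    · exact eq_of_mem_cyl hp.2.2.2 hq.2.2.2 (p.2.2.2.trans q.2.2.2.symm)
  have hwt : ∀ p, ENNReal.ofReal (c₀ * Real.exp (n * P)) * (weight X φ w * weight X φ u) *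
      (weight X φ p.1.1 * weight X φ p.2.1) ≤ orbitWeight X φ n (x p) := by
    intro p
    rw [weight_of_mem (hDL hw), weight_of_mem (hDL hu), weight_of_mem (hDL p.1.2.1),
      weight_of_mem (hDL p.2.2.1), ← ENNReal.ofReal_mul (by positivity),
      ← ENNReal.ofReal_mul (by positivity), ← ENNReal.ofReal_mul (by positivity),
      ← ENNReal.ofReal_mul (by positivity), orbitWeight]
    refine ENNReal.ofReal_le_ofReal ?_
    simp only [c₀, ← Real.exp_add]
    refine Real.exp_le_exp.2 ?_
    have e1 := le_birkhoffSum_glue hB (W p) (v p) (fun i => wordSup X φ (W p i) - V)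
      (fun i y hy => wordSup_sub_le hφ (hV _ (hW p i)) hy) (hx p)
    have e0 : ∑ i : Fin (3 + 1), (wordSup X φ (W p i) - V) = wordSup X φ w - V +
        (wordSup X φ p.1.1 - V) + (wordSup X φ u - V) + (wordSup X φ p.2.1 - V) :=
      Fin.sum_univ_four _
    simp only [e0, Fin.sum_univ_three, (hv p _).2, hglue] at e1
    have e2 := birkhoffSum_add (shiftMap X) φ (w.length + a + u.length + b + 3 * t) t (x p)
    have e3 : w.length + a + u.length + b + 3 * t + t = n := by omega
    have e4 := (abs_le.1 (abs_birkhoffSum_le hB t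
      ((shiftMap X)^[w.length + a + u.length + b + 3 * t] (x p)))).1
    have e5 : (n : ℝ) = w.length + a + u.length + b + 4 * t := by
      rw [← e3]; push_cast; ring
    rw [e3] at e2
    rw [e2, p.1.2.2, p.2.2.2, e5]
    linarith
  calc _ = ENNReal.ofReal (c₀ * Real.exp (n * P)) * (weight X φ w * weight X φ u) *
        (ENNReal.ofReal (1 / 2) * ENNReal.ofReal (1 / 2)) := by
        rw [← ENNReal.ofReal_mul (by norm_num), mul_right_comm (ENNReal.ofReal (c₀ * _)),
          ← ENNReal.ofReal_mul (by positivity)]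
        congr 2; ring
    _ ≤ ENNReal.ofReal (c₀ * Real.exp (n * P)) * (weight X φ w * weight X φ u) *
        (totalWeight X φ (level D a) * totalWeight X φ (level D b)) := by
        gcongr <;> exact hD _
    _ = ∑' p : level D a × level D b, ENNReal.ofReal (c₀ * Real.exp (n * P)) *
        (weight X φ w * weight X φ u) * (weight X φ p.1.1 * weight X φ p.2.1) := by
        rw [ENNReal.tsum_mul_left, totalWeight_eq_tsum_subtype, totalWeight_eq_tsum_subtype,
          ENNReal.tsum_prod', ← ENNReal.tsum_mul_right]
        congr 2
        funext y
        exact ENNReal.tsum_mul_left.symm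
    _ ≤ ∑' p, orbitWeight X φ n (x p) := ENNReal.tsum_le_tsum hwt
    _ ≤ _ := tsum_orbitWeight_le n x hinj hper' fun p => 
      Set.mem_inter (hpos p).1 (hpos p).2.2.1

namespace IsAdaptedDecomposition

variable {G Cs : Set (List (Fin d))} (h : IsAdaptedDecomposition X φ {[]} G Cs)

include h

theorem exists_le_periodicWeight_fattened [Nonempty X.carrier] (hφ : Continuous φ) (M : ℕ) :
    ∃ c : ℝ, 0 < c ∧ ∃ t : ℕ, ∀ w ∈ fattened X {[]} G Cs M, ∀ u ∈ fattened X {[]} G Cs M,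
      ∀ l n, w.length + 2 * t ≤ l → l + u.length + 2 * t ≤ n →
      ENNReal.ofReal (c * Real.exp (n * pressure X φ)) * (weight X φ w * weight X φ u) ≤
        periodicWeight X φ n (cyl X w ∩ (shiftMap X)^[l] ⁻¹' cyl X u) := by
  obtain ⟨M₀, hM₀⟩ := h.exists_half_le_totalWeight_fattened hφ
  -- The fillers must come from a collection heavy at every level, which holds from M₀ on; G(M) is
  -- contained in the larger collection.
  obtain ⟨t, ht⟩ := h.specification (max M M₀)
  obtain ⟨V, -, hV⟩ := h.exists_bowen_fattened hφ (max M M₀)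
  obtain ⟨c, hc, H⟩ := exists_le_periodicWeight hφ (fun w hw => hw.1) ht hV
    (hM₀ _ (le_max_right _ _))
  have hsub := h.fattened_mono (le_max_left M M₀)
  exact ⟨c, hc, t, fun w hw u hu => H w (hsub hw) u (hsub hu)⟩

theorem nil_mem_fattened [Nonempty X.carrier] (M : ℕ) : [] ∈ fattened X {[]} G Cs M :=
  h.core_subset_fattened M h.nil_mem.1

theorem exists_le_periodicWeight_univ [Nonempty X.carrier] (hφ : Continuous φ) :
    ∃ c : ℝ, 0 < c ∧ ∃ n₀ : ℕ, ∀ n ≥ n₀,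
      ENNReal.ofReal (c * Real.exp (n * pressure X φ)) ≤ periodicWeight X φ n Set.univ := by
  obtain ⟨c, hc, t, H⟩ := h.exists_le_periodicWeight_fattened hφ 0
  refine ⟨c, hc, 4 * t, fun n hn => ?_⟩
  have := H [] (h.nil_mem_fattened 0) [] (h.nil_mem_fattened 0) (2 * t) n (by simp)
    (by simp; omega)
  simpa [weight_nil, cyl_nil] using this

theorem exists_periodicWeight_univ_le [Nonempty X.carrier] (hφ : Continuous φ) :
    ∃ C : ℝ, 0 < C ∧ ∀ n > 0, periodicWeight X φ n Set.univ ≤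
      ENNReal.ofReal (C * Real.exp (n * pressure X φ)) := by
  obtain ⟨C, hC, H⟩ := h.exists_totalWeight_language_le hφ
  refine ⟨C, hC, fun n hn => ?_⟩
  have := periodicWeight_cyl_le (X := X) hφ hn (w := []) (by simp)
  rw [cyl_nil, weight_nil, mul_one] at this
  refine this.trans ?_
  rw [mul_comm C, ENNReal.ofReal_mul (Real.exp_pos _).le]
  gcongr
  exact H _

theorem eventually_isProbabilityMeasure [Nonempty X.carrier] (hφ : Continuous φ) :
    ∀ᶠ n in atTop, IsProbabilityMeasure (periodicOrbitMeasure X φ n) := by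
  obtain ⟨c, hc, n₀, H⟩ := h.exists_le_periodicWeight_univ hφ
  obtain ⟨C, hC, H'⟩ := h.exists_periodicWeight_univ_le hφ
  filter_upwards [eventually_ge_atTop n₀, eventually_gt_atTop 0] with n hn hn0
  refine ⟨?_⟩
  rw [periodicOrbitMeasure_apply n MeasurableSet.univ]
  refine ENNReal.inv_mul_cancel ?_ (ne_top_of_le_ne_top ENNReal.ofReal_ne_top (H' n hn0))
  exact ((ENNReal.ofReal_pos.2 (by positivity)).trans_le (H n hn)).ne'

theorem exists_periodicOrbitMeasure_cyl_le [Nonempty X.carrier] (hφ : Continuous φ) :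
    ∃ K : ℝ, 0 < K ∧ ∀ w, ∀ᶠ n in atTop,
      periodicOrbitMeasure X φ n (cyl X w) ≤ ENNReal.ofReal K * weight X φ w := by
  obtain ⟨c, hc, n₀, H⟩ := h.exists_le_periodicWeight_univ hφ
  obtain ⟨C, hC, H'⟩ := h.exists_totalWeight_language_le hφ
  refine ⟨C / c, by positivity, fun w => ?_⟩
  filter_upwards [eventually_ge_atTop n₀, eventually_gt_atTop 0, eventually_ge_atTop w.length]
    with n hn hn0 hnw
  rw [periodicOrbitMeasure_apply n (measurableSet_cyl w)]
  calc _ ≤ (ENNReal.ofReal (c * Real.exp (n * pressure X φ)))⁻¹ *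
        (ENNReal.ofReal (Real.exp (n * pressure X φ)) * weight X φ w * ENNReal.ofReal C) := by
        gcongr
        · exact H n hn
        · refine (periodicWeight_cyl_le hφ hn0 hnw).trans ?_
          gcongr
          exact H' _
    _ = _ := by
        rw [← ENNReal.ofReal_inv_of_pos (by positivity), mul_right_comm (ENNReal.ofReal _),
          ← mul_assoc, ← ENNReal.ofReal_mul (by positivity), ← ENNReal.ofReal_mul (by positivity)]
        congr 2
        field_simp

theorem exists_le_periodicOrbitMeasure [Nonempty X.carrier] (hφ : Continuous φ) (M : ℕ) :
    ∃ c : ℝ, 0 < c ∧ ∃ t : ℕ, ∀ w ∈ fattened X {[]} G Cs M, ∀ u ∈ fattened X {[]} G Cs M,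
      ∀ l, w.length + 2 * t ≤ l → ∀ᶠ n in atTop,
        ENNReal.ofReal c * (weight X φ w * weight X φ u) ≤
          periodicOrbitMeasure X φ n (cyl X w ∩ (shiftMap X)^[l] ⁻¹' cyl X u) := by
  obtain ⟨c, hc, t, H⟩ := h.exists_le_periodicWeight_fattened hφ M
  obtain ⟨C, hC, H'⟩ := h.exists_periodicWeight_univ_le hφ
  refine ⟨c / C, by positivity, t, fun w hw u hu l hl => ?_⟩
  filter_upwards [eventually_ge_atTop (l + u.length + 2 * t), eventually_gt_atTop 0] with n hn hn0
  rw [periodicOrbitMeasure_apply n ((measurableSet_cyl w).inter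
    ((measurable_shiftMap.iterate l) (measurableSet_cyl u)))]
  calc _ = (ENNReal.ofReal (C * Real.exp (n * pressure X φ)))⁻¹ *
        (ENNReal.ofReal (c * Real.exp (n * pressure X φ)) * (weight X φ w * weight X φ u)) := by
        rw [← ENNReal.ofReal_inv_of_pos (by positivity), ← mul_assoc (ENNReal.ofReal (_⁻¹)),
          ← ENNReal.ofReal_mul (by positivity)]
        congr 2
        field_simp
    _ ≤ _ := by
        gcongr
        · exact H' n hn0
        · exact H w hw u hu l n hl hn

end IsAdaptedDecomposition

/-- The shift permutes the points of period n, and S_n φ is constant along their orbits. -/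
theorem map_periodicOrbitMeasure (n : ℕ) (hn : 0 < n) :
    (periodicOrbitMeasure X φ n).map (shiftMap X) = periodicOrbitMeasure X φ n := by
  ext E hE
  rw [Measure.map_apply measurable_shiftMap hE, periodicOrbitMeasure_apply n hE,
    periodicOrbitMeasure_apply n (measurable_shiftMap hE)]
  congr 1
  rw [periodicWeight_eq, periodicWeight_eq]
  let e := (Function.bijOn_ptsOfPeriod (shiftMap X) hn).equiv
  rw [← e.tsum_eq fun x => E.indicator (orbitWeight X φ n) x.1]
  refine tsum_congr fun x => ?_
  have he : (e x : X.carrier) = shiftMap X x := rfl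
  have hw : orbitWeight X φ n (shiftMap X x) = orbitWeight X φ n x := by
    unfold orbitWeight
    congr 2
    have := birkhoffSum_apply_sub_birkhoffSum (shiftMap X) φ n x.1
    have hx : (shiftMap X)^[n] x.1 = x.1 := x.2
    rw [hx, sub_self] at this
    linarith
  rw [he]
  by_cases hxE : shiftMap X x ∈ E
  · rw [Set.indicator_of_mem hxE, Set.indicator_of_mem (show x.1 ∈ shiftMap X ⁻¹' E from hxE), hw]
  · rw [Set.indicator_of_notMem hxE, Set.indicator_of_notMem
      (show x.1 ∉ shiftMap X ⁻¹' E from hxE)]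

end Thermo

end

noncomputable section

namespace Thermo

variable {d : ℕ} {X : Subshift (Fin d) ℕ} {φ : X.carrier → ℝ}

/-! ### Limits of periodic orbit measures -/

theorem isInvariantProb_periodicOrbitMeasure {n : ℕ} (hn : 0 < n)
    (h : IsProbabilityMeasure (periodicOrbitMeasure X φ n)) :
    IsInvariantProb X (periodicOrbitMeasure X φ n) :=
  ⟨h, measurable_shiftMap, map_periodicOrbitMeasure n hn⟩

/-- Weak* compactness of the space of probability measures; invariance is closed because the shift
is continuous. Ultrafilters replace subsequences, so that convergence can later be tested on all of
them. -/
theorem exists_tendsto_integral {m : ℕ → Measure X.carrier} {U : Ultrafilter ℕ}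
    (hm : ∀ᶠ n in U, IsInvariantProb X (m n)) :
    ∃ μ : Measure X.carrier, IsInvariantProb X μ ∧ ∀ g : C(X.carrier, ℝ),
      Tendsto (fun n => ∫ x, g x ∂(m n)) U (𝓝 (∫ x, g x ∂μ)) := by
  classical
  obtain ⟨n₀, hn₀⟩ := hm.exists
  -- The default value m n₀ is taken only outside a set of U and does not affect the limit.
  let pm : ℕ → ProbabilityMeasure X.carrier := fun n =>
    if h : IsInvariantProb X (m n) then ⟨m n, h.1⟩ else ⟨m n₀, hn₀.1⟩
  obtain ⟨μ, -, hμ⟩ := isCompact_univ.ultrafilter_le_nhds (U.map pm) (by simp)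
  have hlim : ∀ g : C(X.carrier, ℝ), Tendsto (fun n => ∫ x, g x ∂(m n)) U
      (𝓝 (∫ x, g x ∂(μ : Measure X.carrier))) := by
    intro g
    have ht : Tendsto pm U (𝓝 μ) := hμ
    have := ProbabilityMeasure.tendsto_iff_forall_integral_tendsto.1 ht
      (BoundedContinuousFunction.mkOfCompact g)
    refine this.congr' ?_
    filter_upwards [hm] with n hn
    have hpm : pm n = ⟨m n, hn.1⟩ := dif_pos hn
    rw [hpm]
    rfl
  refine ⟨μ, ⟨inferInstance, measurable_shiftMap, ?_⟩, hlim⟩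
  have hp : IsProbabilityMeasure ((μ : Measure X.carrier).map (shiftMap X)) :=
    Measure.isProbabilityMeasure_map measurable_shiftMap.aemeasurable
  refine ext_of_forall_integral_eq_of_IsFiniteMeasure fun f => ?_
  rw [integral_map measurable_shiftMap.aemeasurable
    f.continuous.measurable.aestronglyMeasurable]
  have h1 := hlim (f.toContinuousMap.comp ⟨shiftMap X, continuous_shiftMap⟩)
  have h2 := hlim f.toContinuousMap
  refine tendsto_nhds_unique h1 (h2.congr' ?_)
  filter_upwards [hm] with n hn
  have := integral_map (μ := m n) measurable_shiftMap.aemeasurable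
    (f := fun x => f x) f.continuous.measurable.aestronglyMeasurable
  rw [hn.2.map_eq] at this
  exact this

theorem tendsto_measureReal_of_isClopen {m : ℕ → Measure X.carrier} {μ : Measure X.carrier}
    {l : Filter ℕ} (h : ∀ g : C(X.carrier, ℝ),
      Tendsto (fun n => ∫ x, g x ∂(m n)) l (𝓝 (∫ x, g x ∂μ)))
    {E : Set X.carrier} (hE : IsClopen E) :
    Tendsto (fun n => (m n).real E) l (𝓝 (μ.real E)) := by
  have := h ⟨E.indicator 1, hE.continuous_indicator continuous_const⟩
  simpa only [ContinuousMap.coe_mk, integral_indicator_one hE.isOpen.measurableSet] using this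

/-- The real-valued normalised weight of a word. -/
def realWeight (X : Subshift (Fin d) ℕ) (φ : X.carrier → ℝ) (w : List (Fin d)) : ℝ :=
  Real.exp (wordSup X φ w - w.length * pressure X φ)

theorem realWeight_pos (w : List (Fin d)) : 0 < realWeight X φ w := Real.exp_pos _

theorem weight_eq_ofReal {w : List (Fin d)} (hw : w ∈ language X) :
    weight X φ w = ENNReal.ofReal (realWeight X φ w) := weight_of_mem hw

/-- The upper Gibbs bound, with constant `K`, for all words of the language. -/
def HasUpperGibbs (X : Subshift (Fin d) ℕ) (φ : X.carrier → ℝ) (μ : Measure X.carrier) (K : ℝ) :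
    Prop := ∀ w ∈ language X, μ.real (cyl X w) ≤ K * realWeight X φ w

/-- A lower bound of Gibbs type for the joint occurrence of two words of `D`. -/
def HasJointLowerGibbs (X : Subshift (Fin d) ℕ) (φ : X.carrier → ℝ) (μ : Measure X.carrier)
    (D : Set (List (Fin d))) : Prop :=
  ∃ c : ℝ, 0 < c ∧ ∃ t : ℕ, ∀ w ∈ D, ∀ u ∈ D, ∀ l, w.length + 2 * t ≤ l →
    c * (realWeight X φ w * realWeight X φ u) ≤
      μ.real (cyl X w ∩ (shiftMap X)^[l] ⁻¹' cyl X u)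

variable {G Cs : Set (List (Fin d))}

/-- Cylinders are clopen, so bounds that eventually hold for the periodic orbit measures pass to
every ultrafilter limit with the same constants. -/
theorem IsAdaptedDecomposition.exists_limit [Nonempty X.carrier]
    (h : IsAdaptedDecomposition X φ {[]} G Cs) (hφ : Continuous φ) {U : Ultrafilter ℕ}
    (hU : (U : Filter ℕ) ≤ atTop) :
    ∃ μ : Measure X.carrier, IsInvariantProb X μ ∧
      (∀ g : C(X.carrier, ℝ), Tendsto (fun n => ∫ x, g x ∂(periodicOrbitMeasure X φ n)) U
        (𝓝 (∫ x, g x ∂μ))) ∧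
      (∃ K, 0 < K ∧ HasUpperGibbs X φ μ K) ∧
      ∀ M, HasJointLowerGibbs X φ μ (fattened X {[]} G Cs M) := by
  have hprob := h.eventually_isProbabilityMeasure hφ
  have hinv : ∀ᶠ n in U, IsInvariantProb X (periodicOrbitMeasure X φ n) := by
    refine hU ?_
    filter_upwards [hprob, eventually_gt_atTop 0] with n h1 h2
    exact isInvariantProb_periodicOrbitMeasure h2 h1
  obtain ⟨μ, hμ, hlim⟩ := exists_tendsto_integral hinv
  refine ⟨μ, hμ, hlim, ?_, fun M => ?_⟩
  · obtain ⟨K, hK, H⟩ := h.exists_periodicOrbitMeasure_cyl_le hφ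
    refine ⟨K, hK, fun w hw => ?_⟩
    refine le_of_tendsto (tendsto_measureReal_of_isClopen hlim (isClopen_cyl w)) ?_
    refine hU ?_
    filter_upwards [H w] with n hn
    rw [weight_eq_ofReal hw, ← ENNReal.ofReal_mul hK.le] at hn
    exact ENNReal.toReal_le_of_le_ofReal (mul_nonneg hK.le (realWeight_pos w).le) hn
  · obtain ⟨c, hc, t, H⟩ := h.exists_le_periodicOrbitMeasure hφ M
    refine ⟨c, hc, t, fun w hw u hu l hl => ?_⟩
    refine ge_of_tendsto (tendsto_measureReal_of_isClopen hlim ((isClopen_cyl w).inter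
      ((isClopen_cyl u).preimage (continuous_shiftMap.iterate l)))) ?_
    refine hU ?_
    filter_upwards [H w hw u hu l hl, hprob] with n hn hp
    rw [weight_eq_ofReal hw.1, weight_eq_ofReal hu.1, ← ENNReal.ofReal_mul (realWeight_pos w).le,
      ← ENNReal.ofReal_mul hc.le] at hn
    exact (ENNReal.ofReal_le_iff_le_toReal (measure_ne_top _ _)).1 hn

/-! ### Entropy and integrals -/

theorem integral_comp_letters (ν : Measure X.carrier) [IsProbabilityMeasure ν] {n : ℕ}
    (g : (Fin n → Fin d) → ℝ) :
    ∫ x, g (letters X n x) ∂ν = ∑ c, ν.real (letters X n ⁻¹' {c}) * g c := by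
  rw [← integral_map (μ := ν) (φ := letters X n) (f := g) (measurable_letters n).aemeasurable
    (measurable_of_finite g).aestronglyMeasurable]
  have : IsProbabilityMeasure (ν.map (letters X n)) :=
    Measure.isProbabilityMeasure_map (measurable_letters n).aemeasurable
  rw [integral_fintype Integrable.of_finite]
  refine Finset.sum_congr rfl fun c _ => ?_
  rw [map_measureReal_apply (measurable_letters n) (measurableSet_singleton c), smul_eq_mul]

theorem integrable_of_continuous (ν : Measure X.carrier) [IsProbabilityMeasure ν]
    {g : X.carrier → ℝ} (hg : Continuous g) : Integrable g ν :=
  hg.integrable_of_hasCompactSupport (HasCompactSupport.of_compactSpace g)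

theorem integral_birkhoffSum {ν : Measure X.carrier} (hν : IsInvariantProb X ν)
    (hφ : Continuous φ) (n : ℕ) :
    ∫ x, birkhoffSum (shiftMap X) φ n x ∂ν = n * ∫ x, φ x ∂ν := by
  have := hν.1
  unfold birkhoffSum
  have h0 : ∀ i ∈ Finset.range n, Integrable (fun x => φ ((shiftMap X)^[i] x)) ν := fun i _ =>
    integrable_of_continuous ν (hφ.comp (continuous_shiftMap.iterate i))
  rw [integral_finsetSum _ h0]
  have h1 : ∀ i ∈ Finset.range n, ∫ x, φ ((shiftMap X)^[i] x) ∂ν = ∫ x, φ x ∂ν := by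
    intro i _
    have hi := hν.2.iterate i
    have h2 := integral_map (μ := ν) hi.measurable.aemeasurable (f := φ)
      hφ.measurable.aestronglyMeasurable
    rw [hi.map_eq] at h2
    exact h2.symm
  rw [Finset.sum_congr rfl h1]
  simp

theorem sum_letters_preimage (ν : Measure X.carrier) [IsProbabilityMeasure ν] {n : ℕ}
    (S : Finset (Fin n → Fin d)) :
    ∑ c ∈ S, ν.real (letters X n ⁻¹' {c}) = ν.real (letters X n ⁻¹' S) :=
  sum_measureReal_preimage_singleton S fun c _ => measurable_letters n (measurableSet_singleton c)

theorem integrable_comp_letters (ν : Measure X.carrier) [IsProbabilityMeasure ν] {n : ℕ}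
    (g : (Fin n → Fin d) → ℝ) : Integrable (fun x => g (letters X n x)) ν := by
  have hc : Continuous fun x => g (letters X n x) := by
    have hl : Continuous (letters X n) :=
      continuous_pi fun i => (continuous_apply (i : ℕ)).comp continuous_subtype_val
    exact (continuous_of_discreteTopology (f := g)).comp hl
  exact integrable_of_continuous ν hc

/-- An invariant measure with the upper Gibbs bound has free energy at least the pressure. -/
theorem pressure_sub_le_measureEntropy {ν : Measure X.carrier} (hν : IsInvariantProb X ν)
    (hφ : Continuous φ) {K : ℝ} (hK : 0 < K) (hG : HasUpperGibbs X φ ν K) :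
    ((pressure X φ - ∫ x, φ x ∂ν : ℝ) : EReal) ≤ measureEntropy (shiftMap X) ν := by
  have := hν.1
  obtain ⟨x₀⟩ : Nonempty X.carrier := nonempty_of_isProbabilityMeasure ν
  set P := pressure X φ
  set I := ∫ x, φ x ∂ν
  -- The upper Gibbs bound reads -log ν[c] ≥ nP - log K - φ_n(c); average it over the words c.
  have hbound : ∀ n, n * P - Real.log K -
      ∑ c : Fin n → Fin d, ν.real (letters X n ⁻¹' {c}) * wordSup X φ (List.ofFn c) ≤
        obsEntropy ν (letters X n) := by
    intro n
    have h1 : ∑ c : Fin n → Fin d, ν.real (letters X n ⁻¹' {c}) = 1 := by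
      rw [sum_letters_preimage]; simp
    have h2 : n * P - Real.log K = ∑ c : Fin n → Fin d, ν.real (letters X n ⁻¹' {c}) *
        (n * P - Real.log K) := by rw [← Finset.sum_mul, h1, one_mul]
    rw [h2, ← Finset.sum_sub_distrib]
    refine Finset.sum_le_sum fun c _ => ?_
    rcases (measureReal_nonneg (μ := ν) (s := letters X n ⁻¹' {c})).eq_or_lt with h0 | h0
    · rw [← h0]; simp
    · have hL : List.ofFn c ∈ language X := by
        rw [mem_language, cyl_ofFn]
        exact nonempty_of_measureReal_ne_zero h0.ne'
      have h3 := hG _ hL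
      rw [cyl_ofFn] at h3
      have h4 := Real.log_le_log h0 h3
      rw [Real.log_mul hK.ne' (realWeight_pos _).ne', realWeight, Real.log_exp,
        List.length_ofFn] at h4
      have h5 := mul_le_mul_of_nonneg_left h4 h0.le
      simp only [Real.negMulLog]
      nlinarith
  have hle : limsup (fun n : ℕ => ((obsEntropy ν (letters X n) / n : ℝ) : EReal)) atTop ≤
      measureEntropy (shiftMap X) ν := by
    have hm : Measurable fun x : X.carrier => x.1 0 :=
      (measurable_pi_apply 0).comp measurable_subtype_coe
    refine le_trans (le_of_eq ?_) (le_iSup_of_le d (le_iSup_of_le (fun x : X.carrier => x.1 0)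
      (le_iSup_of_le hm le_rfl)))
    congr 1
    funext n
    congr 2
    unfold refinedEntropy obsEntropy
    refine Finset.sum_congr rfl fun c _ => ?_
    congr 2
    ext x
    simp [letters, funext_iff, iterate_shiftMap_apply]
  refine le_trans ?_ hle
  refine EReal.ge_of_forall_gt_iff_ge.1 fun z hz => ?_
  have hz' : z < P - I := by exact_mod_cast hz
  set ε := (P - I - z) / 2 with hε
  have hε0 : 0 < ε := by rw [hε]; linarith
  obtain ⟨C, hC⟩ := exists_abs_birkhoffSum_sub_le hφ hε0
  -- Without the Bowen property on the whole language, φ_n(c) can be replaced by S_n φ only up to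
  -- the sublinear error C + εn, which suffices for growth rates.
  have hsum : ∀ n : ℕ, ∑ c : Fin n → Fin d, ν.real (letters X n ⁻¹' {c}) *
      wordSup X φ (List.ofFn c) ≤ n * I + C + ε * n := by
    intro n
    rw [← integral_comp_letters ν (fun c => wordSup X φ (List.ofFn c))]
    have h1 : ∫ x, (birkhoffSum (shiftMap X) φ n x + (C + ε * n)) ∂ν = n * I + C + ε * n := by
      rw [integral_add (integrable_of_continuous ν (continuous_birkhoffSum hφ n))
        (integrable_const _), integral_birkhoffSum hν hφ]
      simp; ring
    rw [← h1]
    refine integral_mono (integrable_comp_letters ν fun c => wordSup X φ (List.ofFn c))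
      ((integrable_of_continuous ν (continuous_birkhoffSum hφ n)).add (integrable_const _)) ?_
    intro x
    have h2 := wordSup_sub_le hφ (hC (List.ofFn (letters X n x))) (mem_cyl_letters n x)
    rw [List.length_ofFn] at h2
    simp only
    linarith
  have hev : ∀ᶠ n : ℕ in atTop, (Real.log K + C) / n < ε :=
    (tendsto_const_div_atTop_nhds_zero_nat _).eventually_lt_const hε0
  refine le_limsup_of_frequently_le (Eventually.frequently ?_) (by isBoundedDefault)
  filter_upwards [hev, eventually_gt_atTop 0] with n hn hn0
  have hn' : (0 : ℝ) < n := by exact_mod_cast hn0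
  rw [EReal.coe_le_coe_iff, le_div_iff₀ hn']
  rw [div_lt_iff₀ hn'] at hn
  have h1 := hbound n
  have h2 := hsum n
  have h3 : z = P - I - 2 * ε := by rw [hε]; ring
  rw [h3]
  nlinarith

/-- Gibbs' inequality for subprobabilities: with q the sum of p over S, use log t ≤ t - 1 at t = b_i
q / (p_i C). -/
theorem sum_negMulLog_le {ι : Type*} (S : Finset ι) (p b : ι → ℝ) (hp : ∀ i ∈ S, 0 ≤ p i)
    (hb : ∀ i ∈ S, 0 ≤ b i) (hpb : ∀ i ∈ S, 0 < p i → 0 < b i) {C : ℝ} (hC : 0 < C)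
    (hbC : ∑ i ∈ S, b i ≤ C) :
    ∑ i ∈ S, (Real.negMulLog (p i) + p i * Real.log (b i)) ≤
      (∑ i ∈ S, p i) * Real.log C + Real.negMulLog (∑ i ∈ S, p i) := by
  set q := ∑ i ∈ S, p i with hq
  have hq0 : 0 ≤ q := Finset.sum_nonneg hp
  have key : ∀ i ∈ S, Real.negMulLog (p i) + p i * Real.log (b i) ≤
      p i * Real.log C - p i * Real.log q + (b i * q / C - p i) := by
    intro i hi
    rcases (hp i hi).eq_or_lt with h | h
    · rw [← h]
      have := hb i hi
      simp
      positivity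
    · have hbi := hpb i hi h
      have hqi : 0 < q := h.trans_le (Finset.single_le_sum hp hi)
      have h1 := Real.log_le_sub_one_of_pos (x := b i * q / (p i * C)) (by positivity)
      rw [Real.log_div (by positivity) (by positivity), Real.log_mul hbi.ne' hqi.ne',
        Real.log_mul h.ne' hC.ne'] at h1
      have h2 := mul_le_mul_of_nonneg_left h1 h.le
      have h3 : p i * (b i * q / (p i * C) - 1) = b i * q / C - p i := by field_simp
      rw [h3] at h2
      simp only [Real.negMulLog]
      nlinarith
  refine (Finset.sum_le_sum key).trans ?_
  simp only [Finset.sum_add_distrib, Finset.sum_sub_distrib, ← Finset.sum_mul, ← Finset.sum_div,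
    ← hq]
  have h4 : (∑ i ∈ S, b i) * q / C ≤ q := by
    rw [div_le_iff₀ hC, mul_comm q]
    gcongr
  simp only [Real.negMulLog]
  linarith

/-- Gibbs' inequality separately on S and on its complement. If ν charges a set S of tiny weight C₁,
the term log C₁ pushes the free energy of ν below the pressure. The 2 covers the entropy of the
split, each of its two terms being at most 1. -/
theorem obsEntropy_add_le {ν : Measure X.carrier} (hν : IsInvariantProb X ν) (hφ : Continuous φ)
    {n : ℕ} (S : Finset (Fin n → Fin d)) {C₁ C₂ : ℝ} (hC₁ : 0 < C₁) (hC₂ : 0 < C₂)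
    (h₁ : ∑ c ∈ S, weight X φ (List.ofFn c) ≤ ENNReal.ofReal C₁)
    (h₂ : ∑ c : Fin n → Fin d, weight X φ (List.ofFn c) ≤ ENNReal.ofReal C₂) :
    obsEntropy ν (letters X n) + n * ∫ x, φ x ∂ν - n * pressure X φ ≤
      ν.real (letters X n ⁻¹' S) * Real.log C₁ +
        (1 - ν.real (letters X n ⁻¹' S)) * Real.log C₂ + 2 := by
  classical
  have := hν.1
  set p : (Fin n → Fin d) → ℝ := fun c => ν.real (letters X n ⁻¹' {c})
  set b : (Fin n → Fin d) → ℝ := fun c => (weight X φ (List.ofFn c)).toReal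
  have hp : ∀ c, 0 ≤ p c := fun c => measureReal_nonneg
  have hb : ∀ c, 0 ≤ b c := fun c => ENNReal.toReal_nonneg
  have hL : ∀ c, 0 < p c → b c = realWeight X φ (List.ofFn c) := by
    intro c hc
    have : List.ofFn c ∈ language X := by
      rw [mem_language, cyl_ofFn]
      exact nonempty_of_measureReal_ne_zero hc.ne'
    simp only [b]
    rw [weight_eq_ofReal this, ENNReal.toReal_ofReal (realWeight_pos _).le]
  have hpb : ∀ c, 0 < p c → 0 < b c := fun c hc => by rw [hL c hc]; exact realWeight_pos _
  have hbsum : ∀ (S : Finset (Fin n → Fin d)) {C : ℝ}, 0 < C →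
      ∑ c ∈ S, weight X φ (List.ofFn c) ≤ ENNReal.ofReal C → ∑ c ∈ S, b c ≤ C := by
    intro S C hC h
    simp only [b]
    rw [← ENNReal.toReal_sum fun c _ => weight_ne_top _]
    exact ENNReal.toReal_le_of_le_ofReal hC.le h
  have hsum1 : ∑ c, p c = 1 := by
    simp only [p]
    rw [sum_letters_preimage]; simp
  have hint : n * ∫ x, φ x ∂ν ≤ ∑ c, p c * wordSup X φ (List.ofFn c) := by
    rw [← integral_birkhoffSum hν hφ, ← integral_comp_letters ν fun c => wordSup X φ (List.ofFn c)]
    refine integral_mono (integrable_of_continuous ν (continuous_birkhoffSum hφ n))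
      (integrable_comp_letters ν fun c => wordSup X φ (List.ofFn c)) fun x => ?_
    have := birkhoffSum_le_wordSup hφ (mem_cyl_letters n x)
    rwa [List.length_ofFn] at this
  have hlog : ∑ c, p c * Real.log (b c) = ∑ c, p c * wordSup X φ (List.ofFn c) -
      n * pressure X φ := by
    have : n * pressure X φ = ∑ c, p c * (n * pressure X φ) := by
      rw [← Finset.sum_mul, hsum1, one_mul]
    rw [this, ← Finset.sum_sub_distrib]
    refine Finset.sum_congr rfl fun c _ => ?_
    rcases (hp c).eq_or_lt with h | h
    · rw [← h]; simp
    · rw [hL c h, realWeight, Real.log_exp, List.length_ofFn]; ring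
  have hj1 := sum_negMulLog_le S p b (fun c _ => hp c) (fun c _ => hb c) (fun c _ => hpb c) hC₁
    (hbsum S hC₁ h₁)
  have hj2 := sum_negMulLog_le Sᶜ p b (fun c _ => hp c) (fun c _ => hb c) (fun c _ => hpb c) hC₂
    (hbsum Sᶜ hC₂ ((Finset.sum_le_sum_of_subset (Finset.subset_univ _)).trans h₂))
  have hsplit := Finset.sum_add_sum_compl S fun c =>
    Real.negMulLog (p c) + p c * Real.log (b c)
  have hsplitp := Finset.sum_add_sum_compl S p
  rw [hsum1] at hsplitp
  have hqS : ∑ c ∈ S, p c = ν.real (letters X n ⁻¹' S) := sum_letters_preimage ν S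
  have hq' : ∑ c ∈ Sᶜ, p c = 1 - ν.real (letters X n ⁻¹' S) := by linarith
  rw [hqS] at hj1
  rw [hq'] at hj2
  have hn1 := Real.negMulLog_le_one_sub_self (measureReal_nonneg (μ := ν) (s := letters X n ⁻¹' S))
  have hn2 := Real.negMulLog_le_one_sub_self
    (sub_nonneg.2 (measureReal_le_one (μ := ν) (s := letters X n ⁻¹' S)))
  have hn3 := measureReal_nonneg (μ := ν) (s := letters X n ⁻¹' S)
  have hn4 := measureReal_le_one (μ := ν) (s := letters X n ⁻¹' S)
  have hall : ∑ c, (Real.negMulLog (p c) + p c * Real.log (b c)) = obsEntropy ν (letters X n) +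
      (∑ c, p c * wordSup X φ (List.ofFn c) - n * pressure X φ) := by
    rw [Finset.sum_add_distrib, hlog]; rfl
  rw [hall] at hsplit
  linarith

end Thermo

end

/-! ### Variational principle, absolute continuity, ergodicity and uniqueness. -/

noncomputable section

namespace Thermo

variable {d : ℕ} {X : Subshift (Fin d) ℕ} {φ : X.carrier → ℝ} {G Cs : Set (List (Fin d))}

theorem realWeight_nil [Nonempty X.carrier] : realWeight X φ [] = 1 := by
  simp [realWeight, wordSup_nil]

/-- Words of D are compared with μ by the lower Gibbs bound; the remaining words of the language
weigh at most ε in total. -/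
theorem sum_weight_le_of_lower {D : Set (List (Fin d))}
    {μ : Measure X.carrier} [IsProbabilityMeasure μ] {c : ℝ} (hc : 0 < c)
    (hlow : ∀ w ∈ D, c * realWeight X φ w ≤ μ.real (cyl X w)) {n : ℕ} {ε : ℝ} (hε : 0 ≤ ε)
    (hrest : totalWeight X φ (level (language X \ D) n) ≤ ENNReal.ofReal ε)
    (S : Finset (Fin n → Fin d)) :
    ∑ a ∈ S, weight X φ (List.ofFn a) ≤ ENNReal.ofReal (μ.real (letters X n ⁻¹' S) / c + ε) := by
  classical
  rw [ENNReal.ofReal_add (by positivity) hε]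
  have hsplit : ∀ a ∈ S, weight X φ (List.ofFn a) ≤
      ENNReal.ofReal (μ.real (letters X n ⁻¹' {a}) / c) +
        (language X \ D).indicator (weight X φ) (List.ofFn a) := by
    intro a _
    by_cases hL : List.ofFn a ∈ language X
    · by_cases haD : List.ofFn a ∈ D
      · refine le_add_right ?_
        rw [weight_eq_ofReal hL]
        refine ENNReal.ofReal_le_ofReal ?_
        rw [le_div_iff₀ hc, mul_comm, ← cyl_ofFn]
        exact hlow _ haD
      · rw [Set.indicator_of_mem (show _ ∈ language X \ D from ⟨hL, haD⟩)]
        exact le_add_left le_rfl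
    · rw [weight, if_neg hL]; exact zero_le
  refine (Finset.sum_le_sum hsplit).trans ?_
  rw [Finset.sum_add_distrib]
  refine add_le_add (le_of_eq ?_) ?_
  · rw [← ENNReal.ofReal_sum_of_nonneg fun _ _ => by positivity, ← Finset.sum_div,
      sum_letters_preimage]
  · refine le_trans (Finset.sum_le_sum_of_subset (Finset.subset_univ _)) ?_
    rw [← totalWeight_level]
    exact hrest

theorem HasJointLowerGibbs.exists_lower [Nonempty X.carrier] {μ : Measure X.carrier}
    [IsProbabilityMeasure μ] {D : Set (List (Fin d))} (h : HasJointLowerGibbs X φ μ D)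
    (hnil : [] ∈ D) : ∃ c : ℝ, 0 < c ∧ ∀ w ∈ D, c * realWeight X φ w ≤ μ.real (cyl X w) := by
  obtain ⟨c, hc, t, H⟩ := h
  refine ⟨c, hc, fun w hw => ?_⟩
  have := H w hw [] hnil _ le_rfl
  rw [realWeight_nil, mul_one] at this
  exact this.trans (measureReal_mono Set.inter_subset_left)

namespace IsAdaptedDecomposition

variable (h : IsAdaptedDecomposition X φ {[]} G Cs)

include h

/-- The case S = ∅ of `obsEntropy_add_le`: the level weights are bounded by C, and (log C + 2)/n
tends to 0. -/
theorem measureEntropy_le_pressure_sub [Nonempty X.carrier] (hφ : Continuous φ)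
    {ν : Measure X.carrier} (hν : IsInvariantProb X ν) :
    measureEntropy (shiftMap X) ν ≤ ((pressure X φ - ∫ x, φ x ∂ν : ℝ) : EReal) := by
  obtain ⟨C, hC, H⟩ := h.exists_totalWeight_language_le hφ
  have hw : ∀ n, ∑ c : Fin n → Fin d, weight X φ (List.ofFn c) ≤ ENNReal.ofReal C := by
    intro n
    refine le_trans (le_of_eq ?_) (H n)
    rw [totalWeight_level]
    refine Finset.sum_congr rfl fun c _ => ?_
    by_cases hc : List.ofFn c ∈ language X
    · rw [Set.indicator_of_mem hc]
    · rw [Set.indicator_of_notMem hc, weight, if_neg hc]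
  refine EReal.le_of_forall_lt_iff_le.1 fun z hz => ?_
  have hz' : pressure X φ - ∫ x, φ x ∂ν < z := by exact_mod_cast hz
  have hev : ∀ᶠ n : ℕ in atTop, (Real.log C + 2) / n < z - (pressure X φ - ∫ x, φ x ∂ν) :=
    (tendsto_const_div_atTop_nhds_zero_nat _).eventually_lt_const (by linarith)
  obtain ⟨n, hn, hn0⟩ := (hev.and (eventually_gt_atTop 0)).exists
  refine (measureEntropy_le_letters hν hn0.ne').trans ?_
  have hn' : (0 : ℝ) < n := by exact_mod_cast hn0
  rw [EReal.coe_le_coe_iff, div_le_iff₀ hn']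
  rw [div_lt_iff₀ hn'] at hn
  have := obsEntropy_add_le hν hφ (n := n) ∅ one_pos hC (by simp) (hw n)
  simp at this
  nlinarith

/-- A measure of maximal free energy is absolutely continuous with respect to every measure that
satisfies the lower Gibbs bounds. -/
theorem absolutelyContinuous [Nonempty X.carrier] (hφ : Continuous φ) {μ ν : Measure X.carrier}
    (hμ : IsInvariantProb X μ) (hν : IsInvariantProb X ν)
    (hlow : ∀ M, HasJointLowerGibbs X φ μ (fattened X {[]} G Cs M))
    (hmax : ((pressure X φ - ∫ x, φ x ∂ν : ℝ) : EReal) ≤ measureEntropy (shiftMap X) ν) :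
    ν ≪ μ := by
  classical
  have := hμ.1
  have := hν.1
  refine Measure.AbsolutelyContinuous.mk fun A hA hμA => ?_
  by_contra hνA
  set δ := ν.real A with hδ
  have hδ0 : 0 < δ := ENNReal.toReal_pos hνA (measure_ne_top _ _)
  obtain ⟨C, hC, H⟩ := h.exists_totalWeight_language_le hφ
  set C' := max C 1
  have hC' : 1 ≤ C' := le_max_right _ _
  have hlogC : 0 ≤ Real.log C' := Real.log_nonneg hC'
  -- Then ν-mass δ/2 on words of total weight at most η contributes at most -(log C' + 3), which
  -- beats the remaining log C' + 2.
  set η := Real.exp (-(2 * (Real.log C' + 3) / δ)) with hη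
  have hη0 : 0 < η := Real.exp_pos _
  obtain ⟨M, hM⟩ := h.exists_totalWeight_not_fattened_le hφ (half_pos hη0)
  have hM := hM M le_rfl
  obtain ⟨c, hc, hlo⟩ := (hlow M).exists_lower (h.nil_mem_fattened M)
  set ε := min (δ / 2) (c * (η / 2)) with hε
  have hε0 : 0 < ε := by positivity
  -- Approximating for μ + ν produces a single set of words that is close to A for both measures:
  -- μ-null up to ε, but of ν-mass at least δ/2.
  obtain ⟨N, hN⟩ := exists_letters_symmDiff_lt (μ + ν) hA hε0
  obtain ⟨n, hn1, S, hS⟩ : ∃ n, n ≠ 0 ∧ ∃ S : Set (Fin n → Fin d),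
      (μ + ν).real (symmDiff A (letters X n ⁻¹' S)) < ε :=
    ⟨N + 1, by omega, hN (N + 1) (by omega)⟩
  have hS' : μ.real (symmDiff A (letters X n ⁻¹' S)) + ν.real (symmDiff A (letters X n ⁻¹' S)) <
      ε := by
    rwa [measureReal_add_apply] at hS
  have hμS : μ.real (letters X n ⁻¹' S) ≤ c * (η / 2) := by
    have h1 : μ.real (letters X n ⁻¹' S) ≤
        μ.real A + μ.real (symmDiff A (letters X n ⁻¹' S)) := by
      refine (measureReal_mono ?_).trans (measureReal_union_le _ _)
      intro x hx
      by_cases hxA : x ∈ A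
      · exact Or.inl hxA
      · exact Or.inr (Or.inr ⟨hx, hxA⟩)
    have h2 : μ.real A = 0 := by rw [measureReal_def, hμA]; rfl
    have h3 : ε ≤ c * (η / 2) := min_le_right _ _
    have h4 := measureReal_nonneg (μ := ν) (s := symmDiff A (letters X n ⁻¹' S))
    linarith
  have hνS : δ / 2 ≤ ν.real (letters X n ⁻¹' S) := by
    have h1 : ν.real A ≤
        ν.real (letters X n ⁻¹' S) + ν.real (symmDiff A (letters X n ⁻¹' S)) := by
      refine (measureReal_mono ?_).trans (measureReal_union_le _ _)
      intro x hx
      by_cases hxA : x ∈ letters X n ⁻¹' S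
      · exact Or.inl hxA
      · exact Or.inr (Or.inl ⟨hx, hxA⟩)
    have h3 : ε ≤ δ / 2 := min_le_left _ _
    have h4 := measureReal_nonneg (μ := μ) (s := symmDiff A (letters X n ⁻¹' S))
    linarith
  have hw : ∑ a : Fin n → Fin d, weight X φ (List.ofFn a) ≤ ENNReal.ofReal C' := by
    refine le_trans (le_of_eq ?_) ((H n).trans (ENNReal.ofReal_le_ofReal (le_max_left _ _)))
    rw [totalWeight_level]
    refine Finset.sum_congr rfl fun c _ => ?_
    by_cases hc : List.ofFn c ∈ language X
    · rw [Set.indicator_of_mem hc]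
    · rw [Set.indicator_of_notMem hc, weight, if_neg hc]
  have hwS := sum_weight_le_of_lower (X := X) (φ := φ) hc hlo (by positivity)
    (hM n) S.toFinset
  rw [Set.coe_toFinset] at hwS
  have hwS' : ∑ a ∈ S.toFinset, weight X φ (List.ofFn a) ≤ ENNReal.ofReal η := by
    refine hwS.trans (ENNReal.ofReal_le_ofReal ?_)
    have : μ.real (letters X n ⁻¹' S) / c ≤ η / 2 := by
      rw [div_le_iff₀ hc]; linarith
    linarith
  have key := obsEntropy_add_le hν hφ S.toFinset hη0 (by positivity) hwS' hw
  rw [Set.coe_toFinset] at key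
  have hent := hmax.trans (measureEntropy_le_letters hν (n := n) hn1)
  have hn' : (0 : ℝ) < n := by positivity
  rw [EReal.coe_le_coe_iff, le_div_iff₀ hn'] at hent
  rw [hη, Real.log_exp] at key
  have h5 : δ / 2 * (2 * (Real.log C' + 3) / δ) = Real.log C' + 3 := by field_simp
  have h6 : δ / 2 * (2 * (Real.log C' + 3) / δ) ≤
      ν.real (letters X n ⁻¹' S) * (2 * (Real.log C' + 3) / δ) := by gcongr
  have h7 : (1 - ν.real (letters X n ⁻¹' S)) * Real.log C' ≤ 1 * Real.log C' := by
    gcongr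
    linarith [measureReal_nonneg (μ := ν) (s := letters X n ⁻¹' S)]
  nlinarith

/-- The upper Gibbs bound turns the small weight of the words outside G(M) into small measure,
uniformly in n. -/
theorem exists_mass_fattened [Nonempty X.carrier] (hφ : Continuous φ) {μ : Measure X.carrier}
    [IsProbabilityMeasure μ] {K : ℝ} (hK : 0 < K) (hup : HasUpperGibbs X φ μ K) {ε : ℝ}
    (hε : 0 < ε) : ∃ M, ∀ n, μ.real (letters X n ⁻¹' {c | List.ofFn c ∉ fattened X {[]} G Cs M}) ≤
      ε := by
  classical
  obtain ⟨M, hM⟩ := h.exists_totalWeight_not_fattened_le hφ (div_pos hε hK)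
  refine ⟨M, fun n => ?_⟩
  set D := fattened X {[]} G Cs M
  have h1 := sum_letters_preimage μ (n := n) (Finset.univ.filter fun c => List.ofFn c ∉ D)
  simp only [Finset.coe_filter, Finset.mem_univ, true_and] at h1
  rw [← h1]
  have h2 : ∀ c ∈ Finset.univ.filter (fun c : Fin n → Fin d => List.ofFn c ∉ D),
      μ.real (letters X n ⁻¹' {c}) ≤
        K * ((language X \ D).indicator (weight X φ) (List.ofFn c)).toReal := by
    intro c hc
    have hcD : List.ofFn c ∉ D := (Finset.mem_filter.1 hc).2
    by_cases hL : List.ofFn c ∈ language X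
    · rw [Set.indicator_of_mem (show _ ∈ language X \ D from ⟨hL, hcD⟩), weight_eq_ofReal hL,
        ENNReal.toReal_ofReal (realWeight_pos _).le, ← cyl_ofFn]
      exact hup _ hL
    · have : letters X n ⁻¹' {c} = ∅ := by
        rw [← cyl_ofFn]
        exact Set.not_nonempty_iff_eq_empty.1 hL
      rw [this, measureReal_empty]
      positivity
  refine (Finset.sum_le_sum h2).trans ?_
  rw [← Finset.mul_sum, ← ENNReal.toReal_sum fun c _ => ?_]
  · have h3 : (∑ c ∈ Finset.univ.filter (fun c : Fin n → Fin d => List.ofFn c ∉ D),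
        (language X \ D).indicator (weight X φ) (List.ofFn c)) ≤ ENNReal.ofReal (ε / K) := by
      refine (Finset.sum_le_sum_of_subset (Finset.filter_subset _ _)).trans ?_
      rw [← totalWeight_level]
      exact hM M le_rfl n
    have h4 := ENNReal.toReal_le_of_le_ofReal (by positivity) h3
    calc _ ≤ K * (ε / K) := by gcongr
      _ = ε := by field_simp
  · by_cases hmem : List.ofFn c ∈ language X \ D
    · rw [Set.indicator_of_mem hmem]; exact weight_ne_top _
    · rw [Set.indicator_of_notMem hmem]; simp

/-- Suppose s is invariant and neither null nor conull. Approximate s and its complement by unions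
of cylinders over words of G(M). By invariance a point rarely visits the first union now and the
second at time l, whereas the joint lower bound, divided by the two upper bounds, makes this at
least a constant times the product of the masses. -/
theorem ergodic [Nonempty X.carrier] (hφ : Continuous φ) {μ : Measure X.carrier}
    (hμ : IsInvariantProb X μ) {K : ℝ} (hK : 0 < K) (hup : HasUpperGibbs X φ μ K)
    (hlow : ∀ M, HasJointLowerGibbs X φ μ (fattened X {[]} G Cs M)) :
    Ergodic (shiftMap X) μ := by
  classical
  have := hμ.1
  refine ⟨hμ.2, ⟨fun s hs hinv => ?_⟩⟩
  rw [eventuallyConst_set']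
  by_contra hcon
  rw [not_or] at hcon
  have hα : 0 < μ.real s := by
    refine ENNReal.toReal_pos (fun h0 => hcon.1 (ae_eq_empty.2 h0)) (measure_ne_top _ _)
  have hβ : 0 < μ.real sᶜ := by
    refine ENNReal.toReal_pos (fun h0 => hcon.2 (ae_eq_univ.2 h0)) (measure_ne_top _ _)
  set α := μ.real s
  set β := μ.real sᶜ
  set m := min α β with hm
  have hm0 : 0 < m := lt_min hα hβ
  obtain ⟨M, hM⟩ := h.exists_mass_fattened hφ hK hup (show 0 < m / 4 by positivity)
  set D := fattened X {[]} G Cs M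
  obtain ⟨c, hc, t, hct⟩ := hlow M
  -- The first bound leaves mass m/2 after approximating (loss m/4) and discarding words outside D
  -- (loss m/4); the second makes 2δ smaller than the joint lower bound.
  set δ := min (m / 4) (c * (m / 2) ^ 2 / (4 * K ^ 2)) with hδ
  have hδ0 : 0 < δ := by positivity
  obtain ⟨N₁, hN₁⟩ := exists_letters_symmDiff_lt μ hs hδ0
  obtain ⟨N₂, hN₂⟩ := exists_letters_symmDiff_lt μ hs.compl hδ0
  set N := max N₁ N₂
  obtain ⟨S₁, hS₁⟩ := hN₁ N (le_max_left _ _)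
  obtain ⟨S₂, hS₂⟩ := hN₂ N (le_max_right _ _)
  have trim : ∀ (A : Set X.carrier) (S : Set (Fin N → Fin d)), m ≤ μ.real A →
      μ.real (symmDiff A (letters X N ⁻¹' S)) < δ → ∃ W : Finset (Fin N → Fin d),
        (∀ a ∈ W, List.ofFn a ∈ D) ∧ m / 2 ≤ μ.real (letters X N ⁻¹' W) ∧
          μ.real (letters X N ⁻¹' W \ A) ≤ δ := by
    intro A S hA hAS
    refine ⟨(S.toFinset).filter fun a => List.ofFn a ∈ D, fun a ha => (Finset.mem_filter.1 ha).2,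
      ?_, ?_⟩
    · have hsub : A ⊆ letters X N ⁻¹' ((S.toFinset).filter fun a => List.ofFn a ∈ D : Finset _) ∪
          (symmDiff A (letters X N ⁻¹' S) ∪ letters X N ⁻¹' {c | List.ofFn c ∉ D}) := by
        intro x hx
        by_cases h1 : letters X N x ∈ S
        · by_cases h2 : List.ofFn (letters X N x) ∈ D
          · left; simp [h1, h2]
          · right; right; exact h2
        · right; left; left; exact ⟨hx, h1⟩
      have h1 := (measureReal_mono (μ := μ) hsub).trans (measureReal_union_le _ _)
      have h2 := measureReal_union_le (μ := μ) (symmDiff A (letters X N ⁻¹' S))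
        (letters X N ⁻¹' {c | List.ofFn c ∉ D})
      have h3 := hM N
      have h4 : δ ≤ m / 4 := min_le_left _ _
      linarith
    · refine (measureReal_mono ?_).trans hAS.le
      rintro x ⟨hx, hxA⟩
      right
      refine ⟨?_, hxA⟩
      simp only [Finset.coe_filter, Set.mem_toFinset, Set.mem_preimage] at hx
      exact hx.1
  obtain ⟨W₁, hW₁D, hW₁, hW₁s⟩ := trim s S₁ (min_le_left _ _) hS₁
  obtain ⟨W₂, hW₂D, hW₂, hW₂s⟩ := trim sᶜ S₂ (min_le_right _ _) hS₂
  set l := N + 2 * t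
  have hTl := hμ.2.iterate l
  have hinvl : ((shiftMap X)^[l]) ⁻¹' s = s := by
    have : ∀ k, ((shiftMap X)^[k]) ⁻¹' s = s := by
      intro k
      induction k with
      | zero => rfl
      | succ k ih => rw [Function.iterate_succ, Set.preimage_comp, ih, hinv]
    exact this l
  set E := letters X N ⁻¹' (W₁ : Set (Fin N → Fin d)) ∩
    (shiftMap X)^[l] ⁻¹' (letters X N ⁻¹' (W₂ : Set (Fin N → Fin d))) with hE
  have hupper : μ.real E ≤ 2 * δ := by
    have hsub : E ⊆ (letters X N ⁻¹' (W₁ : Set (Fin N → Fin d)) \ s) ∪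
        (shiftMap X)^[l] ⁻¹' (letters X N ⁻¹' (W₂ : Set (Fin N → Fin d)) \ sᶜ) := by
      rintro x ⟨h1, h2⟩
      by_cases hx : x ∈ s
      · right
        refine ⟨h2, fun h3 => h3 ?_⟩
        have : x ∈ ((shiftMap X)^[l]) ⁻¹' s := by rwa [hinvl]
        exact this
      · left; exact ⟨h1, hx⟩
    have h1 := (measureReal_mono (μ := μ) hsub).trans (measureReal_union_le _ _)
    rw [hTl.measureReal_preimage ((measurable_letters N
      (Set.toFinite _).measurableSet).diff hs.compl).nullMeasurableSet] at h1
    linarith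
  have hlower : c / K ^ 2 * (m / 2) ^ 2 ≤ μ.real E := by
    have hpair : Measurable fun x => (letters X N x, letters X N ((shiftMap X)^[l] x)) :=
      (measurable_letters N).prodMk ((measurable_letters N).comp hTl.measurable)
    have hEeq : E = (fun x => (letters X N x, letters X N ((shiftMap X)^[l] x))) ⁻¹'
        ((W₁ ×ˢ W₂ : Finset _) : Set ((Fin N → Fin d) × (Fin N → Fin d))) := by
      ext x; simp [hE]
    rw [hEeq, ← sum_measureReal_preimage_singleton _
      fun p _ => hpair (measurableSet_singleton p), Finset.sum_product]
    have hterm : ∀ a ∈ W₁, ∀ b ∈ W₂, c / K ^ 2 *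
        (μ.real (letters X N ⁻¹' {a}) * μ.real (letters X N ⁻¹' {b})) ≤
        μ.real ((fun x => (letters X N x, letters X N ((shiftMap X)^[l] x))) ⁻¹' {(a, b)}) := by
      intro a ha b hb
      have haD := hW₁D a ha
      have hbD := hW₂D b hb
      have h1 := hct _ haD _ hbD l (by rw [List.length_ofFn])
      have h2 := hup _ haD.1
      have h3 := hup _ hbD.1
      rw [cyl_ofFn] at h2 h3
      rw [cyl_ofFn, cyl_ofFn] at h1
      have e : letters X N ⁻¹' {a} ∩ (shiftMap X)^[l] ⁻¹' (letters X N ⁻¹' {b}) =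
          (fun x => (letters X N x, letters X N ((shiftMap X)^[l] x))) ⁻¹' {(a, b)} := by
        ext x; simp
      rw [e] at h1
      refine le_trans ?_ h1
      have h4 := mul_le_mul h2 h3 measureReal_nonneg
        (mul_nonneg hK.le (realWeight_pos (X := X) (φ := φ) _).le)
      calc _ ≤ c / K ^ 2 * (K * realWeight X φ (List.ofFn a) *
            (K * realWeight X φ (List.ofFn b))) := by gcongr
        _ = _ := by field_simp
    refine le_trans ?_ (Finset.sum_le_sum fun a ha => Finset.sum_le_sum fun b hb => hterm a ha b hb)
    simp only [← Finset.mul_sum, sum_letters_preimage]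
    rw [← Finset.sum_mul, sum_letters_preimage, pow_two (m / 2)]
    gcongr
  have h3 : δ ≤ c * (m / 2) ^ 2 / (4 * K ^ 2) := min_le_right _ _
  have h4 : c * (m / 2) ^ 2 / (4 * K ^ 2) = c / K ^ 2 * (m / 2) ^ 2 / 4 := by
    field_simp
  have h5 : 0 < c / K ^ 2 * (m / 2) ^ 2 := by positivity
  linarith

/-- A continuous potential with an adapted decomposition has a unique equilibrium state; it is weak
Gibbs and the limit of the periodic orbit measures. -/
theorem exists_unique_equilibriumState [Nonempty X.carrier] (hφ : Continuous φ) :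
    ∃ μ : Measure X.carrier, IsEquilibriumState X φ μ ∧
      (∀ ν : Measure X.carrier, IsEquilibriumState X φ ν → ν = μ) ∧
      IsWeakGibbs X φ μ ∧
      ∀ g : C(X.carrier, ℝ),
        Tendsto (fun n : ℕ => ∫ x, g x ∂(periodicOrbitMeasure X φ n)) atTop
          (𝓝 (∫ x, g x ∂μ)) := by
  obtain ⟨U₀, hU₀⟩ := Ultrafilter.exists_le (atTop : Filter ℕ)
  obtain ⟨μ, hμ, hlim, ⟨K, hK, hup⟩, hlow⟩ := h.exists_limit hφ hU₀
  have hmaxμ := pressure_sub_le_measureEntropy hμ hφ hK hup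
  have hle : ∀ ν : Measure X.carrier, IsInvariantProb X ν →
      measureEntropy (shiftMap X) ν + ((∫ x, φ x ∂ν : ℝ) : EReal) ≤ (pressure X φ : EReal) := by
    intro ν hν
    refine (add_le_add_left (h.measureEntropy_le_pressure_sub hφ hν) _).trans ?_
    rw [← EReal.coe_add]; simp
  have hge : (pressure X φ : EReal) ≤
      measureEntropy (shiftMap X) μ + ((∫ x, φ x ∂μ : ℝ) : EReal) := by
    refine le_trans ?_ (add_le_add_left hmaxμ _)
    rw [← EReal.coe_add]; simp
  have huniq : ∀ ν : Measure X.carrier, IsInvariantProb X ν →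
      ((pressure X φ - ∫ x, φ x ∂ν : ℝ) : EReal) ≤ measureEntropy (shiftMap X) ν → ν = μ := by
    intro ν hν hmax
    have := hμ.1
    have := hν.1
    exact (h.ergodic hφ hμ hK hup hlow).eq_of_absolutelyContinuous hν.2
      (h.absolutelyContinuous hφ hμ hν hlow hmax)
  refine ⟨μ, ⟨hμ, fun ν hν => (hle ν hν).trans hge⟩, fun ν hν => huniq ν hν.1 ?_, ?_, fun g => ?_⟩
  · have h1 := hge.trans (hν.2 μ hμ)
    rw [EReal.coe_sub]
    exact EReal.sub_le_of_le_add h1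
  · refine ⟨{[]}, G, Cs, h, ?_⟩
    have := hμ.1
    choose c hc hlo using fun M => (hlow M).exists_lower (h.nil_mem_fattened M)
    refine ⟨K, c, hK, hc, fun M w hw => ?_⟩
    have e : Real.exp (-(w.length : ℝ) * pressure X φ + wordSup X φ w) = realWeight X φ w := by
      rw [realWeight]; congr 1; ring
    rw [e, le_div_iff₀ (realWeight_pos w), div_le_iff₀ (realWeight_pos w)]
    exact ⟨hlo M w hw, hup w hw.1⟩
  -- Along every ultrafilter there is a limit with the upper Gibbs bound, hence with free energy at
  -- least P, and uniqueness identifies it with μ.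
  · rw [tendsto_iff_ultrafilter]
    intro U hU
    obtain ⟨ν, hν, hlimν, ⟨K', hK', hup'⟩, -⟩ := h.exists_limit hφ hU
    have := huniq ν hν (pressure_sub_le_measureEntropy hν hφ hK' hup')
    rw [← this]
    exact hlimν g

end IsAdaptedDecomposition

end Thermo

end

noncomputable section

namespace Thermo

variable {d : ℕ} {X : Subshift (Fin d) ℕ} {φ : X.carrier → ℝ}

/-! ### Criteria for finite total weight and for points of a shift space -/

theorem totalWeight_range_le {ι : Type*} (f : ι → List (Fin d)) :
    totalWeight X φ (Set.range f) ≤ ∑' i, weight X φ (f i) := by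
  rw [totalWeight_eq_tsum_subtype]
  exact ENNReal.tsum_le_tsum_comp_of_surjective Set.rangeFactorization_surjective
    fun w : Set.range f => weight X φ w

theorem summable_of_totalWeight_ne_top [Nonempty X.carrier] {Cs : Set (List (Fin d))}
    (hCs : Cs ⊆ language X) (h : totalWeight X φ Cs ≠ ⊤) :
    Summable fun n : ℕ => partitionSum X ({[]} ∪ Cs) φ (n + 1) *
      Real.exp (-((n + 1 : ℕ) : ℝ) * pressure X φ) := by
  have hU : ({[]} ∪ Cs : Set (List (Fin d))) ⊆ language X :=
    Set.union_subset (by simpa using nil_mem_language) hCs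
  have h1 : totalWeight X φ ({[]} ∪ Cs) ≠ ⊤ := by
    refine ne_top_of_le_ne_top ?_ (totalWeight_union_le _ _)
    rw [totalWeight_singleton]
    exact ENNReal.add_ne_top.2 ⟨weight_ne_top _, h⟩
  rw [totalWeight_eq_tsum_level, tsum_eq_zero_add' ENNReal.summable] at h1
  have h2 := ENNReal.summable_toReal (ENNReal.add_ne_top.1 h1).2
  refine h2.congr fun n => ?_
  rw [totalWeight_level_eq hU, ENNReal.toReal_ofReal]
  exact mul_nonneg (partitionSum_nonneg _ _ _) (Real.exp_pos _).le

theorem totalWeight_level_short_le (D : Set (List (Fin d))) (N : ℕ) :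
    ∑ n ∈ Finset.range N, totalWeight X φ (level D n) ≤
      totalWeight X φ {w | w ∈ D ∧ w.length < N} := by
  rw [totalWeight_eq_tsum_level {w | w ∈ D ∧ w.length < N}]
  refine le_trans (Finset.sum_le_sum fun n hn => ?_) (ENNReal.sum_le_tsum (Finset.range N))
  refine totalWeight_mono fun w hw => ?_
  rw [Finset.mem_range] at hn
  exact ⟨⟨hw.1, hw.2.trans_lt hn⟩, hw.2⟩

theorem totalWeight_short_ne_top (D : Set (List (Fin d))) (N : ℕ) :
    totalWeight X φ {w | w ∈ D ∧ w.length < N} ≠ ⊤ := by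
  rw [totalWeight_eq_tsum_level, tsum_eq_sum (s := Finset.range N)]
  · exact ENNReal.sum_ne_top.2 fun n _ => totalWeight_level_ne_top _ n
  · intro n hn
    rw [Finset.mem_range] at hn
    have : level {w | w ∈ D ∧ w.length < N} n = ∅ := by
      ext w; simp only [level, Set.mem_ofPred_eq, Set.mem_empty_iff_false]; grind
    rw [this]; simp [totalWeight]

/-- Truncation by length makes weights finite, so that self-bounding inequalities can be solved
before passing to the limit. -/
theorem totalWeight_le_of_short {D : Set (List (Fin d))} {C : ENNReal}
    (h : ∀ N, totalWeight X φ {w | w ∈ D ∧ w.length < N} ≤ C) : totalWeight X φ D ≤ C := by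
  rw [totalWeight_eq_tsum_level, ENNReal.tsum_eq_iSup_nat]
  exact iSup_le fun N => (totalWeight_level_short_le D N).trans (h N)

theorem mem_carrier_of_prefixes {x : ℕ → Fin d}
    (h : ∀ n, ∃ y ∈ X.carrier, ∀ i < n, y i = x i) : x ∈ X.carrier := by
  choose y hy hyx using h
  refine X.isClosed.mem_of_tendsto (f := y) (b := atTop) ?_ (Eventually.of_forall hy)
  rw [tendsto_pi_nhds]
  intro i
  refine tendsto_const_nhds.congr' ?_
  filter_upwards [eventually_gt_atTop i] with n hn
  exact (hyx n i hn).symm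

/-- Every prefix of the sequence ζζζ⋯ begins some point of X, and X is closed. For the empty word
the period is 0 and any point serves. -/
theorem exists_isPeriodicPt [Nonempty X.carrier] {ζ : List (Fin d)}
    (h : ∀ k, (List.replicate k ζ).flatten ∈ language X) :
    ∃ x ∈ cyl X ζ, Function.IsPeriodicPt (shiftMap X) ζ.length x := by
  rcases Nat.eq_zero_or_pos ζ.length with h0 | hpos
  · rw [List.length_eq_zero_iff] at h0
    subst h0
    exact ⟨Classical.arbitrary _, mem_cyl_nil _, rfl⟩
  let x : ℕ → Fin d := fun i => ζ[i % ζ.length]'(Nat.mod_lt _ hpos)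
  have hy : ∀ k (y : X.carrier), y ∈ cyl X (List.replicate k ζ).flatten →
      ∀ i < k * ζ.length, y.1 i = x i := by
    intro k
    induction k with
    | zero => intro y _ i hi; omega
    | succ k ih =>
      intro y hy i hi
      rw [List.replicate_succ, List.flatten_cons, mem_cyl_append] at hy
      by_cases hil : i < ζ.length
      · rw [mem_cyl_iff.1 hy.1 i hil]
        simp only [x, Nat.mod_eq_of_lt hil]
      · have := ih _ hy.2 (i - ζ.length) (by rw [Nat.add_mul] at hi; omega)
        rw [iterate_shiftMap_apply, Nat.add_sub_cancel' (by omega)] at this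
        rw [this]
        simp only [x]
        congr 1
        exact (Nat.mod_eq_sub_mod (by omega)).symm
  have hx : x ∈ X.carrier := by
    refine mem_carrier_of_prefixes fun n => ?_
    obtain ⟨y, hyn⟩ := h n
    exact ⟨y.1, y.2, fun i hi => hy n y hyn i (by nlinarith)⟩
  refine ⟨⟨x, hx⟩, mem_cyl_iff.2 fun i hi => ?_, ?_⟩
  · simp only [x, Nat.mod_eq_of_lt hi]
  · refine Subtype.ext (funext fun i => ?_)
    rw [iterate_shiftMap_apply]
    simp [x]

/-! ### Potentials depending on the number of leading zeros -/

variable [NeZero d] {a : ℕ → ℝ}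

theorem leadingZeroPotential_zero {x : X.carrier} (h : x.1 = 0) :
    leadingZeroPotential X a x = 0 := if_pos h

theorem leadingZeroPotential_eq {x : X.carrier} {n : ℕ} (h0 : ∀ i < n, x.1 i = 0)
    (h : x.1 n ≠ 0) : leadingZeroPotential X a x = a n := by
  have hx : x.1 ≠ 0 := fun hx => h (congrFun hx n)
  rw [leadingZeroPotential, if_neg hx]
  congr 1
  refine le_antisymm (Nat.sInf_le h) (le_csInf ⟨n, h⟩ fun m hm => ?_)
  by_contra! hlt
  exact hm (h0 m hlt)

theorem exists_first_ne_zero {x : ℕ → Fin d} {j : ℕ} (h : x j ≠ 0) :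
    ∃ n ≤ j, (∀ i < n, x i = 0) ∧ x n ≠ 0 := by
  classical
  have hex : ∃ n, x n ≠ 0 := ⟨j, h⟩
  exact ⟨Nat.find hex, Nat.find_min' hex h,
    fun i hi => by simpa using Nat.find_min hex hi, Nat.find_spec hex⟩

theorem leadingZeroPotential_congr {x y : X.carrier} {j : ℕ} (h : ∀ i ≤ j, x.1 i = y.1 i)
    (hj : x.1 j ≠ 0) : leadingZeroPotential X a x = leadingZeroPotential X a y := by
  obtain ⟨n, hn, h0, hne⟩ := exists_first_ne_zero hj
  rw [leadingZeroPotential_eq h0 hne, leadingZeroPotential_eq (n := n)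
    (fun i hi => (h i (by omega)) ▸ h0 i hi) (h n hn ▸ hne)]

/-- Away from 0 the function is locally constant; at 0 continuity is the convergence of a to 0. -/
theorem continuous_leadingZeroPotential (ha : Tendsto a atTop (𝓝 0)) :
    Continuous (leadingZeroPotential X a) := by
  rw [Metric.continuous_iff']
  intro x ε hε
  have hnhds : ∀ n, ∀ᶠ y in 𝓝 x, letters X n y = letters X n x := fun n =>
    (isClopen_letters_preimage n {letters X n x}).isOpen.mem_nhds rfl
  by_cases hx : x.1 = 0
  · obtain ⟨N, hN⟩ := Metric.tendsto_atTop.1 ha ε hε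
    filter_upwards [hnhds N] with y hy
    rw [leadingZeroPotential_zero hx]
    by_cases hy0 : y.1 = 0
    · rwa [leadingZeroPotential_zero hy0, dist_self]
    · obtain ⟨j, hj⟩ := Function.ne_iff.1 hy0
      obtain ⟨n, -, h0, hne⟩ := exists_first_ne_zero (x := y.1) hj
      rw [leadingZeroPotential_eq h0 hne]
      refine hN n ?_
      by_contra! hlt
      refine hne ((congrFun hy ⟨n, hlt⟩).trans ?_)
      simp [letters, hx]
  · obtain ⟨j, hj⟩ := Function.ne_iff.1 hx
    filter_upwards [hnhds (j + 1)] with y hy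
    rw [← leadingZeroPotential_congr (x := x) (y := y) (j := j)
      (fun i hi => (congrFun hy ⟨i, by omega⟩).symm) hj, dist_self]
    exact hε

theorem exists_abs_le_of_tendsto (ha : Tendsto a atTop (𝓝 0)) : ∃ A, 0 ≤ A ∧ ∀ n, |a n| ≤ A := by
  obtain ⟨A, hA⟩ := (Metric.isBounded_range_of_tendsto a ha).exists_norm_le
  have hA' : ∀ n, |a n| ≤ A := fun n => hA _ ⟨n, rfl⟩
  exact ⟨A, (abs_nonneg _).trans (hA' 0), hA'⟩

theorem abs_leadingZeroPotential_le {A : ℝ} (hA0 : 0 ≤ A) (hA : ∀ n, |a n| ≤ A) (x : X.carrier) :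
    |leadingZeroPotential X a x| ≤ A := by
  rw [leadingZeroPotential]
  split_ifs
  · simpa using hA0
  · exact hA _

/-- The empty word and the words with a nonzero letter among their last `T + 1` letters. -/
def nearNonzero (d T : ℕ) [NeZero d] : Set (List (Fin d)) :=
  {w | w = [] ∨ ∃ (j : ℕ) (h : j < w.length), w.length ≤ j + T + 1 ∧ w[j] ≠ 0}

/-- Up to the position of a nonzero letter of w the values are determined by w; at most T positions
follow it. -/
theorem hasBowenPropertyOn_nearNonzero (ha : Tendsto a atTop (𝓝 0)) (T : ℕ) :
    HasBowenPropertyOn X (nearNonzero d T) (leadingZeroPotential X a) := by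
  obtain ⟨A, hA0, hA⟩ := exists_abs_le_of_tendsto ha
  have hA2 := abs_leadingZeroPotential_le (X := X) hA0 hA
  refine ⟨T * (2 * A), ?_⟩
  rintro w (rfl | ⟨j, hj, hjT, hne⟩) x hx y hy
  · simp only [List.length_nil, birkhoffSum_zero, sub_self, abs_zero]
    positivity
  · rw [mem_cyl_iff] at hx hy
    rw [birkhoffSum, birkhoffSum, ← Finset.sum_sub_distrib]
    refine (Finset.abs_sum_le_sum_abs _ _).trans ?_
    have hsplit : ∀ i ∈ Finset.range w.length,
        |leadingZeroPotential X a ((shiftMap X)^[i] x) -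
          leadingZeroPotential X a ((shiftMap X)^[i] y)| ≤ if j < i then 2 * A else 0 := by
      intro i hi
      split_ifs with h
      · have h1 := abs_le.1 (hA2 ((shiftMap X)^[i] x))
        have h2 := abs_le.1 (hA2 ((shiftMap X)^[i] y))
        rw [abs_le]; constructor <;> linarith
      · rw [leadingZeroPotential_congr (y := (shiftMap X)^[i] y) (j := j - i), sub_self, abs_zero]
        · intro m hm
          rw [iterate_shiftMap_apply, iterate_shiftMap_apply, hx _ (by omega), hy _ (by omega)]
        · rw [iterate_shiftMap_apply, Nat.add_sub_cancel' (by omega), hx j hj]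
          exact hne
    refine (Finset.sum_le_sum hsplit).trans ?_
    rw [← Finset.sum_filter, Finset.sum_const, nsmul_eq_mul]
    have hcard : ((Finset.range w.length).filter fun i => j < i).card ≤ T := by
      calc _ ≤ (Finset.Ico (j + 1) w.length).card := by
            refine Finset.card_le_card fun i hi => ?_
            simp only [Finset.mem_filter, Finset.mem_range] at hi
            simp only [Finset.mem_Ico]; omega
        _ ≤ T := by rw [Nat.card_Ico]; omega
    gcongr

theorem HasBowenPropertyOn.add {D : Set (List (Fin d))} {f g : X.carrier → ℝ}
    (hf : HasBowenPropertyOn X D f) (hg : HasBowenPropertyOn X D g) :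
    HasBowenPropertyOn X D (fun x => f x + g x) := by
  obtain ⟨V, hV⟩ := hf
  obtain ⟨W, hW⟩ := hg
  refine ⟨V + W, fun w hw x hx y hy => ?_⟩
  have h1 := hV w hw x hx y hy
  have h2 := hW w hw x hx y hy
  simp only [birkhoffSum, Finset.sum_add_distrib] at h1 h2 ⊢
  rw [abs_le] at *
  constructor <;> linarith

theorem HasBowenPropertyOn.mono {D E : Set (List (Fin d))} {f : X.carrier → ℝ}
    (hf : HasBowenPropertyOn X E f) (h : D ⊆ E) : HasBowenPropertyOn X D f := by
  obtain ⟨V, hV⟩ := hf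
  exact ⟨V, fun w hw => hV w (h hw)⟩

theorem append_mem_nearNonzero {T : ℕ} {u v : List (Fin d)} (hv : v ∈ nearNonzero d T)
    (hne : v ≠ []) : u ++ v ∈ nearNonzero d T := by
  rcases hv with rfl | ⟨j, hj, hjT, hz⟩
  · exact absurd rfl hne
  · refine Or.inr ⟨u.length + j, by simpa using hj, by simp; omega, ?_⟩
    rw [List.getElem_append_right (by omega)]
    simpa using hz

/-- With 2ε = P - φ(0), the word 0^k has weight at most e^C e^{-εk}, because sums over a cylinder
differ from those at the point 0 by at most C + εk. This is where the gap φ(0) < P is used. -/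
theorem totalWeight_zeros_ne_top (hφ : Continuous φ) (h0 : (0 : ℕ → Fin d) ∈ X.carrier)
    (hP : φ ⟨0, h0⟩ < pressure X φ) :
    totalWeight X φ (Set.range fun k => List.replicate k (0 : Fin d)) ≠ ⊤ := by
  set P := pressure X φ
  set o : X.carrier := ⟨0, h0⟩
  set ε := (P - φ o) / 2 with hε
  have hε0 : 0 < ε := by rw [hε]; linarith
  obtain ⟨C, hC⟩ := exists_abs_birkhoffSum_sub_le hφ hε0
  have ho : shiftMap X o = o := rfl
  have hS : ∀ n : ℕ, birkhoffSum (shiftMap X) φ n o = n * φ o := by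
    intro n
    simp [birkhoffSum, Function.iterate_fixed ho]
  have hmem : ∀ k, o ∈ cyl X (List.replicate k (0 : Fin d)) := fun k => by
    simp [mem_cyl_iff, o]
  have hw : ∀ k, weight X φ (List.replicate k (0 : Fin d)) ≤
      ENNReal.ofReal (Real.exp C * Real.exp (-ε) ^ k) := by
    intro k
    rw [weight_of_mem ⟨o, hmem k⟩, ← Real.exp_nat_mul, ← Real.exp_add]
    refine ENNReal.ofReal_le_ofReal (Real.exp_le_exp.2 ?_)
    obtain ⟨x, hx, hs⟩ := exists_birkhoffSum_eq_wordSup hφ ⟨o, hmem k⟩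
    have h1 := (abs_le.1 (hC _ x hx o (hmem k))).2
    rw [hs]
    rw [hS] at h1
    simp only [List.length_replicate] at h1 ⊢
    have h2 : (k : ℝ) * (P - φ o) = k * (2 * ε) := by rw [hε]; ring
    linarith
  refine ne_top_of_le_ne_top ?_ ((totalWeight_range_le _).trans (ENNReal.tsum_le_tsum hw))
  refine Summable.tsum_ofReal_ne_top ?_
  refine (summable_geometric_of_lt_one (Real.exp_pos _).le ?_).mul_left _
  rw [Real.exp_lt_one_iff]; linarith

/-- If there are points with every number of leading zeros, then unboundedness of the partial sums
destroys the Bowen property. -/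
theorem not_hasBowenProperty {φr : X.carrier → ℝ} (h0 : (0 : ℕ → Fin d) ∈ X.carrier)
    (hr : HasBowenProperty X φr) (hφ : ∀ x, φ x = φr x + leadingZeroPotential X a x)
    (hpts : ∀ N, ∃ x ∈ X.carrier, (∀ i < N, x i = 0) ∧ x N ≠ 0)
    (hunb : ¬ ∃ C : ℝ, ∀ N : ℕ, |∑ n ∈ Finset.Icc 1 N, a n| ≤ C) : ¬ HasBowenProperty X φ := by
  rintro ⟨V, hV⟩
  obtain ⟨Vr, hVr⟩ := hr
  refine hunb ⟨V + Vr, fun N => ?_⟩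
  obtain ⟨x, hx, hx0, hxN⟩ := hpts N
  set o : X.carrier := ⟨0, h0⟩
  have ho : shiftMap X o = o := rfl
  set p : X.carrier := ⟨x, hx⟩
  have hmo : o ∈ cyl X (List.replicate N (0 : Fin d)) := by simp [mem_cyl_iff, o]
  have hmp : p ∈ cyl X (List.replicate N (0 : Fin d)) := by
    rw [mem_cyl_iff]; intro i hi; simpa using hx0 i (by simpa using hi)
  have h1 := hV _ ⟨o, hmo⟩ p hmp o hmo
  have h2 := hVr _ ⟨o, hmo⟩ p hmp o hmo
  rw [List.length_replicate] at h1 h2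
  have h3 : birkhoffSum (shiftMap X) φ N p =
      birkhoffSum (shiftMap X) φr N p + ∑ n ∈ Finset.Icc 1 N, a n := by
    simp only [birkhoffSum, hφ, Finset.sum_add_distrib]
    congr 1
    -- After i steps exactly N - i zeros remain, so the sum runs through a_N, …, a_1 and a_0 does
    -- not occur.
    have : ∀ i ∈ Finset.range N, leadingZeroPotential X a ((shiftMap X)^[i] p) = a (N - i) := by
      intro i hi
      rw [Finset.mem_range] at hi
      refine leadingZeroPotential_eq (fun j hj => ?_) ?_
      · rw [iterate_shiftMap_apply]; exact hx0 _ (by omega)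
      · rw [iterate_shiftMap_apply, Nat.add_sub_cancel' hi.le]; exact hxN
    rw [Finset.sum_congr rfl this]
    refine Finset.sum_nbij' (fun i => N - i) (fun i => N - i) ?_ ?_ ?_ ?_ ?_ <;>
      simp only [Finset.mem_range, Finset.mem_Icc] <;> intros <;> first | omega | trivial
  have h4 : birkhoffSum (shiftMap X) φ N o = birkhoffSum (shiftMap X) φr N o := by
    refine Finset.sum_congr rfl fun i _ => ?_
    rw [Function.iterate_fixed ho, hφ, leadingZeroPotential_zero rfl, add_zero]
  rw [h3, h4] at h1
  rw [abs_le] at *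
  constructor <;> linarith

end Thermo

end

noncomputable section

namespace Thermo

variable {d : ℕ} {X : Subshift (Fin d) ℕ} {φ : X.carrier → ℝ}

/-! ### Synchronizing words and periodic specification -/

theorem HasSpecificationOn.exists_append {D : Set (List (Fin d))} {t : ℕ}
    (h : HasSpecificationOn X D t) {u v : List (Fin d)} (hu : u ∈ D) (hv : v ∈ D) :
    ∃ g : List (Fin d), g.length = t ∧ u ++ (g ++ v) ∈ language X := by
  obtain ⟨g, hg, hL⟩ := h 1 ![u, v] (fun i => by fin_cases i <;> simpa)
  refine ⟨g 0, (hg 0).2, ?_⟩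
  simpa [glue_succ, glue_zero] using hL

/-- In a shift space with specification there is a synchronizing word. -/
theorem exists_synchronizing {t : ℕ} [Nonempty X.carrier]
    (h : HasSpecificationOn X (language X) t) :
    ∃ s ∈ language X, ∀ p q : List (Fin d), p ++ s ∈ language X → s ++ q ∈ language X →
      p ++ (s ++ q) ∈ language X := by
  classical
  -- E(u, v) is the set of gap words of length t that fit between u and v. The synchronizing word is
  -- u g v for a pair with the fewest fitting gaps.
  let E : List (Fin d) × List (Fin d) → Finset (Fin t → Fin d) := fun p =>
    Finset.univ.filter fun g => p.1 ++ (List.ofFn g ++ p.2) ∈ language X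
  have hE : ∀ u v g, g ∈ E (u, v) ↔ u ++ (List.ofFn g ++ v) ∈ language X := by simp [E]
  let S : Set (List (Fin d) × List (Fin d)) := {p | p.1 ∈ language X ∧ p.2 ∈ language X}
  have hS : S.Nonempty := ⟨([], []), nil_mem_language, nil_mem_language⟩
  obtain ⟨⟨u, v⟩, ⟨hu, hv⟩, hmin⟩ : ∃ p ∈ S, ∀ q ∈ S, (E p).card ≤ (E q).card := by
    obtain ⟨p, hp, hm⟩ := WellFounded.has_min (measure fun p => (E p).card).wf S hS
    exact ⟨p, hp, fun q hq => not_lt.1 (hm q hq)⟩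
  obtain ⟨g, hg, hL⟩ := h.exists_append hu hv
  subst hg
  refine ⟨u ++ (g ++ v), hL, fun p q hp hq => ?_⟩
  have hpu : p ++ u ∈ language X := by
    rw [← List.append_assoc] at hp; exact language_append_left hp
  have hvq : v ++ q ∈ language X := by
    rw [List.append_assoc, List.append_assoc] at hq
    exact language_append_right (language_append_right hq)
  -- Extending u to the left and v to the right can only remove gaps; by minimality none is lost, so
  -- g still fits.
  have hsub : E (p ++ u, v ++ q) ⊆ E (u, v) := by
    intro c hc
    rw [hE] at hc ⊢
    rw [List.append_assoc] at hc
    have := language_append_right hc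
    rw [← List.append_assoc (List.ofFn c), ← List.append_assoc u] at this
    exact language_append_left this
  have heq := Finset.eq_of_subset_of_card_le hsub (hmin (p ++ u, v ++ q) ⟨hpu, hvq⟩)
  have hgE : g.get ∈ E (u, v) := by rw [hE, List.ofFn_get]; exact hL
  rw [← heq, hE, List.ofFn_get] at hgE
  simpa using hgE

/-- Each word w sits in a block s b w a s with s synchronizing. Consecutive blocks may share their
copy of s, so a s b is an admissible gap, depending only on the two neighbours, and the chain can be
closed up cyclically. -/
theorem exists_hasPerSpecificationOn_language [Nonempty X.carrier] {t : ℕ}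
    (h : HasSpecificationOn X (language X) t) :
    ∃ t', HasPerSpecificationOn X (language X) t' := by
  obtain ⟨s, hs, hsync⟩ := exists_synchronizing h
  have hblock : ∀ w ∈ language X, ∃ b a : List (Fin d), b.length = t ∧ a.length = t ∧
      s ++ (b ++ w ++ a ++ s) ∈ language X := by
    intro w hw
    obtain ⟨b, hb, hbL⟩ := h.exists_append hs hw
    obtain ⟨a, ha, haL⟩ := h.exists_append hbL hs
    exact ⟨b, a, hb, ha, by simpa using haL⟩
  choose! b a hb ha hab using hblock
  refine ⟨t + s.length + t, fun m w hw => ?_⟩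
  let v : Fin m → List (Fin d) := fun i => a (w i.castSucc) ++ s ++ b (w i.succ)
  have hglue : ∀ (m : ℕ) (w : Fin (m + 1) → List (Fin d)), (∀ i, w i ∈ language X) →
      s ++ (b (w 0) ++ glue w (fun i : Fin m => a (w i.castSucc) ++ s ++ b (w i.succ)) ++
        a (w (Fin.last m)) ++ s) ∈ language X := by
    intro m
    induction m with
    | zero => intro w hw; rw [glue_zero]; exact hab _ (hw 0)
    | succ m ih =>
      intro w hw
      have h1 := ih (fun i => w i.succ) fun i => hw _
      have h2 := hsync (s ++ (b (w 0) ++ w 0 ++ a (w 0))) _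
        (by simpa using hab _ (hw 0)) h1
      rw [glue_succ]
      simpa using h2
  have hz := hglue m w hw
  set z := glue w v with hzdef
  refine ⟨v, fun i => ⟨?_, ?_⟩, ?_, ?_⟩
  · have h1 := hab _ (hw i.castSucc)
    have h2 := hab _ (hw i.succ)
    have h3 := hsync (s ++ (b (w i.castSucc) ++ w i.castSucc ++ a (w i.castSucc)))
      (b (w i.succ) ++ w i.succ ++ a (w i.succ) ++ s) (by simpa using h1) h2
    have h4 : (s ++ (b (w i.castSucc) ++ w i.castSucc)) ++ (v i ++
        (w i.succ ++ a (w i.succ) ++ s)) ∈ language X := by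
      simpa [v] using h3
    exact language_append_left (language_append_right h4)
  · simp [v, ha _ (hw _), hb _ (hw _), add_assoc]
  · have h4 : (s ++ b (w 0)) ++ (z ++ (a (w (Fin.last m)) ++ s)) ∈ language X := by
      simpa using hz
    exact language_append_left (language_append_right h4)
  · set ζ := s ++ b (w 0) ++ (z ++ a (w (Fin.last m))) with hζ
    have hζs : ζ ++ s ∈ language X := by simpa [hζ] using hz
    have hk : ∀ k, (List.replicate k ζ).flatten ++ s ∈ language X := by
      intro k
      induction k with
      | zero => simpa using hs
      | succ k ih =>
        rw [List.replicate_succ, List.flatten_cons]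
        rcases k with _ | k
        · simpa using hζs
        · rw [List.replicate_succ, List.flatten_cons] at ih ⊢
          have h5 := hsync ζ (b (w 0) ++ (z ++ a (w (Fin.last m))) ++
            ((List.replicate k ζ).flatten ++ s)) hζs (by
              rw [hζ] at ih
              simpa [hζ] using ih)
          simpa [hζ] using h5
    obtain ⟨x, hx, hper⟩ := exists_isPeriodicPt fun k => language_append_left (hk k)
    rw [hζ, mem_cyl_append] at hx
    refine ⟨_, (mem_cyl_append.1 hx.2).1, ?_⟩
    -- The periodic point starts with s b; shifting past it puts z at the front, and |ζ| = |z| + (t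
    -- + |s| + t).
    have h6 := hper.apply_iterate (s ++ b (w 0)).length
    have hzl : (glue w v).length = z.length := rfl
    convert h6 using 1
    simp only [hζ, List.length_append, hb _ (hw _), ha _ (hw _)]
    omega

/-! ### Decompositions for shift spaces with specification -/

variable [NeZero d]

theorem exists_eq_append_replicate (z : List (Fin d)) :
    ∃ v ∈ nearNonzero d 0, ∃ k, z = v ++ List.replicate k 0 := by
  induction z using List.reverseRecOn with
  | nil => exact ⟨[], Or.inl rfl, 0, rfl⟩
  | append_singleton z c ih =>
    by_cases hc : c = 0
    · obtain ⟨v, hv, k, rfl⟩ := ih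
      refine ⟨v, hv, k + 1, ?_⟩
      rw [hc, List.replicate_succ', List.append_assoc]
    · exact ⟨z ++ [c], Or.inr ⟨z.length, by simp, by simp, by simpa using hc⟩, 0, by simp⟩

theorem replicate_zero_mem_language (h0 : (0 : ℕ → Fin d) ∈ X.carrier) (k : ℕ) :
    List.replicate k (0 : Fin d) ∈ language X :=
  ⟨⟨0, h0⟩, by simp [mem_cyl_iff]⟩

/-- Cores are empty or end in a nonzero letter, and the trailing zeros are the suffix. Every G(M)
lies in the language, which has periodic specification as a whole. -/
theorem HasSpecification.isAdaptedDecomposition (hX : HasSpecification X)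
    (h0 : (0 : ℕ → Fin d) ∈ X.carrier) {φr : X.carrier → ℝ} {a : ℕ → ℝ}
    (hφc : Continuous φ) (hbowen : HasBowenProperty X φr) (ha : Tendsto a atTop (𝓝 0))
    (hφ : ∀ x, φ x = φr x + leadingZeroPotential X a x) (hP : φ ⟨0, h0⟩ < pressure X φ) :
    IsAdaptedDecomposition X φ {[]} (language X ∩ nearNonzero d 0)
      (Set.range fun k => List.replicate k 0) := by
  have : Nonempty X.carrier := ⟨⟨0, h0⟩⟩
  obtain ⟨t, ht⟩ := hX
  obtain ⟨t', ht'⟩ := exists_hasPerSpecificationOn_language ht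
  have hsuf : (Set.range fun k => List.replicate k (0 : Fin d)) ⊆ language X := by
    rintro _ ⟨k, rfl⟩; exact replicate_zero_mem_language h0 k
  refine ⟨by simpa using nil_mem_language, Set.inter_subset_left, hsuf, fun z hz => ?_,
    fun M => ⟨t', ht'.mono fun z hz => hz.1⟩, ?_,
    summable_of_totalWeight_ne_top hsuf (totalWeight_zeros_ne_top hφc h0 hP)⟩
  · obtain ⟨v, hv, k, rfl⟩ := exists_eq_append_replicate z
    exact ⟨[], rfl, v, ⟨language_append_left hz, hv⟩, _, ⟨k, rfl⟩, rfl⟩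
  · rw [funext hφ]
    exact (hbowen.mono Set.inter_subset_left).add
      ((hasBowenPropertyOn_nearNonzero ha 0).mono Set.inter_subset_right)

/-- Glue 0^N to a word with a nonzero letter; the first nonzero letter comes at some time n ≥ N, and
shifting by n - N places it at N. -/
theorem HasSpecification.exists_leadingZeros (hX : HasSpecification X)
    (h0 : (0 : ℕ → Fin d) ∈ X.carrier) (hne : X.carrier ≠ {0}) (N : ℕ) :
    ∃ x ∈ X.carrier, (∀ i < N, x i = 0) ∧ x N ≠ 0 := by
  obtain ⟨y, hy, hy0⟩ : ∃ y ∈ X.carrier, y ≠ 0 := by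
    by_contra! H
    exact hne (Set.eq_singleton_iff_unique_mem.2 ⟨h0, H⟩)
  obtain ⟨j, hj⟩ := Function.ne_iff.1 hy0
  obtain ⟨t, ht⟩ := hX
  have hw := letters_mem_language (X := X) (j + 1) ⟨y, hy⟩
  obtain ⟨g, hg, x, hx⟩ := ht.exists_append (replicate_zero_mem_language h0 N) hw
  rw [mem_cyl_append, mem_cyl_append] at hx
  obtain ⟨hx1, -, hx3⟩ := hx
  rw [mem_cyl_iff] at hx1 hx3
  have h3 := hx3 j (by simp)
  simp only [iterate_shiftMap_apply, List.length_replicate, List.getElem_ofFn, letters] at h3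
  obtain ⟨n, hn, hz, hxn⟩ := exists_first_ne_zero (x := x.1) (j := N + (g.length + j))
    (by rw [h3]; exact hj)
  have hNn : N ≤ n := by
    by_contra! hlt
    exact hxn ((hx1 n (by simpa using hlt)).trans (List.getElem_replicate _))
  refine ⟨((shiftMap X)^[n - N] x).1, ((shiftMap X)^[n - N] x).2, fun i hi => ?_, ?_⟩
  · rw [iterate_shiftMap_apply]; exact hz _ (by omega)
  · rwa [iterate_shiftMap_apply, Nat.sub_add_cancel hNn]

end Thermo

end

noncomputable section

namespace Thermo

variable {d : ℕ} [NeZero d] {X : Subshift (Fin d) ℕ} {φ : X.carrier → ℝ}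

/-! ### Shift spaces with a lexicographically maximal sequence -/

/-- The points of `X` are the sequences all of whose shifts are lexicographically at most `ω`,
where `ω` itself is such a sequence, starts with a nonzero letter and does not end in zeros. -/
structure IsLexShift (X : Subshift (Fin d) ℕ) (ω : ℕ → Fin d) : Prop where
  mem_iff : ∀ x, x ∈ X.carrier ↔ ∀ k n, (∀ i < n, x (k + i) = ω i) → x (k + n) ≤ ω n
  self_mem : ω ∈ X.carrier
  zero_ne : ω 0 ≠ 0
  frequently_ne : ∀ N, ∃ n, ω (N + n) ≠ 0

/-- The initial word of length `m` of a sequence. -/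
def initialWord (ω : ℕ → Fin d) (m : ℕ) : List (Fin d) := List.ofFn fun i : Fin m => ω i

@[simp] theorem length_initialWord (ω : ℕ → Fin d) (m : ℕ) : (initialWord ω m).length = m :=
  List.length_ofFn

theorem getElem?_initialWord (ω : ℕ → Fin d) {m i : ℕ} (h : i < m) :
    (initialWord ω m)[i]? = some (ω i) := by
  simp [initialWord, h]

theorem mem_cyl_initialWord {ω : ℕ → Fin d} {m : ℕ} {x : X.carrier} :
    x ∈ cyl X (initialWord ω m) ↔ ∀ i < m, x.1 i = ω i := by
  simp [mem_cyl_iff, initialWord]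

theorem mem_cyl_iff_getElem? {w : List (Fin d)} {x : X.carrier} :
    x ∈ cyl X w ↔ ∀ i < w.length, w[i]? = some (x.1 i) := by
  rw [mem_cyl_iff]
  refine forall₂_congr fun i hi => ?_
  rw [List.getElem?_eq_getElem hi, Option.some_inj, eq_comm]

/-- The words all of whose nonempty suffixes are strictly below `ω`. -/
def strictWords (ω : ℕ → Fin d) : Set (List (Fin d)) :=
  {u | ∀ k < u.length, ∃ n c, u[k + n]? = some c ∧ c < ω n ∧ ∀ i < n, u[k + i]? = some (ω i)}

theorem getElem?_append_of_some {u v : List (Fin d)} {i : ℕ} {c : Fin d} (h : u[i]? = some c) :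
    (u ++ v)[i]? = some c := by
  rw [List.getElem?_append_left (List.getElem?_eq_some_iff.1 h).1, h]

theorem getElem?_append_length_add (u v : List (Fin d)) (i : ℕ) :
    (u ++ v)[u.length + i]? = v[i]? := by
  rw [List.getElem?_append_right (by omega), Nat.add_sub_cancel_left]

variable {ω : ℕ → Fin d}

theorem nil_mem_strictWords : [] ∈ strictWords ω := fun k hk => by simp at hk

/-- The comparison of each suffix with ω is decided inside the word, so whatever follows is
irrelevant. Strict words thus form a free source of concatenations. -/
theorem append_mem_strictWords {u v : List (Fin d)} (hu : u ∈ strictWords ω)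
    (hv : v ∈ strictWords ω) : u ++ v ∈ strictWords ω := by
  intro k hk
  by_cases hku : k < u.length
  · obtain ⟨n, c, h1, h2, h3⟩ := hu k hku
    exact ⟨n, c, getElem?_append_of_some h1, h2, fun i hi => getElem?_append_of_some (h3 i hi)⟩
  · obtain ⟨k, rfl⟩ := Nat.exists_eq_add_of_le (not_lt.1 hku)
    obtain ⟨n, c, h1, h2, h3⟩ := hv k (by simpa using hk)
    refine ⟨n, c, ?_, h2, fun i hi => ?_⟩
    · rw [add_assoc, getElem?_append_length_add, h1]
    · rw [add_assoc, getElem?_append_length_add, h3 i hi]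

/-- The sequence that starts with the word `u` and continues with `x`. -/
def prepend (u : List (Fin d)) (x : ℕ → Fin d) (i : ℕ) : Fin d := (u[i]?).getD (x (i - u.length))

theorem prepend_eq {u : List (Fin d)} {x : ℕ → Fin d} {i : ℕ} {c : Fin d} (h : u[i]? = some c) :
    prepend u x i = c := by simp [prepend, h]

theorem prepend_length_add (u : List (Fin d)) (x : ℕ → Fin d) (i : ℕ) :
    prepend u x (u.length + i) = x i := by simp [prepend]

/-- The strict words that are empty or have a nonzero letter among their last `T + 1` letters. -/
def lexCore (ω : ℕ → Fin d) (T : ℕ) : Set (List (Fin d)) := strictWords ω ∩ nearNonzero d T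

namespace IsLexShift

variable (h : IsLexShift X ω)
include h

theorem lt_or_eq {x : ℕ → Fin d} (hx : x ∈ X.carrier) (k m : ℕ) :
    (∀ i < m, x (k + i) = ω i) ∨ ∃ n < m, x (k + n) < ω n ∧ ∀ i < n, x (k + i) = ω i := by
  induction m with
  | zero => left; intro i hi; omega
  | succ m ih =>
    rcases ih with ih | ⟨n, hn, h1, h2⟩
    · rcases (((h.mem_iff x).1 hx) k m ih).lt_or_eq with hlt | heq
      · exact Or.inr ⟨m, by omega, hlt, ih⟩
      · left
        intro i hi
        rcases Nat.lt_succ_iff_lt_or_eq.1 hi with hi | rfl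
        · exact ih i hi
        · exact heq
    · exact Or.inr ⟨n, by omega, h1, h2⟩

theorem prepend_mem {u : List (Fin d)} (hu : u ∈ strictWords ω) {x : ℕ → Fin d}
    (hx : x ∈ X.carrier) : prepend u x ∈ X.carrier := by
  rw [h.mem_iff]
  intro k n hn
  by_cases hk : k < u.length
  · obtain ⟨m, c, h1, h2, h3⟩ := hu k hk
    rcases lt_trichotomy n m with hnm | rfl | hnm
    · rw [prepend_eq (h3 n hnm)]
    · rw [prepend_eq h1]; exact h2.le
    · have := hn m hnm
      rw [prepend_eq h1] at this
      exact absurd this h2.ne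
  · obtain ⟨k, rfl⟩ := Nat.exists_eq_add_of_le (not_lt.1 hk)
    simp only [add_assoc, prepend_length_add] at hn ⊢
    exact (h.mem_iff x).1 hx k n hn

theorem exists_mem_cyl {u : List (Fin d)} (hu : u ∈ strictWords ω) :
    ∃ x ∈ cyl X u, ∀ i, x.1 (u.length + i) = ω i := by
  refine ⟨⟨_, h.prepend_mem hu h.self_mem⟩, mem_cyl_iff.2 fun i hi => ?_, prepend_length_add u ω⟩
  exact prepend_eq (List.getElem?_eq_getElem hi)

theorem strictWords_subset : strictWords ω ⊆ language X := fun _ hu =>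
  let ⟨x, hx, _⟩ := h.exists_mem_cyl hu
  ⟨x, hx⟩

theorem initialWord_mem_language (m : ℕ) : initialWord ω m ∈ language X :=
  ⟨⟨ω, h.self_mem⟩, mem_cyl_initialWord.2 fun _ _ => rfl⟩

theorem replicate_mem_strictWords (k : ℕ) : List.replicate k 0 ∈ strictWords ω := by
  intro j hj
  rw [List.length_replicate] at hj
  exact ⟨0, 0, by simp [hj], Fin.pos_iff_ne_zero.2 h.zero_ne, fun i hi => by omega⟩

/-- If the suffix from k agrees with ω up to the last letter, then c < ω_n ≤ ω_{n-k}, since shifts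
of ω do not exceed ω; otherwise it is already strictly below. -/
theorem initialWord_append_mem_strictWords {n : ℕ} {c : Fin d} (hc : c < ω n) :
    initialWord ω n ++ [c] ∈ strictWords ω := by
  intro k hk
  simp only [List.length_append, length_initialWord, List.length_singleton] at hk
  rcases h.lt_or_eq h.self_mem k (n - k) with heq | ⟨m, hm, h1, h2⟩
  · refine ⟨n - k, c, ?_, ?_, fun i hi => ?_⟩
    · have := getElem?_append_length_add (initialWord ω n) [c] 0
      rw [length_initialWord, add_zero] at this
      rw [Nat.add_sub_cancel' (by omega), this]
      rfl
    · have := (h.mem_iff ω).1 h.self_mem k (n - k) heq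
      rw [Nat.add_sub_cancel' (by omega)] at this
      exact hc.trans_le this
    · rw [getElem?_append_of_some (getElem?_initialWord ω (by omega)), heq i hi]
  · refine ⟨m, ω (k + m), getElem?_append_of_some (getElem?_initialWord ω (by omega)), h1,
      fun i hi => ?_⟩
    rw [getElem?_append_of_some (getElem?_initialWord ω (by omega)), h2 i hi]

/-- A suffix that copies ω up to the end of the initial word drops below ω at the next nonzero
letter of ω, where the appended zeros must reach. -/
theorem initialWord_append_zeros_mem_strictWords {m t : ℕ}
    (ht : ∀ j ≤ m, ∃ n < t, ω (j + n) ≠ 0) :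
    initialWord ω m ++ List.replicate t 0 ∈ strictWords ω := by
  intro k hk
  have hz : ∀ i < t, (initialWord ω m ++ List.replicate t 0)[m + i]? = some 0 := by
    intro i hi
    have := getElem?_append_length_add (initialWord ω m) (List.replicate t 0) i
    rw [length_initialWord] at this
    rw [this]; simp [hi]
  by_cases hkm : m < k
  · simp only [List.length_append, length_initialWord, List.length_replicate] at hk
    obtain ⟨k, rfl⟩ := Nat.exists_eq_add_of_le hkm.le
    exact ⟨0, 0, hz k (by omega), Fin.pos_iff_ne_zero.2 h.zero_ne, fun i hi => by omega⟩
  · rcases h.lt_or_eq h.self_mem k (m - k) with heq | ⟨n, hn, h1, h2⟩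
    · obtain ⟨n, hn, hne⟩ := ht (m - k) (by omega)
      obtain ⟨n', hn', hz', hne'⟩ := exists_first_ne_zero (x := fun i => ω (m - k + i)) hne
      refine ⟨m - k + n', 0, ?_, Fin.pos_iff_ne_zero.2 hne', fun i hi => ?_⟩
      · rw [← add_assoc, Nat.add_sub_cancel' (by omega)]
        exact hz n' (by omega)
      · by_cases him : i < m - k
        · rw [getElem?_append_of_some (getElem?_initialWord ω (by omega)), heq i him]
        · obtain ⟨i, rfl⟩ := Nat.exists_eq_add_of_le (not_lt.1 him)
          rw [← add_assoc, Nat.add_sub_cancel' (by omega), hz i (by omega), hz' i (by omega)]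
    · refine ⟨n, ω (k + n), getElem?_append_of_some (getElem?_initialWord ω (by omega)), h1,
        fun i hi => ?_⟩
      rw [getElem?_append_of_some (getElem?_initialWord ω (by omega)), h2 i hi]

/-- Every word is a strict word followed by an initial word of `ω`. -/
theorem exists_eq_append_initialWord {u : List (Fin d)} (hu : u ∈ language X) :
    ∃ v ∈ strictWords ω, ∃ m, u = v ++ initialWord ω m := by
  classical
  obtain ⟨x, hx⟩ := hu
  have hxu := mem_cyl_iff_getElem?.1 hx
  -- The least such k marks the longest suffix of u that is an initial word of ω.
  have hex : ∃ k, k ≤ u.length ∧ ∀ i, k + i < u.length → x.1 (k + i) = ω i :=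
    ⟨u.length, le_rfl, fun i hi => by omega⟩
  obtain ⟨k, ⟨hk, hki⟩, hmin⟩ : ∃ k, (k ≤ u.length ∧ ∀ i, k + i < u.length → x.1 (k + i) = ω i) ∧
      ∀ j < k, ¬ (j ≤ u.length ∧ ∀ i, j + i < u.length → x.1 (j + i) = ω i) :=
    ⟨Nat.find hex, Nat.find_spec hex, fun j => Nat.find_min hex⟩
  have htake : ∀ i < k, (u.take k)[i]? = some (x.1 i) := fun i hi => by
    rw [List.getElem?_take_of_lt hi, hxu i (by omega)]
  refine ⟨u.take k, fun j hj => ?_, u.length - k, ?_⟩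
  · rw [List.length_take, min_eq_left hk] at hj
    rcases h.lt_or_eq x.2 j (u.length - j) with heq | ⟨n, hn, h1, h2⟩
    · exact absurd ⟨by omega, fun i hi => heq i (by omega)⟩ (hmin j hj)
    -- If the suffix from j first dropped below ω beyond k, then the initial word at k would lie
    -- strictly below the shift of ω by k - j at the first difference, against the maximality of ω.
    · have hnk : j + n < k := by
        by_contra! hle
        obtain ⟨e, rfl⟩ := Nat.exists_eq_add_of_le hj.le
        obtain ⟨n, rfl⟩ := Nat.exists_eq_add_of_le (show e ≤ n by omega)
        have h3 := (h.mem_iff ω).1 h.self_mem e n fun i hi => by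
          rw [← hki i (by omega), ← h2 (e + i) (by omega), add_assoc]
        rw [← hki n (by omega), add_assoc] at h3
        exact absurd h1 (not_lt.2 h3)
      exact ⟨n, _, htake _ hnk, h1, fun i hi => by rw [htake _ (by omega), h2 i hi]⟩
  · refine List.ext_getElem? fun i => ?_
    by_cases hi : i < u.length
    · by_cases hik : i < k
      · rw [getElem?_append_of_some (htake i hik), hxu i hi]
      · obtain ⟨i, rfl⟩ := Nat.exists_eq_add_of_le (not_lt.1 hik)
        have := getElem?_append_length_add (u.take k) (initialWord ω (u.length - k)) i
        rw [List.length_take, min_eq_left hk] at this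
        rw [this, getElem?_initialWord ω (by omega), hxu _ hi, hki i hi]
    · rw [List.getElem?_eq_none (by omega), List.getElem?_eq_none]
      simp; omega

theorem exists_gap (M : ℕ) : ∃ t, ∀ j ≤ M, ∃ n < t, ω (j + n) ≠ 0 := by
  choose f hf using h.frequently_ne
  refine ⟨(Finset.range (M + 1)).sup f + 1, fun j hj => ⟨f j, ?_, hf j⟩⟩
  exact Nat.lt_succ_of_le (Finset.le_sup (f := f) (Finset.mem_range.2 (by omega)))

/-! ### The decomposition -/

/-- Once padded with 0^t the words concatenate freely, so the gap 0^t always works and the glued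
word can also be repeated. -/
theorem hasPerSpecificationOn {D : Set (List (Fin d))} {t : ℕ}
    (hD : ∀ w ∈ D, w ++ List.replicate t 0 ∈ strictWords ω) : HasPerSpecificationOn X D t := by
  have : Nonempty X.carrier := ⟨⟨ω, h.self_mem⟩⟩
  intro m w hw
  have hglue : ∀ (m : ℕ) (w : Fin (m + 1) → List (Fin d)), (∀ i, w i ∈ D) →
      glue w (fun _ => List.replicate t 0) ++ List.replicate t 0 ∈ strictWords ω := by
    intro m
    induction m with
    | zero => intro w hw; rw [glue_zero]; exact hD _ (hw 0)
    | succ m ih =>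
      intro w hw
      rw [glue_succ, ← List.append_assoc, List.append_assoc (w 0 ++ _)]
      exact append_mem_strictWords (hD _ (hw 0)) (ih _ fun i => hw _)
  have hz := hglue m w hw
  refine ⟨fun _ => List.replicate t 0, fun _ => ⟨h.strictWords_subset
    (h.replicate_mem_strictWords t), List.length_replicate⟩,
    language_append_left (h.strictWords_subset hz), ?_⟩
  have hk : ∀ k, (List.replicate k
      (glue w (fun _ => List.replicate t 0) ++ List.replicate t 0)).flatten ∈ strictWords ω := by
    intro k
    induction k with
    | zero => exact nil_mem_strictWords
    | succ k ih =>
      rw [List.replicate_succ, List.flatten_cons]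
      exact append_mem_strictWords hz ih
  obtain ⟨x, hx, hper⟩ := exists_isPeriodicPt fun k => h.strictWords_subset (hk k)
  refine ⟨x, (mem_cyl_append.1 hx).1, ?_⟩
  simpa using hper

end IsLexShift

end Thermo

end

noncomputable section

namespace Thermo

variable {d : ℕ} [NeZero d] {X : Subshift (Fin d) ℕ} {φ φr : X.carrier → ℝ} {a : ℕ → ℝ}
  {ω : ℕ → Fin d}

/-! ### Comparing sums along points that differ at one letter -/

theorem leadingZeroPotential_congr_of_ne {x y : X.carrier} {j : ℕ} (h : ∀ i < j, x.1 i = y.1 i)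
    (hx : x.1 j ≠ 0) (hy : y.1 j ≠ 0) :
    leadingZeroPotential X a x = leadingZeroPotential X a y := by
  obtain ⟨n, hn, h0, hne⟩ := exists_first_ne_zero hx
  rw [leadingZeroPotential_eq h0 hne]
  refine (leadingZeroPotential_eq (fun i hi => (h i (by omega)) ▸ h0 i hi) ?_).symm
  rcases hn.lt_or_eq with hlt | rfl
  · exact h n hlt ▸ hne
  · exact hy

/-- If p - 1 zeros immediately precede position n, their run and position n contribute a_{p-1} + ⋯ +
a_0 for x and a_p + ⋯ + a_1 for y, and earlier terms agree. The difference telescopes, so unbounded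
partial sums do no harm. The second clause, which identifies p when all letters before n vanish,
feeds the induction. -/
theorem birkhoffSum_leadingZeroPotential_sub (n : ℕ) (x y : X.carrier)
    (h : ∀ i < n, x.1 i = y.1 i) (hx : x.1 n ≠ 0) (hy : y.1 n = 0) (hy' : y.1 (n + 1) ≠ 0) :
    ∃ p, birkhoffSum (shiftMap X) (leadingZeroPotential X a) (n + 1) x -
        birkhoffSum (shiftMap X) (leadingZeroPotential X a) (n + 1) y = a 0 - a p ∧
      ((∀ i < n, x.1 i = 0) → p = n + 1) := by
  induction n generalizing x y with
  | zero =>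
    refine ⟨1, ?_, fun _ => rfl⟩
    rw [zero_add, birkhoffSum_one, birkhoffSum_one,
      leadingZeroPotential_eq (n := 0) (fun i hi => by omega) hx,
      leadingZeroPotential_eq (n := 1) (fun i hi => by rwa [show i = 0 by omega]) hy']
  | succ n ih =>
    obtain ⟨p, hp, hp'⟩ := ih (shiftMap X x) (shiftMap X y)
      (fun i hi => by rw [shiftMap_apply, shiftMap_apply]; exact h _ (by omega))
      (by rwa [shiftMap_apply, add_comm]) (by rwa [shiftMap_apply, add_comm])
      (by rwa [shiftMap_apply, add_comm])
    rw [birkhoffSum_succ', birkhoffSum_succ' _ _ (n + 1) y]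
    by_cases hz : ∀ i < n + 1, x.1 i = 0
    · refine ⟨n + 2, ?_, fun _ => rfl⟩
      have hpn := hp' fun i hi => hz _ (by omega)
      rw [hpn] at hp
      rw [leadingZeroPotential_eq hz hx, leadingZeroPotential_eq (n := n + 2) (fun i hi => ?_) hy']
      · linarith
      · rcases Nat.lt_succ_iff_lt_or_eq.1 hi with hi | rfl
        · rw [← h i hi, hz i hi]
        · exact hy
    · refine ⟨p, ?_, fun hz' => absurd hz' hz⟩
      push Not at hz
      obtain ⟨i, hi, hne⟩ := hz
      rw [leadingZeroPotential_congr (x := x) (y := y) (j := i) (fun m hm => h m (by omega)) hne]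
      linarith

theorem abs_birkhoffSum_leadingZeroPotential_sub_le {A : ℝ} (hA : ∀ n, |a n| ≤ A) {n : ℕ}
    {x y : X.carrier} (h : ∀ i < n, x.1 i = y.1 i) (hx : x.1 n ≠ 0)
    (hy : y.1 (n + 1) ≠ 0) :
    |birkhoffSum (shiftMap X) (leadingZeroPotential X a) (n + 1) x -
      birkhoffSum (shiftMap X) (leadingZeroPotential X a) (n + 1) y| ≤ 2 * A := by
  have hA0 : 0 ≤ A := (abs_nonneg _).trans (hA 0)
  by_cases hyn : y.1 n = 0
  · obtain ⟨p, hp, -⟩ := birkhoffSum_leadingZeroPotential_sub (a := a) n x y h hx hyn hy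
    have h1 := abs_le.1 (hA 0)
    have h2 := abs_le.1 (hA p)
    rw [hp, abs_le]
    constructor <;> linarith
  · rw [birkhoffSum, birkhoffSum, Finset.sum_congr rfl fun i hi => ?_, sub_self, abs_zero]
    · positivity
    · have hin : i ≤ n := by rw [Finset.mem_range] at hi; omega
      refine leadingZeroPotential_congr_of_ne (j := n - i) (fun m hm => ?_) ?_ ?_
      · rw [iterate_shiftMap_apply, iterate_shiftMap_apply, h _ (by omega)]
      · rwa [iterate_shiftMap_apply, Nat.add_sub_cancel' hin]
      · rwa [iterate_shiftMap_apply, Nat.add_sub_cancel' hin]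

/-- The initial word of `ω` of length `n + 1` with its last letter lowered by one. -/
def loopWord (ω : ℕ → Fin d) (n : ℕ) : List (Fin d) :=
  initialWord ω n ++ [⟨(ω n).1 - 1, by omega⟩]

@[simp] theorem length_loopWord (n : ℕ) : (loopWord ω n).length = n + 1 := by simp [loopWord]

theorem getElem?_loopWord_of_lt {n i : ℕ} (hi : i < n) : (loopWord ω n)[i]? = some (ω i) :=
  getElem?_append_of_some (getElem?_initialWord ω hi)

theorem getElem?_loopWord_self {n : ℕ} (hn : ω n ≠ 0) :
    ∃ c, (loopWord ω n)[n]? = some c ∧ c < ω n := by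
  have h1 := getElem?_append_length_add (initialWord ω n) [⟨(ω n).1 - 1, by omega⟩] 0
  rw [length_initialWord, add_zero] at h1
  refine ⟨_, h1.trans rfl, ?_⟩
  have := Fin.pos_iff_ne_zero.2 hn
  rw [Fin.lt_def] at this ⊢
  simp only [Fin.val_zero] at this
  change (ω n).1 - 1 < _
  omega

/-- Loop words form a prefix code: for n < m they differ at position n, where one has a letter below
ω_n and the other ω_n itself. -/
theorem eq_of_flatMap_loopWord_eq {l l' : List ℕ} (hl : ∀ n ∈ l, ω n ≠ 0)
    (hl' : ∀ n ∈ l', ω n ≠ 0) (hlen : l.length = l'.length)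
    (h : l.flatMap (loopWord ω) = l'.flatMap (loopWord ω)) : l = l' := by
  have key : ∀ {n m : ℕ} {u v : List (Fin d)}, ω n ≠ 0 → n < m →
      loopWord ω n ++ u ≠ loopWord ω m ++ v := by
    intro n m u v hn hnm heq
    obtain ⟨c, hc, hlt⟩ := getElem?_loopWord_self hn
    have h1 := congrArg (fun l => l[n]?) heq
    simp only [getElem?_append_of_some hc,
      getElem?_append_of_some (getElem?_loopWord_of_lt hnm), Option.some_inj] at h1
    exact hlt.ne h1
  induction l generalizing l' with
  | nil => exact (List.length_eq_zero_iff.1 hlen.symm).symm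
  | cons n l ih =>
    rcases l' with _ | ⟨m, l'⟩
    · simp at hlen
    · rw [List.flatMap_cons, List.flatMap_cons] at h
      have hnm : n = m := by
        rcases lt_trichotomy n m with hlt | heq | hlt
        · exact absurd h (key (hl n (by simp)) hlt)
        · exact heq
        · exact absurd h.symm (key (hl' m (by simp)) hlt)
      subst hnm
      rw [ih (fun k hk => hl k (by simp [hk])) (fun k hk => hl' k (by simp [hk]))
        (by simpa using hlen) (List.append_cancel_left h)]

namespace IsLexShift

variable (h : IsLexShift X ω)
include h

theorem loopWord_mem_strictWords {n : ℕ} (hn : ω n ≠ 0) : loopWord ω n ∈ strictWords ω := by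
  refine h.initialWord_append_mem_strictWords ?_
  have := Fin.pos_iff_ne_zero.2 hn
  rw [Fin.lt_def] at this ⊢
  simp only [Fin.val_zero] at this
  change (ω n).1 - 1 < _
  omega

/-- Lowering the last letter costs 2A for the leading-zero part by telescoping, V for φ_r on the n
common letters and 2B for its last term. The next letter of y must be nonzero, as a lowered letter 0
could otherwise merge with a long run of zeros. -/
theorem exists_wordSup_sub_le (hφc : Continuous φ) (hrc : Continuous φr)
    (hbowen : HasBowenProperty X φr) (ha : Tendsto a atTop (𝓝 0))
    (hφ : ∀ x, φ x = φr x + leadingZeroPotential X a x) :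
    ∃ C, ∀ n, ω n ≠ 0 → ∀ y ∈ cyl X (loopWord ω n), y.1 (n + 1) ≠ 0 →
      wordSup X φ (initialWord ω (n + 1)) - C ≤ birkhoffSum (shiftMap X) φ (n + 1) y := by
  obtain ⟨A, -, hA⟩ := exists_abs_le_of_tendsto ha
  obtain ⟨B, -, hB⟩ := exists_abs_le hrc
  obtain ⟨V, hV⟩ := hbowen
  refine ⟨2 * A + V + 2 * B, fun n hn y hy hyn => ?_⟩
  obtain ⟨x, hx, hs⟩ := exists_birkhoffSum_eq_wordSup hφc (h.initialWord_mem_language (n + 1))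
  rw [mem_cyl_initialWord] at hx
  have hy1 : y ∈ cyl X (initialWord ω n) := (mem_cyl_append.1 hy).1
  have hx1 : x ∈ cyl X (initialWord ω n) :=
    mem_cyl_initialWord.2 fun i hi => hx i (by omega)
  have h1 := hV _ ⟨x, hx1⟩ x hx1 y hy1
  rw [length_initialWord] at h1
  rw [mem_cyl_initialWord] at hy1
  have h2 := abs_birkhoffSum_leadingZeroPotential_sub_le (x := x) (y := y) (n := n) hA
    (fun i hi => by rw [hx i (by omega), hy1 i hi]) (by rwa [hx n (by omega)]) hyn
  have h3 := abs_le.1 (hB ((shiftMap X)^[n] x))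
  have h4 := abs_le.1 (hB ((shiftMap X)^[n] y))
  have hsum : ∀ z, birkhoffSum (shiftMap X) φ (n + 1) z = birkhoffSum (shiftMap X) φr n z +
      φr ((shiftMap X)^[n] z) +
        birkhoffSum (shiftMap X) (leadingZeroPotential X a) (n + 1) z := by
    intro z
    rw [← birkhoffSum_succ]
    simp only [birkhoffSum, hφ, Finset.sum_add_distrib]
  rw [hs, length_initialWord, hsum, hsum]
  rw [abs_le] at h1 h2
  linarith

/-- For n ≠ 0 a loop word begins with ω_0 ≠ 0, whereas the loop word for n = 0 may be the letter 0.
This supplies the nonzero next letter at each junction of loop words. -/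
theorem first_ne_zero {l : List ℕ} (hl : ∀ n ∈ l, n ≠ 0) {x : X.carrier}
    (hx : x ∈ cyl X (l.flatMap (loopWord ω)))
    (hne : x.1 (l.flatMap (loopWord ω)).length ≠ 0) : x.1 0 ≠ 0 := by
  rcases l with _ | ⟨n, l⟩
  · simpa using hne
  · rw [List.flatMap_cons, mem_cyl_append, mem_cyl_iff_getElem?] at hx
    have h1 := hx.1 0 (by simp)
    rw [getElem?_loopWord_of_lt (Nat.pos_of_ne_zero (hl n (by simp))), Option.some_inj] at h1
    rw [← h1]
    exact h.zero_ne

theorem sum_le_birkhoffSum {C : ℝ} {l : List ℕ} (hl : ∀ n ∈ l, n ≠ 0 ∧ ω n ≠ 0)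
    (hC : ∀ n, ω n ≠ 0 → ∀ y ∈ cyl X (loopWord ω n), y.1 (n + 1) ≠ 0 →
      wordSup X φ (initialWord ω (n + 1)) - C ≤ birkhoffSum (shiftMap X) φ (n + 1) y)
    {x : X.carrier} (hx : x ∈ cyl X (l.flatMap (loopWord ω)))
    (hne : x.1 (l.flatMap (loopWord ω)).length ≠ 0) :
    (l.map fun n => wordSup X φ (initialWord ω (n + 1)) - C).sum ≤
      birkhoffSum (shiftMap X) φ (l.flatMap (loopWord ω)).length x := by
  induction l generalizing x with
  | nil => simp
  | cons n l ih =>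
    rw [List.flatMap_cons, mem_cyl_append] at hx
    rw [List.flatMap_cons, List.length_append] at hne
    have hne' : ((shiftMap X)^[n + 1] x).1 (l.flatMap (loopWord ω)).length ≠ 0 := by
      rwa [iterate_shiftMap_apply, ← length_loopWord (ω := ω) n]
    rw [length_loopWord] at hx
    have hl' : ∀ m ∈ l, m ≠ 0 ∧ ω m ≠ 0 := fun m hm => hl m (by simp [hm])
    have h1 := h.first_ne_zero (fun m hm => (hl' m hm).1) hx.2 hne'
    rw [iterate_shiftMap_apply] at h1
    rw [List.flatMap_cons, List.length_append, length_loopWord, birkhoffSum_add, List.map_cons,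
      List.sum_cons]
    exact add_le_add (hC n (hl n (by simp)).2 x hx.1 h1) (ih hl' hx.2 hne')

theorem flatMap_loopWord_mem_strictWords {l : List ℕ} (hl : ∀ n ∈ l, ω n ≠ 0) :
    l.flatMap (loopWord ω) ∈ strictWords ω := by
  induction l with
  | nil => exact nil_mem_strictWords
  | cons n l ih =>
    rw [List.flatMap_cons]
    exact append_mem_strictWords (h.loopWord_mem_strictWords (hl n (by simp)))
      (ih fun m hm => hl m (by simp [hm]))

/-- Kraft's inequality for the code of loop words, each valued at φ_{n+1} of the initial word of
length n + 1 minus the cost C. Every finite sum of weights is then at most e^C. -/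
theorem sum_weight_initialWord_ne_top (hφc : Continuous φ) (hrc : Continuous φr)
    (hbowen : HasBowenProperty X φr) (ha : Tendsto a atTop (𝓝 0))
    (hφ : ∀ x, φ x = φr x + leadingZeroPotential X a x) :
    ∑' n : {n // n ≠ 0 ∧ ω n ≠ 0}, weight X φ (initialWord ω (n + 1)) ≠ ⊤ := by
  have : Nonempty X.carrier := ⟨⟨ω, h.self_mem⟩⟩
  obtain ⟨C, hC⟩ := h.exists_wordSup_sub_le hφc hrc hbowen ha hφ
  refine ne_top_of_le_ne_top (ENNReal.ofReal_ne_top (r := Real.exp C)) ?_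
  refine ENNReal.summable.tsum_le_of_sum_le fun S => ?_
  have hval : ∀ {k} (i : Fin k → S), ∀ n ∈ List.ofFn (fun j => (i j).1.1), n ≠ 0 ∧ ω n ≠ 0 := by
    intro k i n hn
    obtain ⟨j, rfl⟩ := List.mem_ofFn.1 hn
    exact (i j).1.2
  have hlen : ∀ l : List ℕ, (l.flatMap (loopWord ω)).length = (l.map (· + 1)).sum := by
    intro l; simp [List.length_flatMap]
  have key := sum_exp_le_one (X := X) hφc (I := S) (fun n => n.1.1 + 1)
    (fun n => wordSup X φ (initialWord ω (n.1.1 + 1)) - C)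
    (fun k i => (List.ofFn fun j => (i j).1.1).flatMap (loopWord ω))
    (fun k i i' hii => ?_)
    (fun k i => h.strictWords_subset
      (h.flatMap_loopWord_mem_strictWords fun n hn => (hval i n hn).2))
    (fun k i => ?_) (fun k i => ?_)
  · rw [← Finset.sum_coe_sort]
    calc _ = ∑ n : S, ENNReal.ofReal (Real.exp C) * ENNReal.ofReal (Real.exp
          (wordSup X φ (initialWord ω (n.1.1 + 1)) - C - (n.1.1 + 1 : ℕ) * pressure X φ)) := by
          refine Finset.sum_congr rfl fun n _ => ?_
          rw [weight_of_mem (h.initialWord_mem_language _), ← ENNReal.ofReal_mul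
            (Real.exp_pos _).le, ← Real.exp_add, length_initialWord]
          congr 2; ring
      _ ≤ ENNReal.ofReal (Real.exp C) * 1 := by
          rw [← Finset.mul_sum, ← ENNReal.ofReal_sum_of_nonneg fun _ _ => (Real.exp_pos _).le]
          gcongr
          rw [← ENNReal.ofReal_one]
          exact ENNReal.ofReal_le_ofReal key
      _ = _ := mul_one _
  · have := eq_of_flatMap_loopWord_eq (fun n hn => (hval i n hn).2)
      (fun n hn => (hval i' n hn).2) (by simp) hii
    have h2 := List.ofFn_injective this
    funext j
    exact Subtype.ext (Subtype.ext (congrFun h2 j))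
  · rw [hlen, List.map_ofFn, List.sum_ofFn]; rfl
  -- The concatenation is continued by ω, whose first letter is nonzero, so the last loop word is
  -- also followed by a nonzero letter.
  · obtain ⟨x, hx, hxω⟩ := h.exists_mem_cyl
      (h.flatMap_loopWord_mem_strictWords fun n hn => (hval i n hn).2)
    have h1 := h.sum_le_birkhoffSum (hval i) hC hx
      (by have := hxω 0; rw [add_zero] at this; rw [this]; exact h.zero_ne)
    rw [List.map_ofFn, List.sum_ofFn] at h1
    exact h1.trans (birkhoffSum_le_wordSup hφc hx)

/-! ### The total weight of the suffixes -/

/-- Stripping its trailing zeros leaves an initial word that is empty or ends in a nonzero letter,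
so the total is at most a product of two finite weights. -/
theorem totalWeight_initialWords_ne_top (hφc : Continuous φ) (hrc : Continuous φr)
    (hbowen : HasBowenProperty X φr) (ha : Tendsto a atTop (𝓝 0))
    (hφ : ∀ x, φ x = φr x + leadingZeroPotential X a x) (h0 : (0 : ℕ → Fin d) ∈ X.carrier)
    (hP : φ ⟨0, h0⟩ < pressure X φ) : totalWeight X φ (Set.range (initialWord ω)) ≠ ⊤ := by
  set Z := Set.range fun k => List.replicate k (0 : Fin d)
  -- The lengths 0 and 1 are added by hand, because the Kraft argument excludes n = 0.
  set Q := {[], initialWord ω 1} ∪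
    Set.range fun n : {n // n ≠ 0 ∧ ω n ≠ 0} => initialWord ω (n + 1)
  have hZ := totalWeight_zeros_ne_top hφc h0 hP
  have hQ : totalWeight X φ Q ≠ ⊤ := by
    refine ne_top_of_le_ne_top ?_ (totalWeight_union_le _ _)
    refine ENNReal.add_ne_top.2 ⟨ne_top_of_le_ne_top ?_ (totalWeight_union_le {[]} _),
      ne_top_of_le_ne_top (h.sum_weight_initialWord_ne_top hφc hrc hbowen ha hφ)
        (totalWeight_range_le _)⟩
    rw [totalWeight_singleton, totalWeight_singleton]
    exact ENNReal.add_ne_top.2 ⟨weight_ne_top _, weight_ne_top _⟩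
  refine ne_top_of_le_ne_top (ENNReal.mul_ne_top hZ hQ) (totalWeight_le_mul hφc ?_)
  have hsucc : ∀ m, initialWord ω (m + 1) = initialWord ω m ++ [ω m] := fun m => by
    rw [initialWord, List.ofFn_succ_last]; rfl
  have hmem : ∀ m, ∃ s ∈ Z, ∃ v ∈ Q, initialWord ω m = v ++ s := by
    intro m
    induction m with
    | zero => exact ⟨[], ⟨0, rfl⟩, [], Or.inl (Or.inl rfl), by simp [initialWord]⟩
    | succ m ih =>
      by_cases hm : ω m = 0
      · obtain ⟨_, ⟨k, rfl⟩, v, hv, hmv⟩ := ih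
        refine ⟨_, ⟨k + 1, rfl⟩, v, hv, ?_⟩
        simp only [hsucc, hmv, hm, List.replicate_succ', List.append_assoc]
      · refine ⟨[], ⟨0, rfl⟩, initialWord ω (m + 1), ?_, by simp⟩
        rcases eq_or_ne m 0 with rfl | hm0
        · exact Or.inl (Or.inr rfl)
        · exact Or.inr ⟨⟨m, hm0, hm⟩, rfl⟩
  rintro _ ⟨m, rfl⟩ -
  exact hmem m

end IsLexShift

end Thermo

end

/-! ### Suffixes of the decomposition for lexicographic shifts, expansions of one, and the
conclusion. -/

noncomputable section

namespace Thermo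

variable {d : ℕ} [NeZero d] {X : Subshift (Fin d) ℕ} {φ φr : X.carrier → ℝ} {a : ℕ → ℝ}
  {ω : ℕ → Fin d}

/-- The words of the language without a nonempty prefix in the core. -/
def lexSuffix (X : Subshift (Fin d) ℕ) (ω : ℕ → Fin d) (T : ℕ) : Set (List (Fin d)) :=
  {s | s ∈ language X ∧ ∀ p q, s = p ++ q → p ∈ lexCore ω T → p = []}

theorem append_mem_lexCore {T : ℕ} {u v : List (Fin d)} (hu : u ∈ strictWords ω)
    (hv : v ∈ lexCore ω T) (hne : v ≠ []) : u ++ v ∈ lexCore ω T :=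
  ⟨append_mem_strictWords hu hv.1, append_mem_nearNonzero hv.2 hne⟩

theorem exists_eq_replicate_append (z : List (Fin d)) :
    ∃ k s, z = List.replicate k 0 ++ s ∧ ∀ c ∈ s[0]?, c ≠ 0 := by
  induction z with
  | nil => exact ⟨0, [], rfl, by simp⟩
  | cons c z ih =>
    by_cases hc : c = 0
    · obtain ⟨k, s, rfl, hs⟩ := ih
      exact ⟨k + 1, s, by rw [hc, List.replicate_succ, List.cons_append], hs⟩
    · exact ⟨0, c :: z, rfl, by simpa using hc⟩

namespace IsLexShift

variable (h : IsLexShift X ω)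
include h

/-- Remove the longest prefix in the core: a further nonempty core prefix of the rest could be
appended to it, contradicting maximality. -/
theorem exists_decomposition (T : ℕ) {z : List (Fin d)} (hz : z ∈ language X) :
    ∃ v ∈ lexCore ω T, ∃ s ∈ lexSuffix X ω T, z = v ++ s := by
  classical
  have hex : ∃ k, k ≤ z.length ∧ z.take (z.length - k) ∈ lexCore ω T :=
    ⟨z.length, le_rfl, by simpa using ⟨nil_mem_strictWords, Or.inl rfl⟩⟩
  obtain ⟨k, ⟨hk, hcore⟩, hmin⟩ : ∃ k, (k ≤ z.length ∧ z.take (z.length - k) ∈ lexCore ω T) ∧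
      ∀ j < k, ¬ (j ≤ z.length ∧ z.take (z.length - j) ∈ lexCore ω T) :=
    ⟨Nat.find hex, Nat.find_spec hex, fun j => Nat.find_min hex⟩
  have hzs : z = z.take (z.length - k) ++ z.drop (z.length - k) := (List.take_append_drop _ _).symm
  refine ⟨_, hcore, _, ⟨language_append_right (hzs ▸ hz), fun p q hpq hp => ?_⟩, hzs⟩
  by_contra hne
  have hlen : p.length + q.length = k := by
    have := congrArg List.length hpq
    rw [List.length_drop, List.length_append] at this
    omega
  have hpos := List.length_pos_iff.2 hne
  refine hmin q.length (by omega) ⟨by omega, ?_⟩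
  have : z.take (z.length - q.length) = z.take (z.length - k) ++ p := by
    rw [show z.length - q.length = (z.length - k) + p.length by omega, List.take_add, hpq]
    simp
  rw [this]
  exact append_mem_lexCore hcore.1 hp hne

/-- After its leading zeros, s either copies ω to the end or first drops below ω at some n. In the
second case the prefix up to the drop is strict, so it must fail to have a nonzero letter near its
end; as ω_0 ≠ 0, the dropped letter is 0 and n > T. What remains is again a suffix of the same kind.
-/
theorem suffix_cases {T : ℕ} {s : List (Fin d)} (hs : s ∈ lexSuffix X ω T) :
    (∃ k m, s = List.replicate k 0 ++ initialWord ω m) ∨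
      ∃ k n, ∃ r ∈ lexSuffix X ω T, T < n ∧
        s = List.replicate k 0 ++ (initialWord ω n ++ [0]) ++ r := by
  obtain ⟨k, u, rfl, hu⟩ := exists_eq_replicate_append s
  obtain ⟨x, hx⟩ := language_append_right hs.1
  have hxu := mem_cyl_iff_getElem?.1 hx
  have hle := h.lt_or_eq x.2 0 u.length
  simp only [zero_add] at hle
  rcases hle with heq | ⟨n, hn, hlt, heq⟩
  · refine Or.inl ⟨k, u.length, ?_⟩
    congr 1
    exact eq_of_mem_cyl hx (mem_cyl_initialWord.2 heq) (length_initialWord _ _).symm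
  · right
    have hsplit : u = (initialWord ω n ++ [x.1 n]) ++ u.drop (n + 1) := by
      refine List.ext_getElem? fun i => ?_
      by_cases hi : i < n
      · rw [getElem?_append_of_some (getElem?_append_of_some (getElem?_initialWord ω hi)),
          hxu i (by omega), heq i hi]
      · obtain ⟨i, rfl⟩ := Nat.exists_eq_add_of_le (not_lt.1 hi)
        have h1 := getElem?_append_length_add (initialWord ω n) ([x.1 n] ++ u.drop (n + 1)) i
        rw [length_initialWord, ← List.append_assoc] at h1
        rw [h1]
        rcases i with _ | i
        · rw [add_zero, hxu n hn]; rfl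
        · rw [List.singleton_append, List.getElem?_cons_succ, List.getElem?_drop]
          congr 1; omega
    have hstrict : List.replicate k 0 ++ (initialWord ω n ++ [x.1 n]) ∈ strictWords ω :=
      append_mem_strictWords (h.replicate_mem_strictWords k)
        (h.initialWord_append_mem_strictWords hlt)
    have hnot : List.replicate k 0 ++ (initialWord ω n ++ [x.1 n]) ∉ nearNonzero d T := by
      intro hnear
      have h1 := hs.2 _ (u.drop (n + 1)) (by rw [List.append_assoc, ← hsplit]) ⟨hstrict, hnear⟩
      simp at h1
    have hxn : x.1 n = 0 := by
      by_contra hne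
      refine hnot (append_mem_nearNonzero (append_mem_nearNonzero (Or.inr ⟨0, by simp, by simp, ?_⟩)
        (by simp)) (by simp))
      simpa using hne
    rw [hxn] at hsplit hstrict hnot
    refine ⟨k, n, u.drop (n + 1), ⟨?_, fun p q hpq hp => ?_⟩, ?_, ?_⟩
    · rw [hsplit] at hx
      exact ⟨_, (mem_cyl_append.1 hx).2⟩
    · by_contra hne
      have h1 := hs.2 (List.replicate k 0 ++ (initialWord ω n ++ [0]) ++ p) q (by
        rw [List.append_assoc _ p q, ← hpq, List.append_assoc, ← hsplit])
        (append_mem_lexCore hstrict hp hne)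
      exact hne (List.append_eq_nil_iff.1 h1).2
    · by_contra! hnT
      have hn0 : 0 < n := by
        rcases Nat.eq_zero_or_pos n with rfl | hpos
        · exact absurd hxn (hu _ (hxu 0 hn))
        · exact hpos
      refine hnot (append_mem_nearNonzero (Or.inr ⟨0, by simp, by simp; omega, ?_⟩) (by simp))
      have h1 : (initialWord ω n ++ [0])[0]? = some (ω 0) :=
        getElem?_append_of_some (getElem?_initialWord ω hn0)
      rw [(List.getElem?_eq_some_iff.1 h1).2]
      exact h.zero_ne
    · rw [List.append_assoc, ← hsplit]

/-- The two cases of `suffix_cases` bound the weight of the suffixes by a finite constant plus a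
multiple of itself, and the multiple is at most 1/2 for T large. -/
theorem exists_totalWeight_lexSuffix_ne_top (hφc : Continuous φ) (hrc : Continuous φr)
    (hbowen : HasBowenProperty X φr) (ha : Tendsto a atTop (𝓝 0))
    (hφ : ∀ x, φ x = φr x + leadingZeroPotential X a x) (h0 : (0 : ℕ → Fin d) ∈ X.carrier)
    (hP : φ ⟨0, h0⟩ < pressure X φ) : ∃ T, totalWeight X φ (lexSuffix X ω T) ≠ ⊤ := by
  set Z := Set.range fun k => List.replicate k (0 : Fin d)
  set W := Set.range (initialWord ω)
  have hZ : totalWeight X φ Z ≠ ⊤ := totalWeight_zeros_ne_top hφc h0 hP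
  have hW : totalWeight X φ W ≠ ⊤ :=
    h.totalWeight_initialWords_ne_top hφc hrc hbowen ha hφ h0 hP
  -- The factor in the recursion involves only initial words of length at least T, a tail of a
  -- convergent series.
  obtain ⟨T, hT⟩ : ∃ T, weight X φ [0] * totalWeight X φ {w | w ∈ W ∧ T ≤ w.length} *
      totalWeight X φ Z ≤ 2⁻¹ := by
    have h1 := ENNReal.Tendsto.mul_const (ENNReal.Tendsto.const_mul (tendsto_totalWeight_long hW)
      (Or.inr (weight_ne_top (X := X) (φ := φ) [0]))) (Or.inr hZ)
    rw [mul_zero, zero_mul] at h1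
    exact (h1.eventually (Iic_mem_nhds (by simp))).exists
  refine ⟨T, ne_top_of_le_ne_top (ENNReal.mul_ne_top ENNReal.ofNat_ne_top
    (ENNReal.mul_ne_top hW hZ)) (totalWeight_le_of_short (C := 2 * _) fun N => ?_)⟩
  -- Truncation makes the weight finite, so that half of it can be subtracted; the resulting bound
  -- does not depend on N.
  set D := {w | w ∈ lexSuffix X ω T ∧ w.length < N}
  set H₁ := {z | ∃ k m, z = List.replicate k (0 : Fin d) ++ initialWord ω m}
  set U := {z | ∃ n, T ≤ n ∧ z = initialWord ω n ++ [0]}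
  set H₂ := {z | ∃ k, ∃ u ∈ U, z = List.replicate k (0 : Fin d) ++ u}
  set H₃ := {z | ∃ r ∈ D, ∃ v ∈ H₂, z = v ++ r}
  have hsub : D ⊆ H₁ ∪ H₃ := by
    rintro s ⟨hs, hlen⟩
    rcases h.suffix_cases hs with ⟨k, m, rfl⟩ | ⟨k, n, r, hr, hn, rfl⟩
    · exact Or.inl ⟨k, m, rfl⟩
    · refine Or.inr ⟨r, ⟨hr, ?_⟩, _, ⟨k, _, ⟨n, hn.le, rfl⟩, rfl⟩, rfl⟩
      rw [List.length_append] at hlen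
      omega
  have hH₁ : totalWeight X φ H₁ ≤ totalWeight X φ W * totalWeight X φ Z :=
    totalWeight_le_mul hφc fun z hz _ => by
      obtain ⟨k, m, rfl⟩ := hz
      exact ⟨_, ⟨m, rfl⟩, _, ⟨k, rfl⟩, rfl⟩
  have hU : totalWeight X φ U ≤
      weight X φ [0] * totalWeight X φ {w | w ∈ W ∧ T ≤ w.length} := by
    rw [← totalWeight_singleton]
    refine totalWeight_le_mul hφc fun z hz _ => ?_
    obtain ⟨n, hn, rfl⟩ := hz
    exact ⟨[0], rfl, _, ⟨⟨n, rfl⟩, by simpa using hn⟩, rfl⟩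
  have hH₂ : totalWeight X φ H₂ ≤ 2⁻¹ := by
    refine le_trans (totalWeight_le_mul hφc (E := U) (G := Z) fun z hz _ => ?_)
      (le_trans (mul_le_mul_left hU _) hT)
    obtain ⟨k, u, hu, rfl⟩ := hz
    exact ⟨u, hu, _, ⟨k, rfl⟩, rfl⟩
  have hH₃ : totalWeight X φ H₃ ≤ totalWeight X φ D * 2⁻¹ :=
    (totalWeight_le_mul hφc fun z hz _ => hz).trans (mul_le_mul_right hH₂ _)
  have hD : totalWeight X φ D ≠ ⊤ := totalWeight_short_ne_top _ _
  have hle : totalWeight X φ D ≤ totalWeight X φ W * totalWeight X φ Z + totalWeight X φ D / 2 :=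
    ((totalWeight_mono hsub).trans (totalWeight_union_le _ _)).trans (add_le_add hH₁ hH₃)
  have hhalf : totalWeight X φ D / 2 ≤ totalWeight X φ W * totalWeight X φ Z := by
    refine (ENNReal.add_le_add_iff_right (ENNReal.div_ne_top hD two_ne_zero)).1 ?_
    rwa [ENNReal.add_halves]
  calc totalWeight X φ D = totalWeight X φ D / 2 + totalWeight X φ D / 2 :=
        (ENNReal.add_halves _).symm
    _ ≤ _ := by rw [two_mul]; exact add_le_add hhalf hhalf

theorem exists_isAdaptedDecomposition (hφc : Continuous φ) (hrc : Continuous φr)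
    (hbowen : HasBowenProperty X φr) (ha : Tendsto a atTop (𝓝 0))
    (hφ : ∀ x, φ x = φr x + leadingZeroPotential X a x) (h0 : (0 : ℕ → Fin d) ∈ X.carrier)
    (hP : φ ⟨0, h0⟩ < pressure X φ) : ∃ G Cs, IsAdaptedDecomposition X φ {[]} G Cs := by
  have : Nonempty X.carrier := ⟨⟨0, h0⟩⟩
  obtain ⟨T, hT⟩ := h.exists_totalWeight_lexSuffix_ne_top hφc hrc hbowen ha hφ h0 hP
  have hcore : lexCore ω T ⊆ language X := fun u hu => h.strictWords_subset hu.1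
  have hsuf : lexSuffix X ω T ⊆ language X := fun s hs => hs.1
  refine ⟨lexCore ω T, lexSuffix X ω T, by simpa using nil_mem_language, hcore, hsuf,
    fun z hz => ?_, fun M => ?_, ?_, summable_of_totalWeight_ne_top hsuf hT⟩
  · obtain ⟨v, hv, s, hs, rfl⟩ := h.exists_decomposition T hz
    exact ⟨[], rfl, v, hv, s, hs, rfl⟩
  · obtain ⟨t, ht⟩ := h.exists_gap M
    refine ⟨t, h.hasPerSpecificationOn ?_⟩
    rintro _ ⟨-, u, rfl, v, hv, s, hs, -, hsM, rfl⟩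
    -- A suffix of length at most M ends in an initial word of ω of length at most M, so one number
    -- of zeros makes all words of G(M) strict.
    obtain ⟨s', hs', m, rfl⟩ := h.exists_eq_append_initialWord hs.1
    rw [List.length_append, length_initialWord] at hsM
    rw [List.nil_append, List.append_assoc, List.append_assoc]
    exact append_mem_strictWords hv.1 (append_mem_strictWords hs'
      (h.initialWord_append_zeros_mem_strictWords fun j hj => ht j (by omega)))
  · rw [funext hφ]
    exact (HasBowenPropertyOn.mono hbowen hcore).add
      ((hasBowenPropertyOn_nearNonzero ha T).mono fun u hu => hu.2)

theorem exists_leadingZeros (N : ℕ) : ∃ x ∈ X.carrier, (∀ i < N, x i = 0) ∧ x N ≠ 0 := by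
  refine ⟨_, h.prepend_mem (h.replicate_mem_strictWords N) h.self_mem, fun i hi => ?_, ?_⟩
  · exact prepend_eq (by simp [hi])
  · have := prepend_length_add (List.replicate N 0) ω 0
    rw [List.length_replicate, add_zero] at this
    rw [this]
    exact h.zero_ne

end IsLexShift

/-! ### The expansion of one -/

theorem toLex_le_toLex_iff {x y : ℕ → ℤ} :
    toLex x ≤ toLex y ↔ ∀ n, (∀ i < n, x i = y i) → x n ≤ y n := by
  rw [← not_lt]
  refine (not_congr (b := ∃ n, (∀ i < n, y i = x i) ∧ y n < x n) Iff.rfl).trans ?_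
  push Not
  simp only [eq_comm]

theorem betaRemainder_succ (β : ℝ) (n : ℕ) :
    betaRemainder β (n + 1) = β * betaRemainder β n - betaDigit β n := rfl

theorem betaRemainder_mem {β : ℝ} (n : ℕ) :
    0 < betaRemainder β n ∧ betaRemainder β n ≤ 1 := by
  cases n with
  | zero => simp [betaRemainder]
  | succ n =>
    rw [betaRemainder_succ, betaDigit]
    have h1 := Int.le_ceil (β * betaRemainder β n)
    have h2 := Int.ceil_lt_add_one (β * betaRemainder β n)
    push_cast
    constructor <;> linarith

theorem betaDigit_nonneg {β : ℝ} (hβ : 1 < β) (n : ℕ) : 0 ≤ betaDigit β n := by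
  have h := (betaRemainder_mem (β := β) n).1
  have : 0 < ⌈β * betaRemainder β n⌉ := Int.ceil_pos.2 (by positivity)
  rw [betaDigit]; omega

theorem betaDigit_lt {β : ℝ} (hβ : 1 < β) (n : ℕ) : betaDigit β n < ⌈β⌉₊ := by
  have h := (betaRemainder_mem (β := β) n).2
  have h1 : ⌈β * betaRemainder β n⌉ ≤ ⌈β⌉ := Int.ceil_mono (by nlinarith)
  rw [betaDigit, Int.natCast_ceil_eq_ceil (by linarith)]
  omega

theorem one_le_betaDigit_zero {β : ℝ} (hβ : 1 < β) : 1 ≤ betaDigit β 0 := by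
  have : 1 < ⌈β * betaRemainder β 0⌉ := Int.lt_ceil.2 (by simpa [betaRemainder] using hβ)
  rw [betaDigit]; omega

/-- If all digits from N on vanished, the positive remainders would be multiplied by β forever, yet
they never exceed 1. -/
theorem exists_betaDigit_ne_zero {β : ℝ} (hβ : 1 < β) (N : ℕ) : ∃ n, betaDigit β (N + n) ≠ 0 := by
  by_contra! H
  have hpow : ∀ n, betaRemainder β (N + n) = β ^ n * betaRemainder β N := by
    intro n
    induction n with
    | zero => simp
    | succ n ih => rw [← add_assoc, betaRemainder_succ, H n, ih, Int.cast_zero]; ring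
  have h0 := (betaRemainder_mem (β := β) N).1
  obtain ⟨n, hn⟩ := pow_unbounded_of_one_lt (betaRemainder β N)⁻¹ hβ
  have h1 := (betaRemainder_mem (β := β) (N + n)).2
  rw [hpow] at h1
  rw [inv_lt_iff_one_lt_mul₀ h0] at hn
  linarith

/-- From r_k ≤ 1 = r_0 the inequality r_{k+i} ≤ r_i persists while the digits agree, and the next
digit is monotone in the remainder. -/
theorem betaDigit_add_le {β : ℝ} (hβ : 1 < β) (k n : ℕ)
    (h : ∀ i < n, betaDigit β (k + i) = betaDigit β i) : betaDigit β (k + n) ≤ betaDigit β n := by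
  have hle : ∀ i ≤ n, betaRemainder β (k + i) ≤ betaRemainder β i := by
    intro i
    induction i with
    | zero => intro _; exact (betaRemainder_mem _).2
    | succ i ih =>
      intro hi
      rw [← add_assoc, betaRemainder_succ, betaRemainder_succ, h i hi]
      have := mul_le_mul_of_nonneg_left (ih (by omega)) (by linarith : (0 : ℝ) ≤ β)
      linarith
  have := Int.ceil_mono (mul_le_mul_of_nonneg_left (hle n le_rfl) (by linarith : (0 : ℝ) ≤ β))
  rw [betaDigit, betaDigit]
  omega

theorem IsBetaShift.exists_isLexShift (hX : IsBetaShift X) : ∃ ω, IsLexShift X ω := by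
  obtain ⟨β, hβ, rfl, rfl⟩ := hX
  let ω : ℕ → Fin ⌈β⌉₊ := fun n => ⟨(betaDigit β n).toNat, by
    have h1 := betaDigit_lt hβ n
    have h2 := betaDigit_nonneg hβ n
    omega⟩
  have hω : ∀ n, betaDigit β n = ((ω n).val : ℤ) := fun n =>
    (Int.toNat_of_nonneg (betaDigit_nonneg hβ n)).symm
  have hne : ∀ n, ω n ≠ 0 ↔ betaDigit β n ≠ 0 := fun n => by
    rw [hω, Ne, Ne, Fin.ext_iff]; simp
  have hmem : ∀ x, x ∈ (betaShift β ⌈β⌉₊).carrier ↔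
      ∀ k n, (∀ i < n, x (k + i) = ω i) → x (k + n) ≤ ω n := by
    intro x
    change (∀ k, toLex (fun n => ((x (k + n)).val : ℤ)) ≤ toLex (betaDigit β)) ↔ _
    simp only [toLex_le_toLex_iff, hω, Nat.cast_inj, Nat.cast_le, Fin.val_inj, Fin.val_fin_le]
  refine ⟨ω, hmem, (hmem ω).2 fun k n hn => ?_, ?_, fun N => ?_⟩
  · have := betaDigit_add_le hβ k n fun i hi => by rw [hω, hω, hn i hi]
    rw [hω, hω] at this
    exact_mod_cast this
  · rw [hne]
    have := one_le_betaDigit_zero hβ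
    omega
  · obtain ⟨n, hn⟩ := exists_betaDigit_ne_zero hβ N
    exact ⟨n, (hne _).2 hn⟩

end Thermo

end

theorem theoremB {d : ℕ} [NeZero d] (X : Subshift (Fin d) ℕ)
    (hX : IsBetaShift X ∨ HasSpecification X)
    (h0 : (0 : ℕ → Fin d) ∈ X.carrier) (hne : X.carrier ≠ {0})
    (φ φr : X.carrier → ℝ) (a : ℕ → ℝ)
    (hφr : Continuous φr) (hbowen : HasBowenProperty X φr)
    (ha : Tendsto a atTop (𝓝 0))
    (hφ : ∀ x, φ x = φr x + leadingZeroPotential X a x) :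
    ((¬ ∃ C : ℝ, ∀ N : ℕ, |∑ n ∈ Finset.Icc 1 N, a n| ≤ C) → ¬ HasBowenProperty X φ) ∧
    (φ ⟨0, h0⟩ < pressure X φ →
      ∃ μ : Measure X.carrier,
        IsEquilibriumState X φ μ ∧
        (∀ ν : Measure X.carrier, IsEquilibriumState X φ ν → ν = μ) ∧
        IsWeakGibbs X φ μ ∧
        ∀ g : C(X.carrier, ℝ),
          Tendsto (fun n : ℕ => ∫ x, g x ∂(periodicOrbitMeasure X φ n)) atTop
            (𝓝 (∫ x, g x ∂μ))) := by
  have : Nonempty X.carrier := ⟨⟨0, h0⟩⟩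
  have hφc : Continuous φ := by
    rw [funext hφ]
    exact hφr.add (continuous_leadingZeroPotential ha)
  have hpts : ∀ N, ∃ x ∈ X.carrier, (∀ i < N, x i = 0) ∧ x N ≠ 0 := by
    intro N
    rcases hX with hX | hX
    · obtain ⟨ω, h⟩ := hX.exists_isLexShift
      exact h.exists_leadingZeros N
    · exact hX.exists_leadingZeros h0 hne N
  refine ⟨not_hasBowenProperty h0 hbowen hφ hpts, fun hP => ?_⟩
  obtain ⟨G, Cs, h⟩ : ∃ G Cs, IsAdaptedDecomposition X φ {[]} G Cs := by
    rcases hX with hX | hX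
    · obtain ⟨ω, h⟩ := hX.exists_isLexShift
      exact h.exists_isAdaptedDecomposition hφc hφr hbowen ha hφ h0 hP
    · exact ⟨_, _, hX.isAdaptedDecomposition h0 hφc hbowen ha hφ hP⟩
  exact h.exists_unique_equilibriumState hφc
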